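/- **Setting.** Let $n\in\mathbb N$, $d=n+1$, and work over $\mathbb R$. Let $\mathcal V$ be an NP-manifold of degree $n$ given in Darboux coordinates over an open subset of the space of its degree $0$ coordinates: coordinates $x^\mu,p_\mu$ of degrees $0,n$; $\psi^{\alpha_i},\chi_{\alpha_i}$ of degrees $i,n-i$ for $1\le i\le (n-1)/2$; and, for $n$ even, $\xi^a$ of degree $n/2$, with an invertible constant matrix $\kappa_{ab}=-(-1)^{n/2}\kappa_{ba}$; the symplectic form is $dx^\mu\wedge dp_\mu+\sum_i d\psi^{\alpha_i}\wedge d\chi_{\alpha_i}+\frac12\kappa_{ab}\,d\xi^a\wedge d\xi^b$. Functions on $\mathcal V$ are smooth in the coordinates of degree $0$ and polynomial (graded commutative) in the others. The Poisson bracket, of degree $-n$, is $\{f,g\}=\sum_{a,b}(-1)^{|f|\deg b}P^{ab}\,\partial_a f\,\partial_b g$, with $P$ the (constant) inverse of the symplectic form: $P^{x^\mu p_\mu}=P^{\psi\chi}=1$, $P^{\xi^a\xi^b}=\kappa^{ab}$, and $P^{ba}=(-1)^{n+1}(-1)^{\deg a\deg b}P^{ab}$. Let $\mathcal T^{(n)}_{\rm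 poly}=C^\infty(\mathcal V)[n]$, $s:\mathcal T^{(n)}_{\rm poly}\to C^\infty(\mathcal V)$ the suspension of degree $n$, and $[\cdot,\cdot]_S=s^{-1}\circ\{\cdot,\cdot\}\circ(s\otimes s)$ (the $n$-Schouten algebra). **Graphs.** $\mathsf{Gra}_d(N)$ is the graded space of (possibly infinite) linear combinations of directed graphs with $N$ numbered vertices and $k\ge0$ ordered edges (tadpoles and multiple edges allowed), in degree $k(1-d)$, modulo: permuting the edges by $\tau$ multiplies by $\operatorname{sgn}(\tau)^{d+1}$, reversing an edge multiplies by $(-1)^d$. It is an operad: $\gamma\circ_i\gamma'$ inserts $\gamma'$ in the vertex $i$ of $\gamma$ and sums over all ways of reconnecting the edge ends attached to $i$ to the vertices of $\gamma'$ (edges of $\gamma$ come first). The full graph complex $\mathsf{fGC}_d=\prod_{N\ge1}(\mathsf{Gra}_d(N)\otimes{\rm sgn}_N^{\otimes d}[d(1-N)])^{\mathbb S_N}$, in which a graph with $N$ vertices and $k$ edges has degree $d(N-1)+k(1-d)$, has the pre-Lie product $\gamma\circ\gamma'=\sum_\sigma \operatorname{sgn}(\sigma)^d\,(\gamma\circ_1\gamma')\cdot\sigma$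 over unshuffles $\sigma$ of type $(N',N-1)$, the graded commutator bracket $[\cdot,\cdot]$, and the differential $\delta=[\Gamma,\cdot]$, where $\Gamma$ is the graph with two vertices and one edge from $1$ to $2$. A Maurer–Cartan element is $\mathfrak m\in\mathsf{fGC}_d$ of degree $1$ with $\delta\mathfrak m+\frac12[\mathfrak m,\mathfrak m]=0$. For a graph $\gamma$ with $N$ vertices let ${\sf Rep}_N(\gamma)(f_1\otimes\cdots\otimes f_N)=\mu_N\big(\prod_{(i,j)\in E_\gamma}\Delta_{ij}(f_1\otimes\cdots\otimes f_N)\big)$, where $\Delta_{ij}=\sum_{a,b}P^{ab}\partial_a^{(i)}\partial_b^{(j)}$ (with Koszul signs) and $\mu_N$ is multiplication, and let $s^*{\sf Rep}(\gamma)=s^{-1}\circ{\sf Rep}_N(\gamma)\circ s^{\otimes N}$, so that $s^*{\sf Rep}(\Gamma)=[\cdot,\cdot]_S$. It is extended linearly and arity by arity. **Universal deformations.** Let ${\rm CE}^k(\mathcal T^{(n)}_{\rm poly})=\prod_{i+j=k}{\rm Hom}^i((\mathcal T^{(n)}_{\rm poly})^{\wedge (j+1)},\mathcal T^{(n)}_{\rm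 poly})$, with the Nijenhuis–Richardson bracket and $\delta_S=[[\cdot,\cdot]_S,\cdot]_{NR}$. A cochain $c$ is a *universal deformation of $(\mathcal T^{(n)}_{\rm poly},[\cdot,\cdot]_S)$ as a $\mathsf{Lie}_\infty$-algebra* if * $c\in{\rm CE}^1$ and $\delta_S c+\frac12[c,c]_{NR}=0$; * the arity components $l_N$, $N\ge1$, of $[\cdot,\cdot]_S+c$ are the brackets, $l_N$ of degree $2-N$, of a $\mathsf{Lie}_\infty$-algebra structure on $\mathcal T^{(n)}_{\rm poly}$; * this structure factors through the graph operad: there is $\gamma\in\mathsf{fGC}_d$ of degree $1$ with $[\gamma,\gamma]=0$, with finitely many numbers of edges in each arity, and with $[\cdot,\cdot]_S+c=s^*{\sf Rep}(\gamma)$. A family $(c_r)_{r\ge0}$ is a *formal* universal deformation if $\sum_r\epsilon^rc_r$ has the same properties $\mathbb R[[\epsilon]]$-linearly, $\epsilon$ a formal parameter of degree $0$ (with $\gamma=\sum_r\epsilon^r\gamma_r$, each $\gamma_r$ having finitely many numbers of edges in each arity). **Statement.** 1. If $n\ge1$, then for every Maurer–Cartan element $\mathfrak m$ of $(\mathsf{fGC}_d,\delta,[\cdot,\cdot])$,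 the cochain $s^*{\sf Rep}(\mathfrak m)$ is a universal deformation of the graded Lie algebra $(\mathcal T^{(n)}_{\rm poly},[\cdot,\cdot]_S)$ as a $\mathsf{Lie}_\infty$-algebra. 2. If $n=0$ (where $\mathfrak m$ may be an infinite series in the number of edges), then for every Maurer–Cartan element $\mathfrak m=\sum_{k}\mathfrak m_k$ of $\mathsf{fGC}_1$, $\mathfrak m_k$ being the part with $k$ edges, the family $c_r=s^*{\sf Rep}(\mathfrak m_{r+1})$ is a formal universal deformation. 3. For every $n$ and every formal Maurer–Cartan element $\sum_r\epsilon^r\mathfrak m_r$ of $\mathsf{fGC}_d[[\epsilon]]$, where each $\mathfrak m_r$ has finitely many numbers of edges in each arity (automatic for $n\ge1$), the family $c_r=s^*{\sf Rep}(\mathfrak m_r)$ is a formal universal deformation. -/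

import Mathlib

open scoped TensorProduct ContDiff

noncomputable section

namespace NPGraph

/-! ### The graph operad and the full graph complex -/

/-- Multidigraphs with `N` labelled vertices and `k` labelled directed edges (tadpoles and multiple
edges allowed): the edge `e` goes from `(G e).1` to `(G e).2`. -/
abbrev Multidigraph (N k : ℕ) : Type := Fin k → Fin N × Fin N

/-- Reverse the direction of the edge `e`. -/
def flipEdge {N k : ℕ} (e : Fin k) (G : Multidigraph N k) : Multidigraph N k :=
  Function.update G e (G e).swap

/-- The right action of `S_N`: the vertex label `v` becomes `σ⁻¹ v`. -/
def relabel {N k : ℕ} (σ : Equiv.Perm (Fin N)) (G : Multidigraph N k) : Multidigraph N k :=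
  fun e => (σ⁻¹ (G e).1, σ⁻¹ (G e).2)

/-- The relations defining the coinvariants: reordering the edges by `τ` costs
`sgn(τ)^(d+1)`, flipping an edge costs `(-1)^d`. -/
def graRel (d : ℤ) (N k : ℕ) : Submodule ℝ (Multidigraph N k →₀ ℝ) :=
  Submodule.span ℝ
    ({w | ∃ (G : Multidigraph N k) (τ : Equiv.Perm (Fin k)),
        w = Finsupp.single (G ∘ τ) 1 - (Equiv.Perm.sign τ) ^ (d + 1) • Finsupp.single G 1} ∪
     {w | ∃ (G : Multidigraph N k) (e : Fin k),
        w = Finsupp.single (flipEdge e G) 1 - (-1 : ℤˣ) ^ d • Finsupp.single G 1})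

/-- The part of `Gra_d(N)` with `k` edges; it sits in degree `k (1 - d)`, and `Gra_d(N)` is the
product of these spaces over all `k`. -/
abbrev Gra (d : ℤ) (N k : ℕ) : Type := (Multidigraph N k →₀ ℝ) ⧸ graRel d N k

/-- The class of a graph. -/
def Gra.mk (d : ℤ) {N k : ℕ} (G : Multidigraph N k) : Gra d N k :=
  (graRel d N k).mkQ (Finsupp.single G 1)

/-- To define a linear map on `Gra d N k` it suffices to give its values on graphs, compatibly with
the two kinds of relations. -/
def Gra.lift (d : ℤ) {N k : ℕ} {M : Type*} [AddCommGroup M] [Module ℝ M]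
    (F : Multidigraph N k → M)
    (hperm : ∀ (G : Multidigraph N k) (τ : Equiv.Perm (Fin k)),
      F (G ∘ τ) = (Equiv.Perm.sign τ) ^ (d + 1) • F G)
    (hflip : ∀ (G : Multidigraph N k) (e : Fin k), F (flipEdge e G) = (-1 : ℤˣ) ^ d • F G) :
    Gra d N k →ₗ[ℝ] M :=
  (graRel d N k).liftQ (Finsupp.linearCombination ℝ F) (by
    rw [graRel, Submodule.span_le]
    rintro w (⟨G, τ, rfl⟩ | ⟨G, e, rfl⟩)
    · simp [hperm, Units.smul_def, Int.cast_smul_eq_zsmul]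
    · simp [hflip, Units.smul_def, Int.cast_smul_eq_zsmul])

theorem Gra.mk_perm (d : ℤ) {N k : ℕ} (G : Multidigraph N k) (τ : Equiv.Perm (Fin k)) :
    Gra.mk d (G ∘ τ) = (Equiv.Perm.sign τ) ^ (d + 1) • Gra.mk d G := by
  rw [← sub_eq_zero]
  have h : (Finsupp.single (G ∘ τ) (1 : ℝ) -
      (Equiv.Perm.sign τ) ^ (d + 1) • Finsupp.single G (1 : ℝ)) ∈ graRel d N k :=
    Submodule.subset_span (Or.inl ⟨G, τ, rfl⟩)
  have h' := (Submodule.Quotient.mk_eq_zero _).2 h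
  rwa [← Submodule.mkQ_apply, map_sub, Units.smul_def, map_zsmul] at h'

theorem Gra.mk_flip (d : ℤ) {N k : ℕ} (G : Multidigraph N k) (e : Fin k) :
    Gra.mk d (flipEdge e G) = (-1 : ℤˣ) ^ d • Gra.mk d G := by
  rw [← sub_eq_zero]
  have h : (Finsupp.single (flipEdge e G) (1 : ℝ) -
      (-1 : ℤˣ) ^ d • Finsupp.single G (1 : ℝ)) ∈ graRel d N k :=
    Submodule.subset_span (Or.inr ⟨G, e, rfl⟩)
  have hq := (Submodule.Quotient.mk_eq_zero _).2 h
  rwa [← Submodule.mkQ_apply, map_sub, Units.smul_def, map_zsmul] at hq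

/-- The right action `Σ_N( · | σ)` of the symmetric group on `Gra_d(N)`. -/
def Gra.act (d : ℤ) {N k : ℕ} (σ : Equiv.Perm (Fin N)) : Gra d N k →ₗ[ℝ] Gra d N k :=
  Gra.lift d (fun G => Gra.mk d (relabel σ G))
    (fun G τ => Gra.mk_perm d (relabel σ G) τ)
    (fun G e => by
      rw [← Gra.mk_flip d (relabel σ G) e]
      congr 1
      funext e'
      by_cases h : e' = e
      · subst h; simp [relabel, flipEdge]
      · simp [relabel, flipEdge, h])

/-- The vertices of `γ ∘₁ γ'`, where `γ` has `p + 1` and `γ'` has `q + 1` vertices, are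
`0, …, p + q`. The first `q + 1` of them come from `γ'` and are collapsed to the first vertex of
`γ`; the vertex `q + i` comes from the vertex `i` of `γ`. -/
def collapse {p q P : ℕ} (h : p + q = P) (v : Fin (P + 1)) : Fin (p + 1) :=
  ⟨v.1 - q, by omega⟩

/-- Position in `γ ∘₁ γ'` of the vertices of `γ'`. -/
def embed {p q P : ℕ} (h : p + q = P) (v : Fin (q + 1)) : Fin (P + 1) :=
  ⟨v.1, by omega⟩

/-- The edges `E` (coming from `γ`) followed by the edges of `γ'`. -/
def glue {p q P j k K : ℕ} (h : p + q = P) (hK : j + k = K)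
    (E : Multidigraph (P + 1) j) (H : Multidigraph (q + 1) k) : Multidigraph (P + 1) K :=
  fun e => Fin.append E (fun e' => (embed h (H e').1, embed h (H e').2)) (Fin.cast hK.symm e)

/-- `E` is obtained from the graph `G` by reconnecting every edge end attached to the first vertex
to one of the first `q + 1` vertices. -/
def IsReconnection {p q P j : ℕ} (h : p + q = P) (G : Multidigraph (p + 1) j)
    (E : Multidigraph (P + 1) j) : Prop :=
  ∀ e, (collapse h (E e).1, collapse h (E e).2) = G e

open Classical in
/-- The partial composition `G ∘₁ H` of two graphs: insert `H` in place of the first vertex of `G`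
and sum over all the ways of reconnecting to the vertices of `H` the edge ends (of `G`) that were
attached to this vertex. -/
def compGraph (d : ℤ) {p q P j k K : ℕ} (h : p + q = P) (hK : j + k = K)
    (G : Multidigraph (p + 1) j) (H : Multidigraph (q + 1) k) : Gra d (P + 1) K :=
  ∑ E : Multidigraph (P + 1) j,
    if IsReconnection h G E then Gra.mk d (glue h hK E H) else 0

theorem glue_perm_right {p q P j k K : ℕ} (h : p + q = P) (hK : j + k = K)
    (E : Multidigraph (P + 1) j) (H : Multidigraph (q + 1) k) (τ : Equiv.Perm (Fin k)) :
    ∃ τ' : Equiv.Perm (Fin K), Equiv.Perm.sign τ' = Equiv.Perm.sign τ ∧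
      glue h hK E (H ∘ τ) = glue h hK E H ∘ τ' := by
  subst hK
  refine ⟨finSumFinEquiv.permCongr (Equiv.Perm.sumCongr 1 τ), by simp, ?_⟩
  funext e
  obtain ⟨e, rfl⟩ := finSumFinEquiv.surjective e
  rcases e with e | e <;> simp [glue, Equiv.permCongr_apply]

theorem glue_perm_left {p q P j k K : ℕ} (h : p + q = P) (hK : j + k = K)
    (E : Multidigraph (P + 1) j) (H : Multidigraph (q + 1) k) (τ : Equiv.Perm (Fin j)) :
    ∃ τ' : Equiv.Perm (Fin K), Equiv.Perm.sign τ' = Equiv.Perm.sign τ ∧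
      glue h hK (E ∘ τ) H = glue h hK E H ∘ τ' := by
  subst hK
  refine ⟨finSumFinEquiv.permCongr (Equiv.Perm.sumCongr τ 1), by simp, ?_⟩
  funext e
  obtain ⟨e, rfl⟩ := finSumFinEquiv.surjective e
  rcases e with e | e <;> simp [glue, Equiv.permCongr_apply]

theorem glue_flip_right {p q P j k K : ℕ} (h : p + q = P) (hK : j + k = K)
    (E : Multidigraph (P + 1) j) (H : Multidigraph (q + 1) k) (e : Fin k) :
    ∃ e' : Fin K, glue h hK E (flipEdge e H) = flipEdge e' (glue h hK E H) := by
  subst hK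
  refine ⟨Fin.natAdd j e, ?_⟩
  funext e'
  refine Fin.addCases (fun i => ?_) (fun i => ?_) e'
  · have hne : Fin.castAdd k i ≠ Fin.natAdd j e := by
      intro hh; have := congrArg Fin.val hh; simp at this; omega
    simp [glue, flipEdge, hne]
  · by_cases hi : i = e
    · subst hi; simp [glue, flipEdge]
    · have hne : Fin.natAdd j i ≠ Fin.natAdd j e := by
        intro hh; exact hi (by simpa using hh)
      simp [glue, flipEdge, hi]

theorem glue_flip_left {p q P j k K : ℕ} (h : p + q = P) (hK : j + k = K)
    (E : Multidigraph (P + 1) j) (H : Multidigraph (q + 1) k) (e : Fin j) :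
    ∃ e' : Fin K, glue h hK (flipEdge e E) H = flipEdge e' (glue h hK E H) := by
  subst hK
  refine ⟨Fin.castAdd k e, ?_⟩
  funext e'
  refine Fin.addCases (fun i => ?_) (fun i => ?_) e'
  · by_cases hi : i = e
    · subst hi; simp [glue, flipEdge]
    · have hne : Fin.castAdd k i ≠ Fin.castAdd k e := by
        intro hh; exact hi (by simpa using hh)
      simp [glue, flipEdge, hi]
  · have hne : Fin.natAdd j i ≠ Fin.castAdd k e := by
      intro hh; have := congrArg Fin.val hh; simp at this; omega
    simp [glue, flipEdge, hne]

theorem flipEdge_flipEdge {N k : ℕ} (e : Fin k) (G : Multidigraph N k) :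
    flipEdge e (flipEdge e G) = G := by
  simp [flipEdge]

theorem isReconnection_flip {p q P j : ℕ} (h : p + q = P) (G : Multidigraph (p + 1) j)
    (E : Multidigraph (P + 1) j) (e : Fin j) (hE : IsReconnection h G E) :
    IsReconnection h (flipEdge e G) (flipEdge e E) := by
  intro ej
  by_cases hi : ej = e
  · subst hi; simp [flipEdge, ← hE ej]
  · simpa [flipEdge, hi] using hE ej

/-- The partial composition `∘₁` of the operad `Gra_d`. -/
def Gra.comp (d : ℤ) {p q P j k K : ℕ} (h : p + q = P) (hK : j + k = K) :
    Gra d (p + 1) j →ₗ[ℝ] Gra d (q + 1) k →ₗ[ℝ] Gra d (P + 1) K :=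
  Gra.lift d
    (fun G => Gra.lift d (fun H => compGraph d h hK G H)
      (fun H τ => by
        classical
        rw [compGraph, compGraph, Finset.smul_sum]
        refine Finset.sum_congr rfl fun E _ => ?_
        obtain ⟨τ', hs, he⟩ := glue_perm_right h hK E H τ
        rw [he, Gra.mk_perm, hs, smul_ite, smul_zero])
      (fun H e => by
        classical
        rw [compGraph, compGraph, Finset.smul_sum]
        refine Finset.sum_congr rfl fun E _ => ?_
        obtain ⟨e', he⟩ := glue_flip_right h hK E H e
        rw [he, Gra.mk_flip, smul_ite, smul_zero]))
    (fun G τ => by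
      classical
      refine Submodule.linearMap_qext _ (Finsupp.lhom_ext' fun H => LinearMap.ext_ring ?_)
      simp only [Gra.lift, LinearMap.comp_apply, Finsupp.lsingle_apply, Units.smul_def,
        LinearMap.smul_apply, Submodule.mkQ_apply, Submodule.liftQ_apply,
        Finsupp.linearCombination_single, one_smul]
      rw [← Units.smul_def, compGraph, compGraph, Finset.smul_sum]
      symm
      refine Fintype.sum_equiv (Equiv.arrowCongr τ.symm (Equiv.refl _)) _ _ fun E => ?_
      have hE : (Equiv.arrowCongr τ.symm (Equiv.refl _)) E = E ∘ τ := by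
        funext e; simp
      rw [hE]
      obtain ⟨τ', hs, he⟩ := glue_perm_left h hK E H τ
      have hiff : IsReconnection h (G ∘ τ) (E ∘ τ) ↔ IsReconnection h G E :=
        ⟨fun hh e => by simpa using hh (τ.symm e), fun hh e => hh (τ e)⟩
      rw [he, Gra.mk_perm, hs, smul_ite, smul_zero]
      simp only [hiff])
    (fun G e => by
      classical
      refine Submodule.linearMap_qext _ (Finsupp.lhom_ext' fun H => LinearMap.ext_ring ?_)
      simp only [Gra.lift, LinearMap.comp_apply, Finsupp.lsingle_apply, Units.smul_def,
        LinearMap.smul_apply, Submodule.mkQ_apply, Submodule.liftQ_apply,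
        Finsupp.linearCombination_single, one_smul]
      rw [← Units.smul_def, compGraph, compGraph, Finset.smul_sum]
      symm
      refine Fintype.sum_equiv
        (Function.Involutive.toPerm (flipEdge e) (flipEdge_flipEdge e)) _ _ fun E => ?_
      change _ = if IsReconnection h (flipEdge e G) (flipEdge e E) then
        Gra.mk d (glue h hK (flipEdge e E) H) else 0
      obtain ⟨e', he⟩ := glue_flip_left h hK E H e
      have hiff : IsReconnection h (flipEdge e G) (flipEdge e E) ↔ IsReconnection h G E :=
        ⟨fun hh => by
          simpa [flipEdge_flipEdge] using isReconnection_flip h _ _ e hh,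
          fun hh => isReconnection_flip h _ _ e hh⟩
      rw [he, Gra.mk_flip, smul_ite, smul_zero]
      simp only [hiff])

/-- `σ` is an unshuffle of type `(a, N - a)`: the inverse permutation is increasing on the first `a`
and on the last `N - a` elements. -/
def IsUnshuffle (a : ℕ) {N : ℕ} (σ : Equiv.Perm (Fin N)) : Prop :=
  ∀ i j : Fin N, i < j → (j.1 < a ∨ a ≤ i.1) → σ⁻¹ i < σ⁻¹ j

/-- Families of elements of `Gra_d(p + 1)`, `p ≥ 0`, i.e. elements of the product over all numbers
of vertices `N = p + 1 ≥ 1` and of edges `k ≥ 0`. -/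
abbrev GraphSeries (d : ℤ) : Type := (p k : ℕ) → Gra d (p + 1) k

/-- Degree in the full graph complex of a graph with `N = p + 1` vertices and `k` edges,
`d (N - 1) + k (1 - d)`. -/
def graphDegree (d : ℤ) (p k : ℕ) : ℤ := d * p + k * (1 - d)

/-- The full graph complex `fGC_d`: the invariants for the action of the symmetric groups on the
vertices, twisted by the signature when `d` is odd. -/
def fGC (d : ℤ) : Submodule ℝ (GraphSeries d) where
  carrier := {m | ∀ (p k : ℕ) (σ : Equiv.Perm (Fin (p + 1))),
    (Equiv.Perm.sign σ) ^ d • Gra.act d σ (m p k) = m p k}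
  add_mem' := by
    intro a b ha hb p k σ
    simp only [Pi.add_apply, map_add, smul_add, ha p k σ, hb p k σ]
  zero_mem' := by
    intro p k σ
    simp
  smul_mem' := by
    intro c a ha p k σ
    simp only [Pi.smul_apply, map_smul]
    rw [smul_comm, ha p k σ]

/-- `m` is homogeneous of degree `i`. -/
def HasDegree {d : ℤ} (i : ℤ) (m : GraphSeries d) : Prop :=
  ∀ p k, graphDegree d p k ≠ i → m p k = 0

open Classical in
/-- The pre-Lie product of `fGC_d` on homogeneous components (`p + 1` and `q + 1` vertices, `j` and
`k` edges). -/
def preLie (d : ℤ) {p q P j k K : ℕ} (h : p + q = P) (hK : j + k = K)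
    (γ : Gra d (p + 1) j) (γ' : Gra d (q + 1) k) : Gra d (P + 1) K :=
  ∑ σ : Equiv.Perm (Fin (P + 1)),
    if IsUnshuffle (q + 1) σ then
      (Equiv.Perm.sign σ) ^ d • Gra.act d σ (Gra.comp d h hK γ γ') else 0

/-- The graded Lie bracket of `fGC_d`: the graded commutator of the pre-Lie product. -/
def bracket {d : ℤ} (m m' : GraphSeries d) : GraphSeries d := fun P K =>
  ∑ x : Finset.HasAntidiagonal.antidiagonal P, ∑ y : Finset.HasAntidiagonal.antidiagonal K,
    (preLie d (Finset.HasAntidiagonal.mem_antidiagonal.1 x.2)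
        (Finset.HasAntidiagonal.mem_antidiagonal.1 y.2)
        (m x.1.1 y.1.1) (m' x.1.2 y.1.2)
      - (-1 : ℤˣ) ^ (graphDegree d x.1.1 y.1.1 * graphDegree d x.1.2 y.1.2) •
        preLie d ((add_comm _ _).trans (Finset.HasAntidiagonal.mem_antidiagonal.1 x.2))
          ((add_comm _ _).trans (Finset.HasAntidiagonal.mem_antidiagonal.1 y.2))
          (m' x.1.2 y.1.2) (m x.1.1 y.1.1))

/-- The graph with two vertices `1`, `2` and one edge, from `1` to `2`, as an element of `fGC_d`. -/
def edgeGraph (d : ℤ) : GraphSeries d := fun p k =>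
  if p = 1 ∧ k = 1 then Gra.mk d (fun _ => (0, Fin.last p)) else 0

/-- The differential of `fGC_d`. -/
def differential {d : ℤ} (m : GraphSeries d) : GraphSeries d := bracket (edgeGraph d) m

/-- Maurer–Cartan elements of the dg Lie algebra `fGC_d`: elements `m` of degree `1` with
`δ m + ½ [m, m] = 0`. -/
structure IsMaurerCartan {d : ℤ} (m : GraphSeries d) : Prop where
  mem : m ∈ fGC d
  degree : HasDegree 1 m
  eqn : differential m + (1 / 2 : ℝ) • bracket m m = 0

/-- Every arity component involves finitely many numbers of edges only. -/
def HasFiniteEdges {d : ℤ} (m : GraphSeries d) : Prop :=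
  ∀ p, {k | m p k ≠ 0}.Finite

/-- Maurer–Cartan elements `∑ r, ε ^ r m_r` of the dg Lie algebra `fGC_d[[ε]]`. -/
structure IsFormalMaurerCartan {d : ℤ} (m : ℕ → GraphSeries d) : Prop where
  mem : ∀ r, m r ∈ fGC d
  degree : ∀ r, HasDegree 1 (m r)
  eqn : ∀ r, differential (m r) +
    (1 / 2 : ℝ) • ∑ ij ∈ Finset.HasAntidiagonal.antidiagonal r, bracket (m ij.1) (m ij.2) = 0

/-- The part of `m` with exactly `k` edges. -/
def edgePart {d : ℤ} (k : ℕ) (m : GraphSeries d) : GraphSeries d := fun p k' =>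
  if k' = k then m p k' else 0

/-! ### Functions on an NP-manifold in Darboux coordinates -/

/-- Homogeneous Darboux coordinates of degree `n`: `x^μ` (degree `0`), `p_μ` (degree `n`),
`ψ^α_i` (degree `i`), `χ_{α,i}` (degree `n - i`), `ξ^a` (degree `n / 2`). The integer `i` with
`1 ≤ i ≤ (n - 1) / 2` is represented by the element `i - 1` of `Fin ((n - 1) / 2)`. -/
inductive Coord (n m s : ℕ) (r : Fin ((n - 1) / 2) → ℕ) : Type
  | x (μ : Fin m)
  | p (μ : Fin m)
  | psi (i : Fin ((n - 1) / 2)) (α : Fin (r i))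
  | chi (i : Fin ((n - 1) / 2)) (α : Fin (r i))
  | xi (a : Fin s)
  deriving DecidableEq, Fintype

/-- Degree of a coordinate. -/
def Coord.deg {n m s : ℕ} {r : Fin ((n - 1) / 2) → ℕ} : Coord n m s r → ℕ
  | .x _ => 0
  | .p _ => n
  | .psi i _ => i.1 + 1
  | .chi i _ => n - (i.1 + 1)
  | .xi _ => n / 2

/-- An NP-manifold of degree `n` presented by global Darboux coordinates: the numbers of coordinates
of each kind (coordinates `ξ^a` exist for even `n` only), the constant matrix `κ_{ab}`, which is
invertible with `κ_{ab} = -(-1)^(n/2) κ_{ba}`, and the open subset of the space of the degree `0`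
coordinates that is the base. -/
structure NPDomain (n : ℕ) where
  m : ℕ
  r : Fin ((n - 1) / 2) → ℕ
  s : ℕ
  s_eq_zero : Odd n → s = 0
  κ : Matrix (Fin s) (Fin s) ℝ
  κ_det : IsUnit κ.det
  κ_symm : ∀ a b, κ a b = -(-1) ^ (n / 2) * κ b a
  base : TopologicalSpace.Opens ({c : Coord n m s r // c.deg = 0} → ℝ)

/-- Smooth real functions on an open subset `U` of `ℝ^ι`. -/
def SmoothFun {ι : Type} [Fintype ι] (U : TopologicalSpace.Opens (ι → ℝ)) :
    Subalgebra ℝ (U → ℝ) where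
  carrier := {f | ∃ g : (ι → ℝ) → ℝ, ContDiffOn ℝ ∞ g U ∧ ∀ u : U, f u = g u}
  mul_mem' := by
    rintro a b ⟨g, hg, ha⟩ ⟨g', hg', hb⟩
    exact ⟨fun x => g x * g' x, hg.mul hg', fun u => by simp [ha, hb]⟩
  add_mem' := by
    rintro a b ⟨g, hg, ha⟩ ⟨g', hg', hb⟩
    exact ⟨fun x => g x + g' x, hg.add hg', fun u => by simp [ha, hb]⟩
  algebraMap_mem' := fun c => ⟨fun _ => c, contDiffOn_const, fun u => rfl⟩

/-- Extension by zero of a function on `U`. -/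
def extendFun {ι : Type} {U : TopologicalSpace.Opens (ι → ℝ)} (f : U → ℝ) : (ι → ℝ) → ℝ :=
  Function.extend Subtype.val f 0

theorem extendFun_apply {ι : Type} {U : TopologicalSpace.Opens (ι → ℝ)} (f : U → ℝ) (u : U) :
    extendFun f u = f u :=
  Subtype.val_injective.extend_apply f 0 u

theorem contDiffOn_extendFun {ι : Type} [Fintype ι] {U : TopologicalSpace.Opens (ι → ℝ)}
    (f : SmoothFun U) : ContDiffOn ℝ ∞ (extendFun f.1) U := by
  obtain ⟨f, g, hg, h⟩ := f
  exact hg.congr fun x hx => by rw [← h ⟨x, hx⟩]; exact extendFun_apply f ⟨x, hx⟩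

theorem differentiableAt_extendFun {ι : Type} [Fintype ι] {U : TopologicalSpace.Opens (ι → ℝ)}
    (f : SmoothFun U) (u : U) : DifferentiableAt ℝ (extendFun f.1) u :=
  ((contDiffOn_extendFun f).differentiableOn (by simp)).differentiableAt (U.2.mem_nhds u.2)

/-- Partial derivative of a smooth function on `U` in the direction of the coordinate `i`. -/
def partialDeriv {ι : Type} [Fintype ι] [DecidableEq ι] {U : TopologicalSpace.Opens (ι → ℝ)}
    (i : ι) : Module.End ℝ (SmoothFun U) where
  toFun f := ⟨fun u => fderiv ℝ (extendFun f.1) u (Pi.single i 1),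
    fun y => fderiv ℝ (extendFun f.1) y (Pi.single i 1),
    ((contDiffOn_extendFun f).fderiv_of_isOpen U.2 (by simp)).clm_apply contDiffOn_const,
    fun _ => rfl⟩
  map_add' f g := by
    ext u
    have h : extendFun (f + g).1 = extendFun f.1 + extendFun g.1 := by
      funext y
      by_cases hy : ∃ u : U, u.1 = y
      · obtain ⟨u, rfl⟩ := hy
        simp [extendFun_apply]
      · simp [extendFun, Function.extend_apply' _ _ _ hy]
    change fderiv ℝ (extendFun (f + g).1) u (Pi.single i 1) = _
    rw [h, fderiv_add (differentiableAt_extendFun f u) (differentiableAt_extendFun g u)]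
    rfl
  map_smul' c f := by
    ext u
    have h : extendFun (c • f).1 = c • extendFun f.1 := by
      funext y
      by_cases hy : ∃ u : U, u.1 = y
      · obtain ⟨u, rfl⟩ := hy
        simp [extendFun_apply]
      · simp [extendFun, Function.extend_apply' _ _ _ hy]
    change fderiv ℝ (extendFun (c • f).1) u (Pi.single i 1) = _
    rw [h, fderiv_const_smul (differentiableAt_extendFun f u)]
    rfl

theorem partialDeriv_comm {ι : Type} [Fintype ι] [DecidableEq ι]
    {U : TopologicalSpace.Opens (ι → ℝ)} (i j : ι) :
    partialDeriv (U := U) i * partialDeriv j = partialDeriv j * partialDeriv i := by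
  have key : ∀ (f : SmoothFun U) (u : U) (i j : ι),
      (partialDeriv i (partialDeriv j f)).1 u =
        fderiv ℝ (fderiv ℝ (extendFun f.1)) u (Pi.single i 1) (Pi.single j 1) := by
    intro f u i j
    have hd : DifferentiableAt ℝ (fderiv ℝ (extendFun f.1)) u :=
      (((contDiffOn_extendFun f).fderiv_of_isOpen (m := 1) U.2
        (WithTop.coe_le_coe.2 le_top)).differentiableOn one_ne_zero).differentiableAt (U.2.mem_nhds u.2)
    have he : extendFun (partialDeriv j f).1 =ᶠ[nhds u.1]
        fun y => fderiv ℝ (extendFun f.1) y (Pi.single j 1) := by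
      filter_upwards [U.2.mem_nhds u.2] with y hy
      exact extendFun_apply (partialDeriv j f).1 ⟨y, hy⟩
    change fderiv ℝ (extendFun (partialDeriv j f).1) u (Pi.single i 1) = _
    rw [he.fderiv_eq, fderiv_clm_apply hd (differentiableAt_const _)]
    simp
  refine LinearMap.ext fun f => Subtype.ext (funext fun u => ?_)
  refine (key f u i j).trans (Eq.trans ?_ (key f u j i).symm)
  have hs : IsSymmSndFDerivAt ℝ (extendFun f.1) u.1 :=
    ((contDiffOn_extendFun f).contDiffAt (U.2.mem_nhds u.2)).isSymmSndFDerivAt (by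
      rw [minSmoothness_of_isRCLikeNormedField]; exact WithTop.coe_le_coe.2 le_top)
  exact hs _ _

theorem pderiv_comm' {σ : Type} (i j : σ) (f : MvPolynomial σ ℝ) :
    MvPolynomial.pderiv i (MvPolynomial.pderiv j f) =
      MvPolynomial.pderiv j (MvPolynomial.pderiv i f) := by
  have h : ⁅MvPolynomial.pderiv (R := ℝ) i, MvPolynomial.pderiv (R := ℝ) j⁆ = 0 := by
    classical
    refine MvPolynomial.derivation_ext fun k => ?_
    rw [Derivation.commutator_apply]
    simp only [MvPolynomial.pderiv_X, Derivation.coe_zero, Pi.zero_apply]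
    by_cases hi : i = k <;> by_cases hj : j = k <;> simp [hi, hj]
  have h' := congrArg (fun D : Derivation ℝ (MvPolynomial σ ℝ) (MvPolynomial σ ℝ) => D f) h
  simpa [Derivation.commutator_apply, sub_eq_zero] using h'

theorem involute_contractLeft' {M : Type} [AddCommGroup M] [Module ℝ M]
    (φ : Module.Dual ℝ M) (x : ExteriorAlgebra ℝ M) :
    CliffordAlgebra.involute (Q := (0 : QuadraticForm ℝ M)) (CliffordAlgebra.contractLeft φ x) =
      -CliffordAlgebra.contractLeft φ (CliffordAlgebra.involute (Q := (0 : QuadraticForm ℝ M)) x) := by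
  induction x using CliffordAlgebra.left_induction with
  | algebraMap r => simp
  | add x y hx hy => simp only [map_add, hx, hy, neg_add]
  | ι_mul x m hx =>
    rw [CliffordAlgebra.contractLeft_ι_mul, map_sub, map_smul, map_mul, map_mul,
      CliffordAlgebra.involute_ι, hx, neg_mul, neg_mul, map_neg, CliffordAlgebra.contractLeft_ι_mul]
    simp

theorem map_slot_mul {V : Type} [AddCommGroup V] [Module ℝ V] {N : ℕ}
    (π π' δ δ' : Module.End ℝ V) (c : ℝ) (i j : Fin N) (h1 : π * π' = π' * π)
    (h2 : δ * π' = c • (π' * δ)) (h3 : π * δ' = c • (δ' * π)) (h4 : δ * δ' = c • (δ' * δ)) :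
    (PiTensorProduct.map (fun s => if s < i then π else if s = i then δ else 1) *
      PiTensorProduct.map (fun s => if s < j then π' else if s = j then δ' else 1) :
        Module.End ℝ (⨂[ℝ] _ : Fin N, V)) =
      c • (PiTensorProduct.map (fun s => if s < j then π' else if s = j then δ' else 1) *
        PiTensorProduct.map (fun s => if s < i then π else if s = i then δ else 1)) := by
  have key : ∀ (L L' : Fin N → Module.End ℝ V) (t : Fin N),
      (∀ s, s ≠ t → L s = L' s) → L t = c • L' t →
      (PiTensorProduct.map L : Module.End ℝ (⨂[ℝ] _ : Fin N, V)) =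
        c • PiTensorProduct.map L' := by
    intro L L' t h1 h2
    have hL : L = Function.update L' t (c • L' t) := by
      funext s
      by_cases hs : s = t
      · subst hs; simp [h2]
      · simp [hs, h1 s hs]
    rw [hL, PiTensorProduct.map_update_smul, Function.update_eq_self]
  rw [← PiTensorProduct.map_mul, ← PiTensorProduct.map_mul]
  rcases lt_trichotomy i j with hij | rfl | hij
  · refine key _ _ i (fun s hs => ?_) ?_
    · by_cases h1' : s < i
      · simp [h1', h1'.trans hij, h1]
      · simp only [if_neg h1', if_neg hs, one_mul, mul_one]
    · simp [hij, h2]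
  · refine key _ _ i (fun s hs => ?_) ?_
    · by_cases h1' : s < i
      · simp [h1', h1]
      · simp [h1', hs]
    · simpa using h4
  · refine key _ _ j (fun s hs => ?_) ?_
    · by_cases h1' : s < j
      · simp [h1', h1'.trans hij, h1]
      · simp only [if_neg h1', if_neg hs, one_mul, mul_one]
    · simp [hij, h3]

theorem sum_pairing_mul {A C : Type} [Ring A] [Algebra ℝ A] [Fintype C] (P : C → C → ℝ)
    (deg : C → ℕ) (n : ℕ) (hP : ∀ a b, P a b ≠ 0 → deg a + deg b = n) (S T S' T' : C → A)
    (h1 : ∀ a b, S a * S' b = (-1 : ℝ) ^ (deg a * deg b) • (S' b * S a))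
    (h2 : ∀ a b, S a * T' b = (-1 : ℝ) ^ (deg a * deg b) • (T' b * S a))
    (h3 : ∀ a b, T a * S' b = (-1 : ℝ) ^ (deg a * deg b) • (S' b * T a))
    (h4 : ∀ a b, T a * T' b = (-1 : ℝ) ^ (deg a * deg b) • (T' b * T a)) :
    (∑ a, ∑ b, P a b • (S a * T b)) * (∑ a, ∑ b, P a b • (S' a * T' b)) =
      (-1 : ℝ) ^ n • ((∑ a, ∑ b, P a b • (S' a * T' b)) * (∑ a, ∑ b, P a b • (S a * T b))) := by
  have hcomm : ∀ a b a' b', (P a b • (S a * T b)) * (P a' b' • (S' a' * T' b')) =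
      (-1 : ℝ) ^ n • ((P a' b' • (S' a' * T' b')) * (P a b • (S a * T b))) := by
    intro a b a' b'
    by_cases hab : P a b = 0
    · simp [hab]
    by_cases hab' : P a' b' = 0
    · simp [hab']
    have e1 := hP a b hab
    have e2 := hP a' b' hab'
    have : S a * T b * (S' a' * T' b') = (-1 : ℝ) ^ n • (S' a' * T' b' * (S a * T b)) := by
      calc S a * T b * (S' a' * T' b') = S a * (T b * S' a') * T' b' := by simp only [mul_assoc]
        _ = (-1 : ℝ) ^ (deg b * deg a') • ((S a * S' a') * (T b * T' b')) := by
            rw [h3]; simp only [mul_smul_comm, smul_mul_assoc, mul_assoc]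
        _ = ((-1 : ℝ) ^ (deg b * deg a') * ((-1) ^ (deg a * deg a') * (-1) ^ (deg b * deg b'))) •
              (S' a' * (S a * T' b') * T b) := by
            rw [h1, h4, mul_comm ((-1 : ℝ) ^ (deg a * deg a'))]
            simp only [mul_smul_comm, smul_mul_assoc, mul_assoc, smul_smul]
        _ = ((-1 : ℝ) ^ (deg b * deg a') * ((-1) ^ (deg a * deg a') * (-1) ^ (deg b * deg b')) *
              (-1) ^ (deg a * deg b')) • (S' a' * T' b' * (S a * T b)) := by
            rw [h2]; simp only [mul_smul_comm, smul_mul_assoc, mul_assoc, smul_smul]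
        _ = _ := by
            congr 1
            rw [← pow_add, ← pow_add, ← pow_add]
            have : deg b * deg a' + (deg a * deg a' + deg b * deg b') + deg a * deg b' = n * n := by
              nth_rewrite 1 [← e1]; rw [← e2]; ring
            rw [this, pow_mul]
            rcases Nat.even_or_odd n with hn | hn <;> simp [hn.neg_one_pow]
    rw [smul_mul_smul_comm, smul_mul_smul_comm, this, smul_comm, mul_comm (P a b)]
  have hl : ∀ X : A, ∀ Y : A, (∀ a' b', X * (P a' b' • (S' a' * T' b')) =
      (-1 : ℝ) ^ n • ((P a' b' • (S' a' * T' b')) * X)) →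
      X * (∑ a, ∑ b, P a b • (S' a * T' b)) =
        (-1 : ℝ) ^ n • ((∑ a, ∑ b, P a b • (S' a * T' b)) * X) := by
    intro X _ hX
    simp only [Finset.mul_sum, Finset.sum_mul, Finset.smul_sum, hX]
  rw [Finset.sum_mul, Finset.mul_sum, Finset.smul_sum]
  refine Finset.sum_congr rfl fun a _ => ?_
  rw [Finset.sum_mul, Finset.mul_sum, Finset.smul_sum]
  refine Finset.sum_congr rfl fun b _ => ?_
  exact hl _ 0 fun a' b' => hcomm a b a' b'

theorem sum_pairing_swap {A C : Type} [Ring A] [Algebra ℝ A] [Fintype C] (P : C → C → ℝ)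
    (deg : C → ℕ) (n : ℕ)
    (hP : ∀ a b, P b a = (-1) ^ (n + 1) * (-1) ^ (deg a * deg b) * P a b) (S T : C → A)
    (h : ∀ a b, T a * S b = (-1 : ℝ) ^ (deg a * deg b) • (S b * T a)) :
    (∑ a, ∑ b, P a b • (T a * S b)) = (-1 : ℝ) ^ (n + 1) • ∑ a, ∑ b, P a b • (S a * T b) := by
  rw [Finset.sum_comm, Finset.smul_sum]
  refine Finset.sum_congr rfl fun a _ => ?_
  rw [Finset.smul_sum]
  refine Finset.sum_congr rfl fun b _ => ?_
  rw [h, hP a b, smul_smul, smul_smul]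
  congr 1
  have : ((-1 : ℝ) ^ (deg b * deg a)) * (-1) ^ (deg b * deg a) = 1 := by
    rw [← mul_pow]; simp
  rw [mul_comm (deg a)]
  linear_combination (-1 : ℝ) ^ (n + 1) * P a b * this

theorem prod_ofFn_perm {A : Type} [Ring A] (ε : ℤˣ) {k : ℕ} (g : Fin k → A)
    (hg : ∀ i j, g i * g j = ε • (g j * g i)) (τ : Equiv.Perm (Fin k)) (φ : ℤˣ →* ℤˣ)
    (hφ : φ (-1) = ε) :
    (List.ofFn (g ∘ τ)).prod = φ (Equiv.Perm.sign τ) • (List.ofFn g).prod := by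
  have hadj : ∀ (k : ℕ) (i : Fin k) (g : Fin (k + 1) → A),
      (∀ i j, g i * g j = ε • (g j * g i)) →
      (List.ofFn (g ∘ Equiv.swap i.castSucc i.succ)).prod = ε • (List.ofFn g).prod := by
    intro k
    induction k with
    | zero => intro i; exact i.elim0
    | succ k ih =>
      intro i g hg
      induction i using Fin.cases with
      | zero =>
        have h2 : ∀ x : Fin k, Equiv.swap (0 : Fin (k + 2)) 1 x.succ.succ = x.succ.succ := by
          intro x
          refine Equiv.swap_apply_of_ne_of_ne (Fin.succ_ne_zero _) ?_
          intro h
          exact Fin.succ_ne_zero x (Fin.succ_injective _ (by simpa using h))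
        simp only [List.ofFn_succ, List.prod_cons, Function.comp_apply, Fin.castSucc_zero,
          Fin.succ_zero_eq_one, Equiv.swap_apply_left, Equiv.swap_apply_right, h2]
        rw [← mul_assoc, hg 1 0, smul_mul_assoc, mul_assoc]
      | succ i =>
        have h0 : Equiv.swap i.succ.castSucc i.succ.succ (0 : Fin (k + 2)) = 0 := by
          refine Equiv.swap_apply_of_ne_of_ne ?_ (Fin.succ_ne_zero _).symm
          rw [Fin.castSucc_succ]
          exact (Fin.succ_ne_zero _).symm
        have h1 : ∀ x : Fin (k + 1), Equiv.swap i.succ.castSucc i.succ.succ x.succ =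
            (Equiv.swap i.castSucc i.succ x).succ := by
          intro x
          rw [Fin.castSucc_succ]
          exact (Fin.succ_injective _).swap_apply _ _ _
        have := ih i (fun x => g x.succ) fun a b => hg _ _
        rw [List.ofFn_succ, List.prod_cons, List.ofFn_succ (f := g), List.prod_cons]
        simp only [Function.comp_apply, h0, h1]
        simp only [Function.comp_def] at this
        rw [this, mul_smul_comm]
  rcases k with _ | k
  · have : τ = 1 := Subsingleton.elim _ _
    subst this
    simp
  · have hτ : τ ∈ Submonoid.closure
        (Set.range fun i : Fin k => Equiv.swap i.castSucc i.succ) := by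
      rw [Equiv.Perm.mclosure_swap_castSucc_succ]; trivial
    induction hτ using Submonoid.closure_induction_right with
    | one => simp
    | mul_right τ _ s hs ih =>
      obtain ⟨i, rfl⟩ := hs
      have := hadj k i (g ∘ τ) fun a b => hg _ _
      rw [Equiv.Perm.coe_mul, ← Function.comp_assoc, this, ih, Equiv.Perm.sign_mul, map_mul,
        Equiv.Perm.sign_swap (Fin.castSucc_lt_succ).ne, hφ, smul_smul, mul_comm]

theorem prod_ofFn_update {A : Type} [Ring A] (ε : ℤˣ) {k : ℕ} (g g' : Fin k → A) (e : Fin k)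
    (h1 : ∀ i, i ≠ e → g' i = g i) (h2 : g' e = ε • g e) :
    (List.ofFn g').prod = ε • (List.ofFn g).prod := by
  induction k with
  | zero => exact e.elim0
  | succ k ih =>
    rw [List.ofFn_succ, List.ofFn_succ (f := g), List.prod_cons, List.prod_cons]
    induction e using Fin.cases with
    | zero =>
      rw [h2, smul_mul_assoc]
      congr 3
      exact congrArg List.ofFn (funext fun i => h1 _ (Fin.succ_ne_zero i))
    | succ e =>
      rw [h1 0 (Fin.succ_ne_zero e).symm,
        ih (fun i => g i.succ) (fun i => g' i.succ) e
          (fun i hi => h1 _ fun h => hi (Fin.succ_injective _ h)) h2, mul_smul_comm]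

namespace NPDomain

variable {n : ℕ} (D : NPDomain n)

/-- The coordinates. -/
abbrev Crd : Type := Coord n D.m D.s D.r

/-- The coordinates of degree `0`, of even positive degree, and of odd degree. -/
abbrev BaseCrd : Type := {c : D.Crd // c.deg = 0}
abbrev EvenCrd : Type := {c : D.Crd // c.deg ≠ 0 ∧ Even c.deg}
abbrev OddCrd : Type := {c : D.Crd // Odd c.deg}

/-- The algebra of functions on the graded manifold: smooth functions on the base, tensored with the
free graded commutative algebra on the coordinates of positive degree (polynomials in the even
ones, exterior algebra on the odd ones). -/
def Fun : Type :=
  SmoothFun D.base ⊗[ℝ] (MvPolynomial D.EvenCrd ℝ ⊗[ℝ] ExteriorAlgebra ℝ (D.OddCrd → ℝ))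

instance : Ring D.Fun :=
  inferInstanceAs (Ring
    (SmoothFun D.base ⊗[ℝ] (MvPolynomial D.EvenCrd ℝ ⊗[ℝ] ExteriorAlgebra ℝ (D.OddCrd → ℝ))))

instance : Algebra ℝ D.Fun :=
  inferInstanceAs (Algebra ℝ
    (SmoothFun D.base ⊗[ℝ] (MvPolynomial D.EvenCrd ℝ ⊗[ℝ] ExteriorAlgebra ℝ (D.OddCrd → ℝ))))

/-- The function `f(x) · y · θ`, for a smooth function `f` of the coordinates of degree `0`, a
polynomial `y` in the even and an element `θ` of the exterior algebra on the odd coordinates. -/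
def tmul (f : SmoothFun D.base) (y : MvPolynomial D.EvenCrd ℝ)
    (θ : ExteriorAlgebra ℝ (D.OddCrd → ℝ)) : D.Fun :=
  (f ⊗ₜ[ℝ] (y ⊗ₜ[ℝ] θ) :
    SmoothFun D.base ⊗[ℝ] (MvPolynomial D.EvenCrd ℝ ⊗[ℝ] ExteriorAlgebra ℝ (D.OddCrd → ℝ)))

/-- Operators acting on one of the three factors. -/
def onBase (φ : Module.End ℝ (SmoothFun D.base)) : Module.End ℝ D.Fun :=
  LinearMap.rTensor (MvPolynomial D.EvenCrd ℝ ⊗[ℝ] ExteriorAlgebra ℝ (D.OddCrd → ℝ)) φ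

def onEven (φ : Module.End ℝ (MvPolynomial D.EvenCrd ℝ)) : Module.End ℝ D.Fun :=
  LinearMap.lTensor (SmoothFun D.base)
    (LinearMap.rTensor (ExteriorAlgebra ℝ (D.OddCrd → ℝ)) φ)

def onOdd (φ : Module.End ℝ (ExteriorAlgebra ℝ (D.OddCrd → ℝ))) : Module.End ℝ D.Fun :=
  LinearMap.lTensor (SmoothFun D.base) (LinearMap.lTensor (MvPolynomial D.EvenCrd ℝ) φ)

/-- The homogeneous functions of degree `k`. -/
def funGrading (k : ℤ) : Submodule ℝ D.Fun :=
  Submodule.span ℝ {w | ∃ (f : SmoothFun D.base) (a : D.EvenCrd →₀ ℕ) (l : List D.OddCrd),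
    ((a.sum fun c e => e * c.1.deg : ℕ) + ((l.map fun c => c.1.deg).sum : ℕ) : ℤ) = k ∧
    w = D.tmul f (MvPolynomial.monomial a 1)
      (l.map fun c => ExteriorAlgebra.ι ℝ (Pi.single c (1 : ℝ))).prod}

/-- The parity operator `f ↦ (-1)^f f`. -/
def parity : Module.End ℝ D.Fun :=
  D.onOdd (CliffordAlgebra.involute (Q := (0 : QuadraticForm ℝ (D.OddCrd → ℝ)))).toLinearMap

/-- The (left) partial derivative with respect to a coordinate. -/
def deriv (c : D.Crd) : Module.End ℝ D.Fun :=
  if h0 : c.deg = 0 then D.onBase (partialDeriv (⟨c, h0⟩ : D.BaseCrd))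
  else if h : Even c.deg then
    D.onEven (MvPolynomial.pderiv (R := ℝ) (⟨c, h0, h⟩ : D.EvenCrd)).toLinearMap
  else
    D.onOdd (CliffordAlgebra.contractLeft (Q := (0 : QuadraticForm ℝ (D.OddCrd → ℝ)))
      (LinearMap.proj (⟨c, Nat.not_even_iff_odd.1 h⟩ : D.OddCrd)))

/-- The constant coefficients `P^{ab}` of the Poisson bivector, i.e. of the operator
`Δ_{ij} = ∑ P^{ab} ∂_a^{(i)} ∂_b^{(j)}`. -/
def pairing : D.Crd → D.Crd → ℝ
  | .x μ, .p ν => if μ = ν then 1 else 0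
  | .p μ, .x ν => if μ = ν then (if Odd n then 1 else -1) else 0
  | .psi i α, .chi j β => if (⟨i, α⟩ : Σ i, Fin (D.r i)) = ⟨j, β⟩ then 1 else 0
  | .chi i α, .psi j β =>
      if (⟨i, α⟩ : Σ i, Fin (D.r i)) = ⟨j, β⟩ then
        (if Odd n then 1 else -(-1) ^ (i.1 + 1)) else 0
  | .xi a, .xi b => D.κ⁻¹ a b
  | _, _ => 0

theorem onBase_mul (φ ψ : Module.End ℝ (SmoothFun D.base)) :
    D.onBase φ * D.onBase ψ = D.onBase (φ * ψ) :=
  (LinearMap.rTensor_comp _ φ ψ).symm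

theorem onEven_mul (φ ψ : Module.End ℝ (MvPolynomial D.EvenCrd ℝ)) :
    D.onEven φ * D.onEven ψ = D.onEven (φ * ψ) := by
  refine (LinearMap.lTensor_comp (SmoothFun D.base) _ _).symm.trans ?_
  exact congrArg (LinearMap.lTensor (SmoothFun D.base)) (LinearMap.rTensor_comp _ φ ψ).symm

theorem onOdd_mul (φ ψ : Module.End ℝ (ExteriorAlgebra ℝ (D.OddCrd → ℝ))) :
    D.onOdd φ * D.onOdd ψ = D.onOdd (φ * ψ) := by
  refine (LinearMap.lTensor_comp (SmoothFun D.base) _ _).symm.trans ?_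
  exact congrArg (LinearMap.lTensor (SmoothFun D.base)) (LinearMap.lTensor_comp _ φ ψ).symm

theorem onOdd_neg (φ : Module.End ℝ (ExteriorAlgebra ℝ (D.OddCrd → ℝ))) :
    D.onOdd (-φ) = (-1 : ℝ) • D.onOdd φ := by
  have h : -φ = (-1 : ℝ) • φ := (neg_one_smul ℝ φ).symm
  rw [h]
  refine Eq.trans ?_ (LinearMap.lTensor_smul (SmoothFun D.base) (-1 : ℝ) _)
  exact congrArg (LinearMap.lTensor (SmoothFun D.base)) (LinearMap.lTensor_smul _ (-1 : ℝ) φ)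

theorem onBase_mul_onEven (φ : Module.End ℝ (SmoothFun D.base))
    (ψ : Module.End ℝ (MvPolynomial D.EvenCrd ℝ)) :
    D.onBase φ * D.onEven ψ = D.onEven ψ * D.onBase φ :=
  (LinearMap.rTensor_comp_lTensor _ _ _).trans (LinearMap.lTensor_comp_rTensor _ _ _).symm

theorem onBase_mul_onOdd (φ : Module.End ℝ (SmoothFun D.base))
    (ψ : Module.End ℝ (ExteriorAlgebra ℝ (D.OddCrd → ℝ))) :
    D.onBase φ * D.onOdd ψ = D.onOdd ψ * D.onBase φ :=
  (LinearMap.rTensor_comp_lTensor _ _ _).trans (LinearMap.lTensor_comp_rTensor _ _ _).symm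

theorem onEven_mul_onOdd (φ : Module.End ℝ (MvPolynomial D.EvenCrd ℝ))
    (ψ : Module.End ℝ (ExteriorAlgebra ℝ (D.OddCrd → ℝ))) :
    D.onEven φ * D.onOdd ψ = D.onOdd ψ * D.onEven φ := by
  refine (LinearMap.lTensor_comp (SmoothFun D.base) _ _).symm.trans
    (Eq.trans ?_ (LinearMap.lTensor_comp (SmoothFun D.base) _ _))
  exact congrArg (LinearMap.lTensor (SmoothFun D.base))
    ((LinearMap.rTensor_comp_lTensor _ _ _).trans (LinearMap.lTensor_comp_rTensor _ _ _).symm)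

theorem parity_mul_deriv (c : D.Crd) :
    D.parity * D.deriv c = (-1 : ℝ) ^ c.deg • (D.deriv c * D.parity) := by
  unfold deriv
  split_ifs with h0 h
  · rw [h0, pow_zero, one_smul, parity, onBase_mul_onOdd]
  · rw [h.neg_one_pow, one_smul, parity, onEven_mul_onOdd]
  · rw [(Nat.not_even_iff_odd.1 h).neg_one_pow, parity, onOdd_mul, onOdd_mul, ← onOdd_neg]
    congr 1
    exact LinearMap.ext fun x => involute_contractLeft' _ x

theorem deriv_mul_deriv (a b : D.Crd) :
    D.deriv a * D.deriv b = (-1 : ℝ) ^ (a.deg * b.deg) • (D.deriv b * D.deriv a) := by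
  have hcomm : Even (a.deg * b.deg) → D.deriv a * D.deriv b = D.deriv b * D.deriv a →
      D.deriv a * D.deriv b = (-1 : ℝ) ^ (a.deg * b.deg) • (D.deriv b * D.deriv a) := by
    intro h h'
    rw [h.neg_one_pow, one_smul, h']
  by_cases ha0 : a.deg = 0
  · refine hcomm (by simp [ha0]) ?_
    by_cases hb0 : b.deg = 0
    · simp only [deriv, ha0, hb0, dif_pos, onBase_mul]
      rw [partialDeriv_comm]
    · by_cases hb : Even b.deg
      · simp only [deriv, ha0, hb0, hb, dif_pos, dif_neg, not_false_eq_true, onBase_mul_onEven]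
      · simp only [deriv, ha0, hb0, hb, dif_pos, dif_neg, not_false_eq_true, onBase_mul_onOdd]
  by_cases hb0 : b.deg = 0
  · refine hcomm (by simp [hb0]) ?_
    by_cases ha : Even a.deg
    · simp only [deriv, ha0, hb0, ha, dif_pos, dif_neg, not_false_eq_true, onBase_mul_onEven]
    · simp only [deriv, ha0, hb0, ha, dif_pos, dif_neg, not_false_eq_true, onBase_mul_onOdd]
  by_cases ha : Even a.deg
  · refine hcomm (ha.mul_right _) ?_
    by_cases hb : Even b.deg
    · simp only [deriv, ha0, hb0, ha, hb, dif_pos, dif_neg, not_false_eq_true, onEven_mul]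
      congr 1
      exact LinearMap.ext fun x => pderiv_comm' _ _ x
    · simp only [deriv, ha0, hb0, ha, hb, dif_pos, dif_neg, not_false_eq_true, onEven_mul_onOdd]
  · by_cases hb : Even b.deg
    · refine hcomm (hb.mul_left _) ?_
      simp only [deriv, ha0, hb0, ha, hb, dif_pos, dif_neg, not_false_eq_true, onEven_mul_onOdd]
    · have hodd : Odd (a.deg * b.deg) :=
        (Nat.not_even_iff_odd.1 ha).mul (Nat.not_even_iff_odd.1 hb)
      rw [hodd.neg_one_pow]
      simp only [deriv, ha0, hb0, ha, hb, dif_neg, not_false_eq_true, onOdd_mul]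
      rw [← onOdd_neg]
      congr 1
      exact LinearMap.ext fun x => CliffordAlgebra.contractLeft_comm _ _ x

theorem parity_pow_mul_deriv (k : ℕ) (c : D.Crd) :
    D.parity ^ k * D.deriv c = (-1 : ℝ) ^ (k * c.deg) • (D.deriv c * D.parity ^ k) := by
  induction k with
  | zero => simp
  | succ k ih =>
    rw [pow_succ, mul_assoc, parity_mul_deriv, mul_smul_comm, ← mul_assoc, ih, smul_mul_assoc,
      smul_smul, mul_assoc, ← pow_add]
    congr 2; ring

theorem deriv_mul_parity_pow (k : ℕ) (c : D.Crd) :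
    D.deriv c * D.parity ^ k = (-1 : ℝ) ^ (k * c.deg) • (D.parity ^ k * D.deriv c) := by
  rw [parity_pow_mul_deriv, smul_smul, ← mul_pow]
  simp

theorem pairing_deg (a b : D.Crd) (h : D.pairing a b ≠ 0) : a.deg + b.deg = n := by
  rcases a with μ | μ | ⟨i, α⟩ | ⟨i, α⟩ | a <;> rcases b with ν | ν | ⟨j, β⟩ | ⟨j, β⟩ | b <;>
    simp only [pairing, ne_eq, not_true_eq_false] at h
  · simp [Coord.deg]
  · simp [Coord.deg]
  · have hij : i = j := by
      by_contra hne
      exact h (if_neg fun hh => hne (congrArg Sigma.fst hh))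
    subst hij
    have := i.2
    simp only [Coord.deg]; omega
  · have hij : i = j := by
      by_contra hne
      exact h (if_neg fun hh => hne (congrArg Sigma.fst hh))
    subst hij
    have := i.2
    simp only [Coord.deg]; omega
  · have hn : ¬ Odd n := fun hn => by
      have := D.s_eq_zero hn
      exact absurd a.2 (by omega)
    obtain ⟨t, rfl⟩ := Nat.not_odd_iff_even.1 hn
    simp only [Coord.deg]; omega

theorem kappa_inv_symm (a b : Fin D.s) : D.κ⁻¹ b a = -(-1) ^ (n / 2) * D.κ⁻¹ a b := by
  have hT : D.κ.transpose = (-(-1) ^ (n / 2) : ℝ) • D.κ := by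
    ext i j
    simpa using D.κ_symm j i
  have hu : (-(-1) ^ (n / 2) : ℝ) * (-(-1) ^ (n / 2)) = 1 := by
    rw [neg_mul_neg, ← mul_pow]; simp
  have h1 : (D.κ⁻¹).transpose = (-(-1) ^ (n / 2) : ℝ) • D.κ⁻¹ := by
    rw [Matrix.transpose_nonsing_inv, hT]
    refine Matrix.inv_eq_right_inv ?_
    rw [Matrix.smul_mul, Matrix.mul_smul, smul_smul, hu, one_smul,
      Matrix.mul_nonsing_inv _ D.κ_det]
  simpa using congrFun (congrFun h1 a) b

theorem neg_one_pow_psi_chi (i : Fin ((n - 1) / 2)) :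
    (-1 : ℝ) ^ ((i.1 + 1) * (n - (i.1 + 1))) = if Odd n then 1 else (-1) ^ (i.1 + 1) := by
  have := i.2
  obtain ⟨t, ht⟩ : ∃ t, n = (i.1 + 1) + t := ⟨n - (i.1 + 1), by omega⟩
  have h1 : n - (i.1 + 1) = t := by omega
  rw [h1, pow_mul]
  rcases Nat.even_or_odd (i.1 + 1) with hi | hi
  · split_ifs <;> simp [hi.neg_one_pow]
  · rcases Nat.even_or_odd t with h | h
    · have hn : Odd n := by rw [ht]; exact hi.add_even h
      simp [hi.neg_one_pow, h.neg_one_pow, hn]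
    · have hn : ¬ Odd n := by rw [ht, Nat.not_odd_iff_even]; exact hi.add_odd h
      simp [hi.neg_one_pow, h.neg_one_pow, hn]

theorem pairing_symm (a b : D.Crd) :
    D.pairing b a = (-1) ^ (n + 1) * (-1) ^ (a.deg * b.deg) * D.pairing a b := by
  have hn1 : (-1 : ℝ) ^ (n + 1) = if Odd n then 1 else -1 := by
    rw [pow_succ]
    rcases Nat.even_or_odd n with hn | hn
    · simp [hn.neg_one_pow, Nat.not_odd_iff_even.2 hn]
    · simp [hn.neg_one_pow, hn]
  have hsq : ∀ k : ℕ, (-1 : ℝ) ^ k * (-1) ^ k = 1 := fun k => by rw [← mul_pow]; simp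
  rw [hn1]
  rcases a with μ | μ | ⟨i, α⟩ | ⟨i, α⟩ | a <;> rcases b with ν | ν | ⟨j, β⟩ | ⟨j, β⟩ | b <;>
    simp only [pairing, mul_zero]
  · by_cases h : μ = ν
    · subst h
      simp [Coord.deg]
    · simp [h, Ne.symm h]
  · by_cases h : μ = ν
    · subst h
      by_cases hn : Odd n <;> simp [Coord.deg, hn]
    · simp [h, Ne.symm h]
  · by_cases h : (⟨i, α⟩ : Σ i, Fin (D.r i)) = ⟨j, β⟩
    · rw [if_pos h, if_pos h.symm]
      obtain ⟨rfl, -⟩ := Sigma.mk.inj_iff.1 h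
      simp only [Coord.deg, neg_one_pow_psi_chi]
      by_cases hn : Odd n <;> simp [hn]
    · rw [if_neg h, if_neg (Ne.symm h), mul_zero]
  · by_cases h : (⟨i, α⟩ : Σ i, Fin (D.r i)) = ⟨j, β⟩
    · rw [if_pos h, if_pos h.symm]
      obtain ⟨rfl, -⟩ := Sigma.mk.inj_iff.1 h
      simp only [Coord.deg]
      rw [mul_comm (n - (i.1 + 1)), neg_one_pow_psi_chi]
      by_cases hn : Odd n
      · simp [hn]
      · simp only [hn, if_false]
        linear_combination -hsq (i.1 + 1)
    · rw [if_neg h, if_neg (Ne.symm h), mul_zero]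
  · have hn : ¬ Odd n := fun hn => by
      have := D.s_eq_zero hn
      exact absurd a.2 (by omega)
    rw [kappa_inv_symm, if_neg hn]
    simp only [Coord.deg]
    congr 1
    rw [pow_mul]
    rcases Nat.even_or_odd (n / 2) with h | h <;> simp [h.neg_one_pow]

/-! ### The representation of the graph operad -/

/-- The derivative `∂_a^{(i)}` acting on the `i`-th factor of a tensor product of `N` functions, with
the Koszul sign `(-1)^(deg a · (f_1 + ⋯ + f_{i-1}))`. -/
def slotDeriv {N : ℕ} (a : D.Crd) (i : Fin N) : Module.End ℝ (⨂[ℝ] _ : Fin N, D.Fun) :=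
  PiTensorProduct.map fun j =>
    if j < i then D.parity ^ a.deg else if j = i then D.deriv a else 1

/-- The operator `Δ_{ij}`. -/
def edgeOp {N : ℕ} (i j : Fin N) : Module.End ℝ (⨂[ℝ] _ : Fin N, D.Fun) :=
  ∑ a : D.Crd, ∑ b : D.Crd, D.pairing a b • (D.slotDeriv a i * D.slotDeriv b j)

/-- The multiplication `f_1 ⊗ ⋯ ⊗ f_N ↦ f_1 ⋯ f_N`. -/
def mulMap (N : ℕ) : (⨂[ℝ] _ : Fin N, D.Fun) →ₗ[ℝ] D.Fun :=
  PiTensorProduct.lift (MultilinearMap.mkPiAlgebraFin ℝ N D.Fun)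

theorem slotDeriv_mul_slotDeriv {N : ℕ} (a b : D.Crd) (i j : Fin N) :
    D.slotDeriv a i * D.slotDeriv b j =
      (-1 : ℝ) ^ (a.deg * b.deg) • (D.slotDeriv b j * D.slotDeriv a i) :=
  map_slot_mul _ _ _ _ _ i j (by rw [← pow_add, ← pow_add, add_comm])
    (by rw [deriv_mul_parity_pow, mul_comm a.deg]) (D.parity_pow_mul_deriv _ _)
    (D.deriv_mul_deriv a b)

theorem edgeOp_swap {N : ℕ} (i j : Fin N) :
    D.edgeOp j i = (-1 : ℝ) ^ (n + 1) • D.edgeOp i j :=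
  sum_pairing_swap D.pairing Coord.deg n D.pairing_symm (fun a => D.slotDeriv a i)
    (fun a => D.slotDeriv a j) fun a b => D.slotDeriv_mul_slotDeriv a b j i

theorem edgeOp_mul_edgeOp {N : ℕ} (i j i' j' : Fin N) :
    D.edgeOp i j * D.edgeOp i' j' = (-1 : ℝ) ^ n • (D.edgeOp i' j' * D.edgeOp i j) :=
  sum_pairing_mul D.pairing Coord.deg n D.pairing_deg _ _ _ _
    (fun _ _ => D.slotDeriv_mul_slotDeriv _ _ _ _) (fun _ _ => D.slotDeriv_mul_slotDeriv _ _ _ _)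
    (fun _ _ => D.slotDeriv_mul_slotDeriv _ _ _ _) (fun _ _ => D.slotDeriv_mul_slotDeriv _ _ _ _)

/-- `f_1 ⊗ ⋯ ⊗ f_N ↦ μ_N (∏_{(i,j) ∈ E} Δ_{ij} (f_1 ⊗ ⋯ ⊗ f_N))`, the product being taken in the
order of the edges. -/
def repGraph {N k : ℕ} (G : Multidigraph N k) : MultilinearMap ℝ (fun _ : Fin N => D.Fun) D.Fun :=
  (D.mulMap N ∘ₗ (List.ofFn fun e => D.edgeOp (G e).1 (G e).2).prod).compMultilinearMap
    (PiTensorProduct.tprod ℝ)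



theorem neg_one_zpow_smul {A : Type*} [AddCommGroup A] [Module ℝ A] (k : ℕ) (x : A) :
    ((-1 : ℤˣ) ^ (k : ℤ)) • x = (-1 : ℝ) ^ k • x := by
  rw [zpow_natCast]
  rcases Nat.even_or_odd k with h | h <;> simp [h.neg_one_pow, Units.smul_def]

theorem compMultilinearMap_units_smul {N : ℕ} (L L' : Module.End ℝ (⨂[ℝ] _ : Fin N, D.Fun))
    (u : ℤˣ) (h : L = u • L') :
    (D.mulMap N ∘ₗ L).compMultilinearMap (PiTensorProduct.tprod ℝ) =
      u • (D.mulMap N ∘ₗ L').compMultilinearMap (PiTensorProduct.tprod ℝ) := by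
  subst h
  rcases Int.units_eq_one_or u with rfl | rfl
  · simp
  · ext v
    simp [Units.smul_def]

/-- `Rep_N` on the part of `Gra_d(N)` with `k` edges, `d = n + 1`. -/
def rep {N k : ℕ} :
    Gra ((n : ℤ) + 1) N k →ₗ[ℝ] MultilinearMap ℝ (fun _ : Fin N => D.Fun) D.Fun :=
  Gra.lift _ D.repGraph
    (fun G τ => by
      have h := prod_ofFn_perm ((-1 : ℤˣ) ^ ((n : ℤ) + 1 + 1))
        (fun e => D.edgeOp (G e).1 (G e).2)
        (fun i j => by
          have h2 : (-1 : ℤˣ) ^ ((n : ℤ) + 1 + 1) = (-1 : ℤˣ) ^ (n : ℤ) := by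
            rw [zpow_add_one, zpow_add_one, mul_assoc]; simp
          rw [edgeOp_mul_edgeOp, h2, neg_one_zpow_smul])
        τ (zpowGroupHom ((n : ℤ) + 1 + 1)) rfl
      exact D.compMultilinearMap_units_smul _ _ _ h)
    (fun G e => by
      have h := prod_ofFn_update ((-1 : ℤˣ) ^ ((n : ℤ) + 1))
        (fun e => D.edgeOp (G e).1 (G e).2)
        (fun e' => D.edgeOp (flipEdge e G e').1 (flipEdge e G e').2) e
        (fun i hi => by simp [flipEdge, hi])
        (by
          have h2 : (n : ℤ) + 1 = ((n + 1 : ℕ) : ℤ) := by push_cast; rfl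
          rw [h2, neg_one_zpow_smul]
          simpa [flipEdge] using D.edgeOp_swap (G e).1 (G e).2)
      exact D.compMultilinearMap_units_smul _ _ _ h)

end NPDomain

/-! ### The Chevalley–Eilenberg complex and `Lie_∞`-algebras -/

/-- Families of multilinear maps `V^(p + 1) → V`, `p ≥ 0`, i.e. elements of the product over all
arities. -/
abbrev Cochains (V : Type*) [AddCommGroup V] [Module ℝ V] : Type _ :=
  (p : ℕ) → MultilinearMap ℝ (fun _ : Fin (p + 1) => V) V

/-- The Koszul sign of the passage from `X_1 ⊗ ⋯ ⊗ X_N` to `X_{τ 1} ⊗ ⋯ ⊗ X_{τ N}`, where `X_i` is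
homogeneous of degree `x i`. -/
def koszul {N : ℕ} (τ : Equiv.Perm (Fin N)) (x : Fin N → ℤ) : ℤˣ :=
  ∏ i, ∏ j, if i < j ∧ τ j < τ i then (-1) ^ (x (τ i) * x (τ j)) else 1

section CE

variable {V : Type*} [AddCommGroup V] [Module ℝ V]

/-- `c` belongs to the component `CE^k = ∏_{i + p = k} Hom^i(𝔤^{∧ (p + 1)}, 𝔤)` of the graded
Chevalley–Eilenberg cochains of the graded vector space `𝔤 = ⨁ 𝒜 i`. -/
structure IsCE (𝒜 : ℤ → Submodule ℝ V) (k : ℤ) (c : Cochains V) : Prop where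
  degree : ∀ (p : ℕ) (x : Fin (p + 1) → ℤ) (X : Fin (p + 1) → V), (∀ i, X i ∈ 𝒜 (x i)) →
    c p X ∈ 𝒜 (∑ i, x i + (k - p))
  antisymm : ∀ (p : ℕ) (x : Fin (p + 1) → ℤ) (X : Fin (p + 1) → V), (∀ i, X i ∈ 𝒜 (x i)) →
    ∀ τ : Equiv.Perm (Fin (p + 1)), c p (X ∘ τ) = (Equiv.Perm.sign τ * koszul τ x) • c p X

open Classical in
/-- The component of arity `P + 1` of the Nijenhuis–Richardson product `c ∘ c'`, where `c'` has
total degree `k'`, evaluated on arguments `X i` of degree `x i`. The summand of arities `p + 1`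
for `c` and `q + 1` for `c'` carries the sign `(-1)^(p |c'_q|)`, where `|c'_q| = k' - q` is the
degree of `c'_q` as a map, besides the signature and the Koszul sign of the unshuffle. -/
def nrProd (k' : ℤ) (c c' : Cochains V) (P : ℕ) (x : Fin (P + 1) → ℤ) (X : Fin (P + 1) → V) : V :=
  ∑ y : Finset.HasAntidiagonal.antidiagonal P, ∑ σ : Equiv.Perm (Fin (P + 1)),
    if IsUnshuffle (y.1.2 + 1) σ then
      (Equiv.Perm.sign σ * koszul σ⁻¹ x * (-1) ^ ((y.1.1 : ℤ) * (k' - y.1.2))) •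
        c y.1.1 (Fin.cons
          (c' y.1.2 fun i => X (σ⁻¹ (embed (Finset.HasAntidiagonal.mem_antidiagonal.1 y.2) i)))
          fun i : Fin y.1.1 => X (σ⁻¹ ⟨y.1.2 + 1 + i.1, by
            have := Finset.HasAntidiagonal.mem_antidiagonal.1 y.2
            omega⟩))
    else 0

/-- The Nijenhuis–Richardson bracket of cochains of total degrees `k` and `k'`. -/
def nrBracket (k k' : ℤ) (c c' : Cochains V) (P : ℕ) (x : Fin (P + 1) → ℤ)
    (X : Fin (P + 1) → V) : V :=
  nrProd k' c c' P x X - (-1 : ℤˣ) ^ (k * k') • nrProd k c' c P x X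

/-- `Lie_∞`-algebra structures on the graded vector space `⨁ 𝒜 i`: graded antisymmetric brackets
`l_N` with `N ≥ 1` arguments (here `l_N = l (N - 1)`), of degree `2 - N`, with
`∑ ± l_{p + 1}(l_{q + 1}(X_{σ⁻¹ 0}, …, X_{σ⁻¹ q}), X_{σ⁻¹ (q + 1)}, …) = 0`, the sign being
`(-1)^(p (q + 1))` times the signature and the Koszul sign of the unshuffle. -/
structure IsLieInfty (𝒜 : ℤ → Submodule ℝ V) (l : Cochains V) : Prop where
  cochain : IsCE 𝒜 1 l
  jacobi : ∀ (P : ℕ) (x : Fin (P + 1) → ℤ) (X : Fin (P + 1) → V), (∀ i, X i ∈ 𝒜 (x i)) →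
    nrProd 1 l l P x X = 0

/-- Families `∑ r, ε ^ r l_r` of cochains that form an `ℝ[[ε]]`-linear `Lie_∞`-algebra structure on
formal power series in `ε`, the parameter `ε` having degree `0`. -/
structure IsFormalLieInfty (𝒜 : ℤ → Submodule ℝ V) (l : ℕ → Cochains V) : Prop where
  cochain : ∀ r, IsCE 𝒜 1 (l r)
  jacobi : ∀ (r P : ℕ) (x : Fin (P + 1) → ℤ) (X : Fin (P + 1) → V), (∀ i, X i ∈ 𝒜 (x i)) →
    ∑ ij ∈ Finset.HasAntidiagonal.antidiagonal r, nrProd 1 (l ij.1) (l ij.2) P x X = 0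

end CE

namespace NPDomain

variable {n : ℕ} (D : NPDomain n)

/-! ### The Schouten algebra and its universal deformations -/

/-- The Poisson bracket `{f, g} = ∑ P^{ab} (-1)^(f · deg b) ∂_a f · ∂_b g`, of degree `-n`. -/
def poisson : MultilinearMap ℝ (fun _ : Fin 2 => D.Fun) D.Fun :=
  ∑ a : D.Crd, ∑ b : D.Crd, D.pairing a b •
    (MultilinearMap.mkPiAlgebraFin ℝ 2 D.Fun).compLinearMap
      ![D.deriv a * D.parity ^ b.deg, D.deriv b]

/-- The grading of `T_poly = Fun[n]`: the elements of degree `k` are the functions of degree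
`k + n`. -/
def tGrading (k : ℤ) : Submodule ℝ D.Fun := D.funGrading (k + n)

/-- The operator `X ↦ (-1)^X X` for the degree of `T_poly`. -/
def tParity : Module.End ℝ D.Fun := (-1 : ℝ) ^ n • D.parity

/-- The pullback `s⁻¹ ∘ θ ∘ (s ⊗ ⋯ ⊗ s)` along the suspension map `s : T_poly → Fun` of degree `n`
(the identity of the underlying vector space), where
`(s ⊗ ⋯ ⊗ s) (X_1 ⊗ ⋯ ⊗ X_N) = (-1)^(∑ i, n (N - i) X_i) s X_1 ⊗ ⋯ ⊗ s X_N`. -/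
def pullback {N : ℕ} :
    MultilinearMap ℝ (fun _ : Fin N => D.Fun) D.Fun →ₗ[ℝ]
      MultilinearMap ℝ (fun _ : Fin N => D.Fun) D.Fun :=
  MultilinearMap.compLinearMapₗ fun i : Fin N => D.tParity ^ (n * (N - 1 - i.1))

/-- The Schouten bracket `[ , ]_S = s⁻¹ ∘ { , } ∘ (s ⊗ s)`, as a cochain. -/
def schouten : Cochains D.Fun
  | 1 => D.pullback D.poisson
  | _ => 0

/-- The map `s* Rep`. The sum over the numbers of edges has finitely many non-zero terms if
`HasFiniteEdges m`; for `n ≥ 1` this holds whenever `m` is homogeneous. -/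
def sRep (m : GraphSeries ((n : ℤ) + 1)) : Cochains D.Fun := fun p =>
  ∑ᶠ k, D.pullback (D.rep (m p k))

/-- The cochain `c` is a universal deformation of the graded Lie algebra `(T_poly, [ , ]_S)` as a
`Lie_∞`-algebra: it is a Maurer–Cartan element of the Chevalley–Eilenberg dg Lie algebra, so that
`[ , ]_S + c` is a `Lie_∞`-structure, and this structure is universal, i.e. given by the action of
a structure `γ` in the graph operad (`γ ∈ fGC_d` of degree `1` with `[γ, γ] = 0`, i.e. a morphism to
`Gra_d` from the operad governing (shifted) `Lie_∞`-algebras). -/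
structure IsUniversalDeformation (c : Cochains D.Fun) : Prop where
  cochain : IsCE D.tGrading 1 c
  maurerCartan : ∀ (P : ℕ) (x : Fin (P + 1) → ℤ) (X : Fin (P + 1) → D.Fun),
    (∀ i, X i ∈ D.tGrading (x i)) →
      nrBracket 1 1 D.schouten c P x X + (1 / 2 : ℝ) • nrBracket 1 1 c c P x X = 0
  lieInfty : IsLieInfty D.tGrading (D.schouten + c)
  universal : ∃ γ ∈ fGC ((n : ℤ) + 1), HasDegree 1 γ ∧ HasFiniteEdges γ ∧ bracket γ γ = 0 ∧
    D.schouten + c = D.sRep γ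

/-- The brackets of the deformation given by a formal power series `∑ r, ε ^ r c_r`, that is, the
coefficients of `[ , ]_S + ∑ r, ε ^ r c_r`. -/
def deformed (c : ℕ → Cochains D.Fun) (r : ℕ) : Cochains D.Fun :=
  if r = 0 then D.schouten + c 0 else c r

/-- The analogue over `ℝ[[ε]]` of `IsUniversalDeformation`, for `∑ r, ε ^ r c_r`. -/
structure IsFormalUniversalDeformation (c : ℕ → Cochains D.Fun) : Prop where
  cochain : ∀ r, IsCE D.tGrading 1 (c r)
  maurerCartan : ∀ (r P : ℕ) (x : Fin (P + 1) → ℤ) (X : Fin (P + 1) → D.Fun),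
    (∀ i, X i ∈ D.tGrading (x i)) →
      nrBracket 1 1 D.schouten (c r) P x X + (1 / 2 : ℝ) •
        ∑ ij ∈ Finset.HasAntidiagonal.antidiagonal r, nrBracket 1 1 (c ij.1) (c ij.2) P x X = 0
  lieInfty : IsFormalLieInfty D.tGrading (D.deformed c)
  universal : ∃ γ : ℕ → GraphSeries ((n : ℤ) + 1),
    (∀ r, γ r ∈ fGC ((n : ℤ) + 1) ∧ HasDegree 1 (γ r) ∧ HasFiniteEdges (γ r)) ∧
    (∀ r, ∑ ij ∈ Finset.HasAntidiagonal.antidiagonal r, bracket (γ ij.1) (γ ij.2) = 0) ∧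
    ∀ r, D.deformed c r = D.sRep (γ r)

end NPDomain

end NPGraph

end

/-! The theorem holds because a graph acts on functions by a polydifferential operator, and this
action respects every structure of the graph operad. Three compatibilities carry the argument.

Degrees: each edge operator lowers the degree by `n`, so a graph with `k` edges acts in degree `-n
k` (`rep_mem`). Permutations: relabelling vertices corresponds to permuting the arguments with
Koszul signs (`rep_act`). Composition: the coefficients `P^{ab}` are constant, so a derivative that
meets a product of functions is distributed over its factors by the graded Leibniz rule, and
distributing all of them is the sum over all reconnections of edge ends (`rep_compGraph`,
`rep_comp`).

Conjugation by the suspension `s` turns the action twisted by `sgn^d`, with degrees counted in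
functions, into graded antisymmetry with degrees counted in `T_poly` (`pullback_rep_act`), and its
signs absorb the sign in the Nijenhuis–Richardson product (`pullback_rep_comp`). Hence `sRep` sends
the pre-Lie product of degree `1` elements to the Nijenhuis–Richardson product (`nrProd_sRep`). It
sends the one-edge graph `Γ` to the Schouten bracket (`sRep_edgeGraph`).

The product of `Γ` with itself vanishes, because its six terms cancel in pairs (`preLie_edge_edge`).
So the Maurer–Cartan equation for `m` says that `Γ + m` has vanishing pre-Lie square, and applying
`sRep` to these graph identities yields the deformation equation, the Jacobi identities and
universality at once (`isFormalUniversalDeformation_sRep`).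

All three claims reduce to this formal statement. For `n ≥ 1`, an ordinary Maurer–Cartan element is
a constant series, and the degree bounds its number of edges. For `n = 0` the bracket adds numbers
of edges and `Γ` has one edge, so giving the part with `r + 1` edges the weight `ε ^ r` makes the
equation homogeneous in `ε`. The edgeless part, which would have weight `-1`, vanishes by
antisymmetry. -/

noncomputable section

namespace NPGraph
namespace NPDomain
variable {n : ℕ} (D : NPDomain n)

/-! ### Functions on the graded manifold: parity and Leibniz rules -/

theorem tmul_mul_tmul (f f' : SmoothFun D.base) (y y' : MvPolynomial D.EvenCrd ℝ)
    (θ θ' : ExteriorAlgebra ℝ (D.OddCrd → ℝ)) :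
    D.tmul f y θ * D.tmul f' y' θ' = D.tmul (f * f') (y * y') (θ * θ') :=
  (Algebra.TensorProduct.tmul_mul_tmul _ _ _ _).trans
    (congrArg (TensorProduct.tmul ℝ (f * f')) (Algebra.TensorProduct.tmul_mul_tmul _ _ _ _))

theorem one_eq_tmul : (1 : D.Fun) = D.tmul 1 1 1 := rfl

@[elab_as_elim]
theorem fun_induction {motive : D.Fun → Prop} (F : D.Fun)
    (tmul : ∀ f y θ, motive (D.tmul f y θ)) (add : ∀ F G, motive F → motive G → motive (F + G)) :
    motive F := by
  have zero : motive 0 := by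
    have h := tmul 0 0 0
    have h0 : D.tmul 0 0 0 = 0 := TensorProduct.zero_tmul _ _
    rwa [h0] at h
  refine TensorProduct.induction_on F zero (fun f z => ?_) (fun F G hF hG => add F G hF hG)
  refine TensorProduct.induction_on z ?_ (fun y θ => tmul f y θ) (fun z z' hz hz' => ?_)
  · rw [TensorProduct.tmul_zero]; exact zero
  · rw [TensorProduct.tmul_add]; exact add _ _ hz hz'

theorem onBase_tmul (φ : Module.End ℝ (SmoothFun D.base)) (f y θ) :
    D.onBase φ (D.tmul f y θ) = D.tmul (φ f) y θ := rfl

theorem onEven_tmul (φ : Module.End ℝ (MvPolynomial D.EvenCrd ℝ)) (f y θ) :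
    D.onEven φ (D.tmul f y θ) = D.tmul f (φ y) θ := rfl

theorem onOdd_tmul (φ : Module.End ℝ (ExteriorAlgebra ℝ (D.OddCrd → ℝ))) (f y θ) :
    D.onOdd φ (D.tmul f y θ) = D.tmul f y (φ θ) := rfl

theorem tmul_add_base (f f' y θ) : D.tmul (f + f') y θ = D.tmul f y θ + D.tmul f' y θ :=
  TensorProduct.add_tmul _ _ _

theorem tmul_add_even (f y y' θ) : D.tmul f (y + y') θ = D.tmul f y θ + D.tmul f y' θ := by
  refine Eq.trans ?_ (TensorProduct.tmul_add _ _ _)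
  exact congrArg (TensorProduct.tmul ℝ f) (TensorProduct.add_tmul _ _ _)

theorem tmul_add_odd (f y θ θ') : D.tmul f y (θ + θ') = D.tmul f y θ + D.tmul f y θ' := by
  refine Eq.trans ?_ (TensorProduct.tmul_add _ _ _)
  exact congrArg (TensorProduct.tmul ℝ f) (TensorProduct.tmul_add _ _ _)

theorem tmul_smul_even (c : ℝ) (f y θ) : D.tmul f (c • y) θ = c • D.tmul f y θ := by
  refine Eq.trans ?_ (TensorProduct.tmul_smul c _ _)
  exact congrArg (TensorProduct.tmul ℝ f) (TensorProduct.smul_tmul' c y θ).symm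

theorem tmul_smul_odd (c : ℝ) (f y θ) : D.tmul f y (c • θ) = c • D.tmul f y θ := by
  refine Eq.trans ?_ (TensorProduct.tmul_smul c _ _)
  exact congrArg (TensorProduct.tmul ℝ f) (TensorProduct.tmul_smul c y θ)

theorem parity_one : D.parity 1 = 1 := by
  rw [one_eq_tmul, parity, onOdd_tmul]
  simp

theorem parity_mul (F G : D.Fun) : D.parity (F * G) = D.parity F * D.parity G := by
  induction F using fun_induction with
  | add F F' h h' => simp only [add_mul, map_add, h, h']
  | tmul f y θ =>
    induction G using fun_induction with
    | add G G' h h' => simp only [mul_add, map_add, h, h']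
    | tmul f' y' θ' =>
      rw [tmul_mul_tmul, parity, onOdd_tmul, onOdd_tmul, onOdd_tmul, tmul_mul_tmul]
      simp

theorem parity_mul_parity : D.parity * D.parity = 1 := by
  refine LinearMap.ext fun F => ?_
  induction F using fun_induction with
  | add F F' h h' => rw [map_add, map_add, h, h']
  | tmul f y θ =>
    rw [Module.End.mul_apply, parity, onOdd_tmul, onOdd_tmul]
    simp

theorem parity_pow_even {k : ℕ} (hk : Even k) : D.parity ^ k = 1 := by
  obtain ⟨t, rfl⟩ := hk
  rw [← two_mul, pow_mul, pow_two, parity_mul_parity, one_pow]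

theorem parity_pow_odd {k : ℕ} (hk : Odd k) : D.parity ^ k = D.parity := by
  obtain ⟨t, rfl⟩ := hk
  rw [pow_succ, parity_pow_even D (even_two_mul t), one_mul]

theorem parity_pow_mul (k : ℕ) (F G : D.Fun) :
    (D.parity ^ k) (F * G) = (D.parity ^ k) F * (D.parity ^ k) G := by
  rcases Nat.even_or_odd k with h | h
  · simp [parity_pow_even D h]
  · simp [parity_pow_odd D h, parity_mul]

theorem parity_pow_one (k : ℕ) : (D.parity ^ k) 1 = 1 := by
  rcases Nat.even_or_odd k with h | h
  · simp [parity_pow_even D h]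
  · simp [parity_pow_odd D h, parity_one]

end NPDomain

theorem partialDeriv_mul {ι : Type} [Fintype ι] [DecidableEq ι]
    {U : TopologicalSpace.Opens (ι → ℝ)} (i : ι) (f g : SmoothFun U) :
    partialDeriv i (f * g) = partialDeriv i f * g + f * partialDeriv i g := by
  ext u
  have h : extendFun (f * g).1 = extendFun f.1 * extendFun g.1 := by
    funext y
    by_cases hy : ∃ u : U, u.1 = y
    · obtain ⟨u, rfl⟩ := hy
      simp [extendFun_apply]
    · simp [extendFun, Function.extend_apply' _ _ _ hy]
  change fderiv ℝ (extendFun (f * g).1) u (Pi.single i 1) =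
    fderiv ℝ (extendFun f.1) u (Pi.single i 1) * g.1 u +
      f.1 u * fderiv ℝ (extendFun g.1) u (Pi.single i 1)
  rw [h, fderiv_mul (differentiableAt_extendFun f u) (differentiableAt_extendFun g u)]
  simp only [extendFun_apply, add_apply, smul_apply, smul_eq_mul]
  ring

/-- Contraction with a covector is an odd derivation: `involute x` records the sign of moving the
covector past `x`. Both sides obey the same recursion in the leading generator of `x`. -/
theorem contractLeft_mul {M : Type} [AddCommGroup M] [Module ℝ M]
    (φ : Module.Dual ℝ M) (x y : ExteriorAlgebra ℝ M) :
    CliffordAlgebra.contractLeft (Q := (0 : QuadraticForm ℝ M)) φ (x * y) =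
      CliffordAlgebra.contractLeft (Q := (0 : QuadraticForm ℝ M)) φ x * y +
      CliffordAlgebra.involute (Q := (0 : QuadraticForm ℝ M)) x *
        CliffordAlgebra.contractLeft (Q := (0 : QuadraticForm ℝ M)) φ y := by
  induction x using CliffordAlgebra.left_induction with
  | algebraMap r => 
    simp [← Algebra.smul_def]
  | add x x' hx hx' => simp only [map_add, add_mul, hx, hx']; abel
  | ι_mul x m hx =>
    rw [mul_assoc, CliffordAlgebra.contractLeft_ι_mul, hx, CliffordAlgebra.contractLeft_ι_mul,
      map_mul, CliffordAlgebra.involute_ι]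
    simp only [sub_mul, mul_add, smul_mul_assoc, neg_mul, mul_assoc]
    abel

namespace NPDomain
variable {n : ℕ} (D : NPDomain n)

/-- The Koszul-signed Leibniz rule. Only the exterior factor of `D.Fun` contains odd elements, so
the ordinary tensor product of algebras already has the right signs, and `parity ^ c.deg` is
nontrivial only for odd coordinates. -/
theorem deriv_mul (c : D.Crd) (F G : D.Fun) :
    D.deriv c (F * G) = D.deriv c F * G + (D.parity ^ c.deg) F * D.deriv c G := by
  induction F using fun_induction with
  | add F F' h h' => simp only [add_mul, map_add, h, h']; abel
  | tmul f y θ =>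
    induction G using fun_induction with
    | add G G' h h' => simp only [mul_add, map_add, h, h']; abel
    | tmul f' y' θ' =>
      rw [tmul_mul_tmul]
      unfold deriv
      split_ifs with h0 h
      · rw [h0, pow_zero, Module.End.one_apply, onBase_tmul, onBase_tmul, onBase_tmul,
          partialDeriv_mul, tmul_add_base, tmul_mul_tmul, tmul_mul_tmul]
      · rw [parity_pow_even D h, Module.End.one_apply, onEven_tmul, onEven_tmul, onEven_tmul,
          Derivation.coeFn_coe, Derivation.leibniz, add_comm, tmul_add_even, smul_eq_mul,
          smul_eq_mul, mul_comm y', tmul_mul_tmul, tmul_mul_tmul]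
      · rw [parity_pow_odd D (Nat.not_even_iff_odd.1 h), onOdd_tmul, onOdd_tmul, onOdd_tmul,
          contractLeft_mul, tmul_add_odd, parity, onOdd_tmul, tmul_mul_tmul, tmul_mul_tmul]
        rfl

theorem deriv_one (c : D.Crd) : D.deriv c 1 = 0 := by
  have h := D.deriv_mul c 1 1
  rw [parity_pow_one, mul_one, mul_one, one_mul] at h
  simpa using h

/-! ### The grading of functions and graded commutativity -/

/-- The function `f(x) · y^a · θ_{l_1} ⋯ θ_{l_r}`. -/
def gen (f : SmoothFun D.base) (a : D.EvenCrd →₀ ℕ) (l : List D.OddCrd) : D.Fun :=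
  D.tmul f (MvPolynomial.monomial a 1) (l.map fun c => ExteriorAlgebra.ι ℝ (Pi.single c (1 : ℝ))).prod

/-- The degree of `gen f a l`. -/
def genDeg (a : D.EvenCrd →₀ ℕ) (l : List D.OddCrd) : ℤ :=
  ((a.sum fun c e => e * c.1.deg : ℕ) + ((l.map fun c => c.1.deg).sum : ℕ) : ℤ)

theorem gen_mem (f a l) : D.gen f a l ∈ D.funGrading (D.genDeg a l) :=
  Submodule.subset_span ⟨f, a, l, rfl, rfl⟩

@[elab_as_elim]
theorem funGrading_induction {k : ℤ} {motive : (F : D.Fun) → F ∈ D.funGrading k → Prop}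
    (gen : ∀ f a l (h : D.genDeg a l = k), motive (D.gen f a l) (h ▸ D.gen_mem f a l))
    (zero : motive 0 (zero_mem _))
    (add : ∀ F G hF hG, motive F hF → motive G hG → motive (F + G) (add_mem hF hG))
    (smul : ∀ (c : ℝ) F hF, motive F hF → motive (c • F) (Submodule.smul_mem _ c hF))
    {F : D.Fun} (hF : F ∈ D.funGrading k) : motive F hF := by
  refine Submodule.span_induction ?_ zero add smul hF
  rintro _ ⟨f, a, l, h, rfl⟩
  exact gen f a l h

theorem gen_mul_gen (f f' a a' l l') :
    D.gen f a l * D.gen f' a' l' = D.gen (f * f') (a + a') (l ++ l') := by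
  rw [gen, gen, tmul_mul_tmul, gen, MvPolynomial.monomial_mul, one_mul, List.map_append,
    List.prod_append]

theorem genDeg_add (a a' l l') :
    D.genDeg (a + a') (l ++ l') = D.genDeg a l + D.genDeg a' l' := by
  classical
  simp only [genDeg, List.map_append, List.sum_append]
  rw [Finsupp.sum_add_index' (by simp) (by intros; ring)]
  push_cast
  ring

theorem one_mem_funGrading : (1 : D.Fun) ∈ D.funGrading 0 := by
  have h := D.gen_mem 1 0 []
  simpa [gen, genDeg, one_eq_tmul] using h

theorem mul_mem_funGrading {k k' : ℤ} {F G : D.Fun} (hF : F ∈ D.funGrading k)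
    (hG : G ∈ D.funGrading k') : F * G ∈ D.funGrading (k + k') := by
  induction hF using funGrading_induction with
  | zero => simp
  | add F F' _ _ h h' => rw [add_mul]; exact add_mem h h'
  | smul c F _ h => rw [smul_mul_assoc]; exact Submodule.smul_mem _ _ h
  | gen f a l h =>
    induction hG using funGrading_induction with
    | zero => simp
    | add F F' _ _ h h' => rw [mul_add]; exact add_mem h h'
    | smul c F _ h => rw [mul_smul_comm]; exact Submodule.smul_mem _ _ h
    | gen f' a' l' h' =>
      rw [gen_mul_gen, ← h, ← h', ← genDeg_add]
      exact D.gen_mem _ _ _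

/-- Even coordinates contribute even degrees and each odd letter contributes an odd one. This links
the integer grading to the word length in the exterior algebra, on which `parity` and the
commutation signs are defined. -/
theorem even_genDeg_sub (a l) : Even (D.genDeg a l - l.length) := by
  have h1 : Even ((a.sum fun c e => e * c.1.deg : ℕ) : ℤ) := by
    rw [Int.even_coe_nat]
    exact Finset.even_sum _ fun c _ => c.2.2.mul_left _
  have h2 : Even (((l.map fun c => c.1.deg).sum : ℕ) - (l.length : ℤ)) := by
    induction l with
    | nil => simp
    | cons c l ih =>
      have hc := c.2
      have : Even ((c.1.deg : ℤ) - 1) := by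
        obtain ⟨t, ht⟩ := hc
        exact ⟨t, by rw [ht]; push_cast; ring⟩
      simp only [List.map_cons, List.sum_cons, List.length_cons]
      have e : (((c.1.deg + (l.map fun c => c.1.deg).sum : ℕ) : ℤ) - ((l.length + 1 : ℕ) : ℤ)) =
          ((c.1.deg : ℤ) - 1) + ((((l.map fun c => c.1.deg).sum : ℕ) : ℤ) - l.length) := by
        push_cast
        ring
      rw [e]
      exact this.add ih
  rw [genDeg, add_sub_assoc]
  exact h1.add h2

theorem neg_one_zpow_genDeg (a l) : (-1 : ℤˣ) ^ D.genDeg a l = (-1) ^ l.length := by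
  obtain ⟨t, ht⟩ := D.even_genDeg_sub a l
  rw [sub_eq_iff_eq_add.1 ht, zpow_add, zpow_add, ← mul_zpow, neg_mul_neg, one_mul, one_zpow,
    one_mul, zpow_natCast]

theorem parity_of_mem {k : ℤ} {F : D.Fun} (hF : F ∈ D.funGrading k) :
    D.parity F = ((-1 : ℤˣ) ^ k) • F := by
  induction hF using funGrading_induction with
  | zero => simp
  | add F F' _ _ h h' => rw [map_add, h, h', smul_add]
  | smul c F _ h => rw [map_smul, h, smul_comm]
  | gen f a l h =>
    rw [← h, neg_one_zpow_genDeg, gen, parity, onOdd_tmul]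
    have := CliffordAlgebra.involute_prod_map_ι (Q := (0 : QuadraticForm ℝ (D.OddCrd → ℝ)))
      (l.map fun c => Pi.single c (1 : ℝ))
    rw [List.map_map, List.length_map] at this
    refine (congrArg (D.tmul f _) this).trans ?_
    rw [tmul_smul_odd, ← neg_one_zpow_smul, zpow_natCast]
    rfl

theorem ι_prod_comm {M : Type} [AddCommGroup M] [Module ℝ M] (l l' : List M) :
    (l.map (ExteriorAlgebra.ι ℝ)).prod * (l'.map (ExteriorAlgebra.ι ℝ)).prod =
      ((-1 : ℝ) ^ (l.length * l'.length)) •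
        ((l'.map (ExteriorAlgebra.ι ℝ)).prod * (l.map (ExteriorAlgebra.ι ℝ)).prod) := by
  have key : ∀ (v : M) (l' : List M),
      ExteriorAlgebra.ι ℝ v * (l'.map (ExteriorAlgebra.ι ℝ)).prod =
      ((-1 : ℝ) ^ l'.length) • ((l'.map (ExteriorAlgebra.ι ℝ)).prod * ExteriorAlgebra.ι ℝ v) := by
    intro v l'
    induction l' with
    | nil => simp
    | cons w l' ih =>
      have hvw : ExteriorAlgebra.ι ℝ v * ExteriorAlgebra.ι ℝ w =
          -(ExteriorAlgebra.ι ℝ w * ExteriorAlgebra.ι ℝ v) :=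
        eq_neg_of_add_eq_zero_left (ExteriorAlgebra.ι_add_mul_swap v w)
      rw [List.map_cons, List.prod_cons, ← mul_assoc, hvw, neg_mul, mul_assoc, ih, mul_smul_comm,
        List.length_cons, pow_succ, mul_neg_one, neg_smul, mul_assoc]
  induction l with
  | nil => simp
  | cons v l ih =>
    rw [List.map_cons, List.prod_cons, mul_assoc, ih, mul_smul_comm, ← mul_assoc, key,
      smul_mul_assoc, smul_smul, ← pow_add, List.length_cons, mul_assoc]
    congr 2; ring

theorem mul_comm_of_mem {k k' : ℤ} {F G : D.Fun} (hF : F ∈ D.funGrading k)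
    (hG : G ∈ D.funGrading k') : F * G = ((-1 : ℤˣ) ^ (k * k')) • (G * F) := by
  induction hF using funGrading_induction with
  | zero => simp
  | add F F' _ _ h h' => rw [add_mul, mul_add, h, h', smul_add]
  | smul c F _ h => rw [smul_mul_assoc, mul_smul_comm, h, smul_comm]
  | gen f a l h =>
    induction hG using funGrading_induction with
    | zero => simp
    | add F F' _ _ h h' => rw [add_mul, mul_add, h, h', smul_add]
    | smul c F _ h => rw [smul_mul_assoc, mul_smul_comm, h, smul_comm]
    | gen f' a' l' h' =>
      rw [← h, ← h', zpow_mul, neg_one_zpow_genDeg, ← zpow_natCast, ← zpow_mul,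
        mul_comm (l.length : ℤ), zpow_mul, neg_one_zpow_genDeg, zpow_natCast, ← pow_mul, gen, gen, tmul_mul_tmul, tmul_mul_tmul, mul_comm f',
        mul_comm (MvPolynomial.monomial a' _)]
      have := ι_prod_comm (l.map fun c => (Pi.single c (1 : ℝ) : D.OddCrd → ℝ))
        (l'.map fun c => (Pi.single c (1 : ℝ) : D.OddCrd → ℝ))
      simp only [List.map_map, List.length_map, Function.comp_def] at this
      rw [this, tmul_smul_odd, ← neg_one_zpow_smul, zpow_natCast, mul_comm l'.length]

/-- Contracting a word either removes its first letter, with nonzero coefficient only if that letter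
is `c`, or keeps the letter in front of the contraction of a shorter word. Either way exactly the
degree of `c` is lost. -/
theorem contractLeft_mem (f : SmoothFun D.base) (a : D.EvenCrd →₀ ℕ) (l : List D.OddCrd)
    (c : D.OddCrd) :
    D.tmul f (MvPolynomial.monomial a 1)
      (CliffordAlgebra.contractLeft (Q := (0 : QuadraticForm ℝ (D.OddCrd → ℝ))) (LinearMap.proj c)
        (l.map fun c => ExteriorAlgebra.ι ℝ (Pi.single c (1 : ℝ))).prod) ∈
      D.funGrading (D.genDeg a l - c.1.deg) := by
  induction l with
  | nil =>
    have h : CliffordAlgebra.contractLeft (Q := (0 : QuadraticForm ℝ (D.OddCrd → ℝ)))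
        (LinearMap.proj c) (1 : ExteriorAlgebra ℝ (D.OddCrd → ℝ)) = (0 : ℝ) • 0 := by
      rw [zero_smul]; exact CliffordAlgebra.contractLeft_one _ _
    rw [List.map_nil, List.prod_nil, h, tmul_smul_odd, zero_smul]
    exact zero_mem _
  | cons v l ih =>
    have hdeg : D.genDeg a (v :: l) = v.1.deg + D.genDeg a l := by
      simp only [genDeg, List.map_cons, List.sum_cons]
      push_cast
      ring
    have hsub : ∀ x y : ExteriorAlgebra ℝ (D.OddCrd → ℝ), x - y = x + (-1 : ℝ) • y := by
      intro x y; rw [neg_one_smul, sub_eq_add_neg]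
    have h := CliffordAlgebra.contractLeft_ι_mul (Q := (0 : QuadraticForm ℝ (D.OddCrd → ℝ)))
      (LinearMap.proj c) (Pi.single v (1 : ℝ))
      (l.map fun c => ExteriorAlgebra.ι ℝ (Pi.single c (1 : ℝ))).prod
    rw [List.map_cons, List.prod_cons]
    refine Eq.mp (congrArg (· ∈ D.funGrading (D.genDeg a (v :: l) - c.1.deg))
      (congrArg (D.tmul f (MvPolynomial.monomial a 1)) (h.trans (hsub _ _))).symm) ?_
    rw [tmul_add_odd, tmul_smul_odd, tmul_smul_odd]
    refine add_mem ?_ (Submodule.smul_mem _ _ ?_)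
    · by_cases hvc : c = v
      · subst hvc
        rw [hdeg, add_sub_cancel_left]
        exact Submodule.smul_mem _ _ (D.gen_mem f a l)
      · rw [LinearMap.proj_apply, Pi.single_eq_of_ne hvc, zero_smul]
        exact zero_mem _
    · have h1 := D.mul_mem_funGrading (D.gen_mem 1 0 [v]) ih
      rw [gen, tmul_mul_tmul] at h1
      have h2 : D.genDeg 0 [v] = v.1.deg := by simp [genDeg]
      rw [h2, ← add_sub_assoc, ← hdeg] at h1
      simpa using h1

theorem deriv_mem {k : ℤ} {F : D.Fun} (hF : F ∈ D.funGrading k) (c : D.Crd) :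
    D.deriv c F ∈ D.funGrading (k - c.deg) := by
  induction hF using funGrading_induction with
  | zero => simp
  | add F F' _ _ h h' => rw [map_add]; exact add_mem h h'
  | smul r F _ h => rw [map_smul]; exact Submodule.smul_mem _ _ h
  | gen f a l h =>
    subst h
    unfold deriv
    split_ifs with h0 h
    · rw [gen, onBase_tmul, h0, Nat.cast_zero, sub_zero]
      exact D.gen_mem _ _ _
    · rw [gen, onEven_tmul, Derivation.coeFn_coe, MvPolynomial.pderiv_monomial, one_mul]
      -- For a zero exponent the subtraction in the exponent vector is truncated and the degree does
      -- not drop, but then the coefficient vanishes.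
      by_cases hc : a ⟨c, h0, h⟩ = 0
      · rw [hc, Nat.cast_zero, map_zero, ← zero_smul ℝ (0 : MvPolynomial D.EvenCrd ℝ),
          tmul_smul_even, zero_smul]
        exact zero_mem _
      · have ha : a = (a - Finsupp.single ⟨c, h0, h⟩ 1) + Finsupp.single ⟨c, h0, h⟩ 1 :=
          (tsub_add_cancel_of_le (Finsupp.single_le_iff.2 (Nat.one_le_iff_ne_zero.2 hc))).symm
        have hd : D.genDeg a l - c.deg = D.genDeg (a - Finsupp.single ⟨c, h0, h⟩ 1) l := by
          have h1 := D.genDeg_add (a - Finsupp.single ⟨c, h0, h⟩ 1) (Finsupp.single ⟨c, h0, h⟩ 1) l []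
          rw [← ha, List.append_nil] at h1
          rw [h1]
          simp [genDeg]
        have hm : MvPolynomial.monomial (a - Finsupp.single ⟨c, h0, h⟩ 1)
            ((a ⟨c, h0, h⟩ : ℕ) : ℝ) = ((a ⟨c, h0, h⟩ : ℕ) : ℝ) •
              MvPolynomial.monomial (a - Finsupp.single ⟨c, h0, h⟩ 1) (1 : ℝ) := by
          rw [MvPolynomial.smul_monomial, smul_eq_mul, mul_one]
        rw [hd, hm, tmul_smul_even]
        exact Submodule.smul_mem _ _ (D.gen_mem _ _ _)
    · rw [gen, onOdd_tmul]
      exact D.contractLeft_mem f a l ⟨c, Nat.not_even_iff_odd.1 h⟩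

end NPDomain
-- Koszul signs
/-- The product of `w i j` over the pairs `i < j`. -/
def pairProd {N : ℕ} (w : Fin N → Fin N → ℤˣ) : ℤˣ :=
  ∏ i, ∏ j, if i < j then w i j else 1

theorem pairProd_mul {N : ℕ} (v w : Fin N → Fin N → ℤˣ) :
    pairProd (fun i j => v i j * w i j) = pairProd v * pairProd w := by
  simp only [pairProd, ← Finset.prod_mul_distrib]
  refine Finset.prod_congr rfl fun i _ => Finset.prod_congr rfl fun j _ => ?_
  split_ifs <;> simp

theorem pairProd_congr {N : ℕ} {v w : Fin N → Fin N → ℤˣ} (h : ∀ i j, i < j → v i j = w i j) :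
    pairProd v = pairProd w := by
  refine Finset.prod_congr rfl fun i _ => Finset.prod_congr rfl fun j _ => ?_
  split_ifs with hij
  · exact h i j hij
  · rfl

/-- A symmetric weight is a function on unordered pairs, and `τ` permutes these. Sorting each image
pair by `min` and `max` gives the bijection on ordered representatives. -/
theorem pairProd_comp_of_symm {N : ℕ} (w : Fin N → Fin N → ℤˣ) (hw : ∀ i j, w i j = w j i)
    (τ : Equiv.Perm (Fin N)) : pairProd (fun i j => w (τ i) (τ j)) = pairProd w := by
  have h : ∀ v : Fin N → Fin N → ℤˣ, pairProd v =
      ∏ p ∈ Finset.univ.filter (fun p : Fin N × Fin N => p.1 < p.2), v p.1 p.2 := by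
    intro v
    rw [Finset.prod_filter, ← Finset.univ_product_univ, Finset.prod_product]
    rfl
  rw [h, h]
  have key : ∀ (ρ : Equiv.Perm (Fin N)) (p : Fin N × Fin N), p.1 < p.2 →
      min (ρ p.1) (ρ p.2) < max (ρ p.1) (ρ p.2) := fun ρ p hp =>
    min_lt_max.2 fun h => hp.ne (ρ.injective h)
  have inv : ∀ (ρ : Equiv.Perm (Fin N)) (p : Fin N × Fin N), p.1 < p.2 →
      (min (ρ⁻¹ (min (ρ p.1) (ρ p.2))) (ρ⁻¹ (max (ρ p.1) (ρ p.2))),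
        max (ρ⁻¹ (min (ρ p.1) (ρ p.2))) (ρ⁻¹ (max (ρ p.1) (ρ p.2)))) = p := by
    intro ρ p hp
    rcases le_total (ρ p.1) (ρ p.2) with h | h <;> simp [h, hp.le]
  refine Finset.prod_nbij' (fun p => (min (τ p.1) (τ p.2), max (τ p.1) (τ p.2)))
    (fun p => (min (τ⁻¹ p.1) (τ⁻¹ p.2), max (τ⁻¹ p.1) (τ⁻¹ p.2))) ?_ ?_ ?_ ?_ ?_
  · intro p hp
    simp only [Finset.mem_filter, Finset.mem_univ, true_and] at hp ⊢
    exact key τ p hp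
  · intro p hp
    simp only [Finset.mem_filter, Finset.mem_univ, true_and] at hp ⊢
    exact key τ⁻¹ p hp
  · intro p hp
    simp only [Finset.mem_filter, Finset.mem_univ, true_and] at hp
    exact inv τ p hp
  · intro p hp
    simp only [Finset.mem_filter, Finset.mem_univ, true_and] at hp
    simpa using inv τ⁻¹ p hp
  · intro p _
    rcases le_total (τ p.1) (τ p.2) with h | h
    · simp [h]
    · simp [h, hw (τ p.1)]

/-- The sign of moving an element of index `a` past one of index `b`, if they are out of order. -/
def inversionSign {N : ℕ} (x : Fin N → ℤ) (a b : Fin N) : ℤˣ :=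
  if b < a then (-1) ^ (x a * x b) else 1

theorem koszul_eq_pairProd {N : ℕ} (τ : Equiv.Perm (Fin N)) (x : Fin N → ℤ) :
    koszul τ x = pairProd fun i j => inversionSign x (τ i) (τ j) := by
  refine Finset.prod_congr rfl fun i _ => Finset.prod_congr rfl fun j _ => ?_
  by_cases h : i < j <;> simp [inversionSign, h]

theorem units_zpow_mul_self (k : ℤ) : ((-1 : ℤˣ) ^ k) * (-1) ^ k = 1 := by
  rw [← mul_zpow, neg_mul_neg, one_mul, one_zpow]

theorem koszul_one {N : ℕ} (x : Fin N → ℤ) : koszul (1 : Equiv.Perm (Fin N)) x = 1 := by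
  refine Finset.prod_eq_one fun i _ => Finset.prod_eq_one fun j _ => if_neg ?_
  rintro ⟨h1, h2⟩
  exact lt_asymm h1 h2

/-- The cocycle property of Koszul signs. The inversion sign of a pair after `τ`, times the one
before `τ` for the degrees `x ∘ τ`, is symmetric in the pair, so its product over all pairs is
unchanged by `ρ`. Comparing the two products gives the formula. -/
theorem koszul_mul {N : ℕ} (τ ρ : Equiv.Perm (Fin N)) (x : Fin N → ℤ) :
    koszul (τ * ρ) x = koszul ρ (x ∘ τ) * koszul τ x := by
  have hw : ∀ i j : Fin N,
      inversionSign x (τ i) (τ j) * inversionSign (x ∘ τ) i j =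
        inversionSign x (τ j) (τ i) * inversionSign (x ∘ τ) j i := by
    intro i j
    rcases lt_trichotomy i j with h | rfl | h
    · rcases lt_or_gt_of_ne (τ.injective.ne h.ne) with h' | h' <;>
        simp [inversionSign, h, h', h.not_gt, h'.not_gt, mul_comm (x (τ i))]
    · rfl
    · rcases lt_or_gt_of_ne (τ.injective.ne h.ne) with h' | h' <;>
        simp [inversionSign, h, h', h.not_gt, h'.not_gt, mul_comm (x (τ i))]
  have h1 := pairProd_comp_of_symm _ hw ρ
  have hsq : ∀ u : ℤˣ, u * u = 1 := Int.units_mul_self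
  rw [pairProd_mul, pairProd_mul, ← koszul_eq_pairProd, ← koszul_eq_pairProd] at h1
  have h2 : pairProd (fun i j => inversionSign (x ∘ τ) i j) = 1 := by
    rw [← koszul_one (x ∘ τ), koszul_eq_pairProd]; rfl
  have h3 : koszul (τ * ρ) x = pairProd fun i j => inversionSign x (τ (ρ i)) (τ (ρ j)) :=
    koszul_eq_pairProd _ _
  rw [h2, mul_one, ← h3] at h1
  rw [← h1, mul_comm (koszul ρ _), mul_assoc, hsq, mul_one]

theorem koszul_congr {N : ℕ} (τ : Equiv.Perm (Fin N)) (x y : Fin N → ℤ)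
    (h : ∀ i, Even (x i - y i)) : koszul τ x = koszul τ y := by
  refine Finset.prod_congr rfl fun i _ => Finset.prod_congr rfl fun j _ => ?_
  congr 1
  obtain ⟨s, hs⟩ := h (τ i)
  obtain ⟨t, ht⟩ := h (τ j)
  rw [sub_eq_iff_eq_add.1 hs, sub_eq_iff_eq_add.1 ht]
  have : (s + s + y (τ i)) * (t + t + y (τ j)) =
      2 * (2 * s * t + s * y (τ j) + t * y (τ i)) + y (τ i) * y (τ j) := by ring
  rw [this, zpow_add, zpow_mul]
  simp

theorem pairProd_left {N : ℕ} (u : Fin N → ℤˣ) :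
    pairProd (fun i _ => u i) = ∏ i, u i ^ (N - 1 - i.1) := by
  refine Finset.prod_congr rfl fun i _ => ?_
  rw [Finset.prod_ite, Finset.prod_const_one, mul_one, Finset.prod_const, ← Fin.card_Ioi]
  congr 2
  ext j; simp

/-- For an inverted pair, `(a + 1) (b + 1) = 1 + a b + (a + b)`: the `1` produces the signature, `a
b` the old Koszul sign, and `a + b` the change in the suspension sign between the two orders. -/
theorem koszul_add_one {N : ℕ} (τ : Equiv.Perm (Fin N)) (x : Fin N → ℤ) :
    koszul τ (fun i => x i + 1) = Equiv.Perm.sign τ * koszul τ x *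
      ((∏ i, ((-1 : ℤˣ) ^ x i) ^ (N - 1 - i.1)) * ∏ i, ((-1 : ℤˣ) ^ x (τ i)) ^ (N - 1 - i.1)) := by
  have hsign : Equiv.Perm.sign τ = pairProd fun i j => if τ j < τ i then -1 else 1 := by
    rw [Equiv.Perm.sign_eq_prod_prod_Ioi]
    refine Finset.prod_congr rfl fun i _ => ?_
    rw [← Finset.prod_filter]
    refine Finset.prod_congr (by ext j; simp) fun j hj => ?_
    have hij : i < j := by simpa using hj
    rcases lt_or_gt_of_ne (τ.injective.ne hij.ne) with h | h <;> simp [h, h.not_gt]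
  set u : Fin N → ℤˣ := fun i => (-1) ^ x i with hu
  have hsq : ∀ u : ℤˣ, u * u = 1 := Int.units_mul_self
  -- The weight of a pair is the sign of its element of smaller index. This is symmetric, so the
  -- suspension sign in the original order can be computed over the pairs permuted by `τ`.
  set w : Fin N → Fin N → ℤˣ := fun a b => if a < b then u a else u b with hw
  have hws : ∀ a b, w a b = w b a := by
    intro a b
    rcases lt_trichotomy a b with h | rfl | h
    · simp [hw, h, h.not_gt]
    · rfl
    · simp [hw, h, h.not_gt]
  have h1 : (∏ i, (u i) ^ (N - 1 - i.1)) = pairProd fun i j => w (τ i) (τ j) := by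
    rw [pairProd_comp_of_symm w hws, ← pairProd_left]
    exact pairProd_congr fun i j hij => by simp [hw, hij]
  have h2 : (∏ i, (u (τ i)) ^ (N - 1 - i.1)) = pairProd fun i _ => u (τ i) :=
    (pairProd_left fun i => u (τ i)).symm
  change _ = _ * ((∏ i, (u i) ^ (N - 1 - i.1)) * (∏ i, (u (τ i)) ^ (N - 1 - i.1)))
  rw [h1, h2, hsign, koszul_eq_pairProd, koszul_eq_pairProd, ← pairProd_mul, ← pairProd_mul,
    ← pairProd_mul]
  refine pairProd_congr fun i j hij => ?_
  rcases lt_or_gt_of_ne (τ.injective.ne hij.ne) with h | h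
  · simp [inversionSign, h, h.not_gt, hw, hsq]
  · have e : (x (τ i) + 1) * (x (τ j) + 1) = 1 + x (τ i) * x (τ j) + (x (τ j) + x (τ i)) := by ring
    simp only [inversionSign, h, h.not_gt, hw, if_true, if_false, hu, e, zpow_add, zpow_one]

theorem koszul_swap {N : ℕ} (i : Fin N) (x : Fin (N + 1) → ℤ) :
    koszul (Equiv.swap i.castSucc i.succ) x = (-1) ^ (x i.castSucc * x i.succ) := by
  have hcond : ∀ a b : Fin (N + 1), (a < b ∧ Equiv.swap i.castSucc i.succ b <
      Equiv.swap i.castSucc i.succ a) ↔ (a = i.castSucc ∧ b = i.succ) := by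
    intro a b
    constructor
    · rintro ⟨h1, h2⟩
      rw [Equiv.swap_apply_def, Equiv.swap_apply_def] at h2
      split_ifs at h2 <;> simp only [Fin.lt_def, Fin.ext_iff, Fin.val_castSucc, Fin.val_succ] at * <;>
        omega
    · rintro ⟨rfl, rfl⟩
      simp
  simp only [koszul, hcond]
  rw [Finset.prod_eq_single i.castSucc, Finset.prod_eq_single i.succ]
  · simp [mul_comm]
  · intro b _ hb; simp [hb]
  · simp
  · intro b _ hb; simp [hb]
  · simp

/-- This compares differentiating by a coordinate of degree `a` before and after permuting the
factors. Lowering the degree of the factor `τ w` alters the Koszul sign by the factors inverted with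
it. These are exactly the factors lying before it in one order but not in the other, which is the
discrepancy between the two prefix signs. -/
theorem koszul_update {N : ℕ} (τ : Equiv.Perm (Fin N)) (y : Fin N → ℤ) (w : Fin N) (a : ℤ) :
    koszul τ (Function.update y (τ w) (y (τ w) - a)) *
        (∏ u, if u < τ w then (-1 : ℤˣ) ^ (a * y u) else 1) =
      (∏ j, if j < w then (-1 : ℤˣ) ^ (a * y (τ j)) else 1) * koszul τ y := by
  set y' := Function.update y (τ w) (y (τ w) - a) with hy'
  have hne : ∀ j, j ≠ w → y' (τ j) = y (τ j) := fun j hj => by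
    rw [hy', Function.update_of_ne (τ.injective.ne hj)]
  have hself : y' (τ w) = y (τ w) - a := by rw [hy', Function.update_self]
  have hsub : ∀ k l : ℤ, (-1 : ℤˣ) ^ (k - l) = (-1) ^ k * (-1) ^ l := fun k l => by
    rw [zpow_sub, ← inv_zpow]; simp
  have hratio : koszul τ y' = koszul τ y *
      ((∏ j, if w < j ∧ τ j < τ w then (-1 : ℤˣ) ^ (a * y (τ j)) else 1) *
        ∏ j, if j < w ∧ τ w < τ j then (-1 : ℤˣ) ^ (a * y (τ j)) else 1) := by
    -- Only pairs containing `w` are affected; the correction separates the pairs in which `w` comes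
    -- first from those in which it comes second.
    have h1 : ∀ i j, (if i < j ∧ τ j < τ i then (-1 : ℤˣ) ^ (y' (τ i) * y' (τ j)) else 1) =
        (if i < j ∧ τ j < τ i then (-1 : ℤˣ) ^ (y (τ i) * y (τ j)) else 1) *
        ((if i = w then (if w < j ∧ τ j < τ w then (-1 : ℤˣ) ^ (a * y (τ j)) else 1) else 1) *
        (if j = w then (if i < w ∧ τ w < τ i then (-1 : ℤˣ) ^ (a * y (τ i)) else 1) else 1)) := by
      intro i j
      by_cases hi : i = w
      · subst hi
        by_cases hj : j = i
        · subst hj; simp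
        · rw [hself, hne j hj, if_pos rfl, if_neg hj, mul_one, sub_mul, hsub]
          by_cases h : i < j ∧ τ j < τ i <;> simp [h]
      · by_cases hj : j = w
        · subst hj
          rw [hself, hne i hi, if_pos rfl, if_neg hi, one_mul, mul_sub, hsub, mul_comm _ a]
          by_cases h : i < j ∧ τ j < τ i <;> simp [h]
        · simp [hi, hj, hne]
    simp only [koszul, h1, Finset.prod_mul_distrib]
    congr 2
    · rw [Finset.prod_eq_single w]
      · simp
      · intro b _ hb; simp [hb]
      · simp
    · refine Finset.prod_congr rfl fun i _ => ?_
      rw [Finset.prod_ite_eq' Finset.univ w, if_pos (Finset.mem_univ _)]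
  rw [hratio, mul_assoc, mul_comm (koszul τ y)]
  congr 1
  rw [← Equiv.prod_comp τ (fun u => if u < τ w then (-1 : ℤˣ) ^ (a * y u) else 1),
    ← Finset.prod_mul_distrib, ← Finset.prod_mul_distrib]
  refine Finset.prod_congr rfl fun j _ => ?_
  rcases lt_trichotomy j w with h | rfl | h
  · rcases lt_or_gt_of_ne (τ.injective.ne h.ne) with h' | h' <;> simp [h, h', h.not_gt, h'.not_gt]
  · simp
  · rcases lt_or_gt_of_ne (τ.injective.ne h.ne) with h' | h' <;>
      simp [h, h', h.not_gt, h'.not_gt]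

theorem multilinear_units_smul {ι : Type*} [Fintype ι] {V W : Type*} [AddCommGroup V] [Module ℝ V]
    [AddCommGroup W] [Module ℝ W] (φ : MultilinearMap ℝ (fun _ : ι => V) W) (c : ι → ℤˣ)
    (X : ι → V) : φ (fun i => c i • X i) = (∏ i, c i) • φ X := by
  have h : ∀ (u : ℤˣ) (v : V), u • v = ((u : ℤ) : ℝ) • v := fun u v => by
    rw [Units.smul_def, Int.cast_smul_eq_zsmul]
  have h' : ∀ (u : ℤˣ) (v : W), u • v = ((u : ℤ) : ℝ) • v := fun u v => by
    rw [Units.smul_def, Int.cast_smul_eq_zsmul]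
  simp only [h]
  rw [φ.map_smul_univ, h']
  push_cast
  rfl

theorem map_units_smul {V W : Type*} [AddCommGroup V] [Module ℝ V] [AddCommGroup W] [Module ℝ W]
    (φ : V →ₗ[ℝ] W) (u : ℤˣ) (v : V) : φ (u • v) = u • φ v := by
  rw [Units.smul_def, Units.smul_def, map_zsmul]

/-! ### `Rep` preserves degrees and intertwines permutations -/

namespace NPDomain
variable {n : ℕ} (D : NPDomain n)

theorem parity_pow_of_mem {k : ℤ} {F : D.Fun} (hF : F ∈ D.funGrading k) (a : ℕ) :
    (D.parity ^ a) F = ((-1 : ℤˣ) ^ (a * k)) • F := by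
  induction a with
  | zero => simp
  | succ a ih =>
    rw [pow_succ', Module.End.mul_apply, ih, map_units_smul, D.parity_of_mem hF, smul_smul,
      ← zpow_add]
    congr 2; push_cast; ring

theorem slotDeriv_tprod {N : ℕ} (a : D.Crd) (i : Fin N) (y : Fin N → ℤ) (f : Fin N → D.Fun)
    (hf : ∀ u, f u ∈ D.funGrading (y u)) :
    D.slotDeriv a i (PiTensorProduct.tprod ℝ f) =
      (∏ u, if u < i then (-1 : ℤˣ) ^ (a.deg * y u) else 1) •
        PiTensorProduct.tprod ℝ (Function.update f i (D.deriv a (f i))) := by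
  rw [slotDeriv, PiTensorProduct.map_tprod, ← multilinear_units_smul]
  congr 1
  funext u
  rcases lt_trichotomy u i with h | rfl | h
  · simp only [h, if_true, Function.update_of_ne h.ne]
    exact D.parity_pow_of_mem (hf u) a.deg
  · simp
  · simp [h.not_gt, h.ne']

theorem update_mem {N : ℕ} (a : D.Crd) (i : Fin N) (y : Fin N → ℤ) (f : Fin N → D.Fun)
    (hf : ∀ u, f u ∈ D.funGrading (y u)) (u : Fin N) :
    Function.update f i (D.deriv a (f i)) u ∈
      D.funGrading (Function.update y i (y i - a.deg) u) := by
  by_cases h : u = i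
  · subst h
    simpa using D.deriv_mem (hf u) a
  · simpa [h] using hf u

/-- The tensors of total degree `e`. -/
def tensorGrading (N : ℕ) (e : ℤ) : Submodule ℝ (⨂[ℝ] _ : Fin N, D.Fun) :=
  Submodule.span ℝ {t | ∃ (y : Fin N → ℤ) (f : Fin N → D.Fun),
    (∀ u, f u ∈ D.funGrading (y u)) ∧ ∑ u, y u = e ∧ t = PiTensorProduct.tprod ℝ f}

theorem slotDeriv_mem {N : ℕ} {e : ℤ} {t : ⨂[ℝ] _ : Fin N, D.Fun} (ht : t ∈ D.tensorGrading N e)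
    (a : D.Crd) (i : Fin N) : D.slotDeriv a i t ∈ D.tensorGrading N (e - a.deg) := by
  revert t
  change D.tensorGrading N e ≤ (D.tensorGrading N (e - a.deg)).comap (D.slotDeriv a i)
  refine Submodule.span_le.2 ?_
  rintro _ ⟨y, f, hf, rfl, rfl⟩
  change D.slotDeriv a i _ ∈ D.tensorGrading N _
  rw [D.slotDeriv_tprod a i y f hf, Units.smul_def]
  have hsum : ∑ u, Function.update y i (y i - a.deg) u = ∑ u, y u - a.deg := by
    rw [Finset.sum_update_of_mem (Finset.mem_univ _),
      ← Finset.add_sum_erase Finset.univ y (Finset.mem_univ i), Finset.sdiff_singleton_eq_erase]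
    ring
  have hgen : PiTensorProduct.tprod ℝ (Function.update f i (D.deriv a (f i))) ∈
      D.tensorGrading N (∑ u, y u - a.deg) :=
    Submodule.subset_span ⟨_, _, D.update_mem a i y f hf, hsum, rfl⟩
  exact zsmul_mem hgen _

theorem edgeOp_mem {N : ℕ} {e : ℤ} {t : ⨂[ℝ] _ : Fin N, D.Fun} (ht : t ∈ D.tensorGrading N e)
    (i j : Fin N) : D.edgeOp i j t ∈ D.tensorGrading N (e - n) := by
  simp only [edgeOp, LinearMap.sum_apply, LinearMap.smul_apply, Module.End.mul_apply]
  refine sum_mem fun a _ => sum_mem fun b _ => ?_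
  by_cases h : D.pairing a b = 0
  · rw [h, zero_smul]; exact zero_mem _
  · have := D.slotDeriv_mem (D.slotDeriv_mem ht b j) a i
    have hd : (n : ℤ) = b.deg + a.deg := by
      rw [← Nat.cast_add, add_comm, D.pairing_deg a b h]
    rw [hd, ← sub_sub]
    exact Submodule.smul_mem _ _ this

theorem mulMap_tprod {N : ℕ} (f : Fin N → D.Fun) :
    D.mulMap N (PiTensorProduct.tprod ℝ f) = (List.ofFn f).prod := by
  simp [mulMap]

theorem prod_ofFn_mem {N : ℕ} (y : Fin N → ℤ) (f : Fin N → D.Fun)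
    (hf : ∀ u, f u ∈ D.funGrading (y u)) : (List.ofFn f).prod ∈ D.funGrading (∑ u, y u) := by
  induction N with
  | zero => simpa using D.one_mem_funGrading
  | succ N ih =>
    rw [List.ofFn_succ, List.prod_cons, Fin.sum_univ_succ]
    exact D.mul_mem_funGrading (hf 0) (ih _ _ fun u => hf u.succ)

theorem mulMap_mem {N : ℕ} {e : ℤ} {t : ⨂[ℝ] _ : Fin N, D.Fun} (ht : t ∈ D.tensorGrading N e) :
    D.mulMap N t ∈ D.funGrading e := by
  revert t
  change D.tensorGrading N e ≤ (D.funGrading e).comap (D.mulMap N)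
  refine Submodule.span_le.2 ?_
  rintro _ ⟨y, f, hf, rfl, rfl⟩
  change D.mulMap N _ ∈ D.funGrading _
  rw [mulMap_tprod]
  exact D.prod_ofFn_mem y f hf

theorem prod_edgeOp_mem {N k : ℕ} (G : Multidigraph N k) {e : ℤ} {t : ⨂[ℝ] _ : Fin N, D.Fun}
    (ht : t ∈ D.tensorGrading N e) :
    (List.ofFn fun e => D.edgeOp (G e).1 (G e).2).prod t ∈ D.tensorGrading N (e - n * k) := by
  induction k with
  | zero => simpa using ht
  | succ k ih =>
    rw [List.ofFn_succ, List.prod_cons, Module.End.mul_apply]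
    have := D.edgeOp_mem (ih (fun i => G i.succ)) (G 0).1 (G 0).2
    convert this using 2
    push_cast; ring

theorem rep_mk {N k : ℕ} (G : Multidigraph N k) : D.rep (Gra.mk _ G) = D.repGraph G := by
  simp [rep, Gra.lift, Gra.mk]

theorem repGraph_apply {N k : ℕ} (G : Multidigraph N k) (f : Fin N → D.Fun) :
    D.repGraph G f = D.mulMap N
      ((List.ofFn fun e => D.edgeOp (G e).1 (G e).2).prod (PiTensorProduct.tprod ℝ f)) := rfl

end NPDomain

@[elab_as_elim]
theorem Gra.induction {d : ℤ} {N k : ℕ} {motive : Gra d N k → Prop} (γ : Gra d N k)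
    (mk : ∀ G, motive (Gra.mk d G)) (add : ∀ a b, motive a → motive b → motive (a + b))
    (smul : ∀ (c : ℝ) a, motive a → motive (c • a)) (zero : motive 0) : motive γ := by
  obtain ⟨w, rfl⟩ := Submodule.mkQ_surjective _ γ
  induction w using Finsupp.induction_linear with
  | zero => rw [map_zero]; exact zero
  | add a b ha hb => rw [map_add]; exact add _ _ ha hb
  | single G c =>
    rw [← mul_one c, ← smul_eq_mul, ← Finsupp.smul_single, map_smul]
    exact smul _ _ (mk G)

theorem Gra.act_mk (d : ℤ) {N k : ℕ} (σ : Equiv.Perm (Fin N)) (G : Multidigraph N k) :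
    Gra.act d σ (Gra.mk d G) = Gra.mk d (relabel σ G) := by
  simp [act, Gra.lift, Gra.mk]

namespace NPDomain
variable {n : ℕ} (D : NPDomain n)

theorem rep_mem {N k : ℕ} (γ : Gra ((n : ℤ) + 1) N k) (y : Fin N → ℤ) (f : Fin N → D.Fun)
    (hf : ∀ u, f u ∈ D.funGrading (y u)) : D.rep γ f ∈ D.funGrading (∑ u, y u - n * k) := by
  induction γ using Gra.induction with
  | zero => simp
  | add a b ha hb => rw [map_add, add_apply]; exact add_mem ha hb
  | smul c a ha => rw [map_smul, smul_apply]; exact Submodule.smul_mem _ _ ha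
  | mk G =>
    rw [rep_mk, repGraph_apply]
    exact D.mulMap_mem (D.prod_edgeOp_mem G (Submodule.subset_span ⟨y, f, hf, rfl, rfl⟩))

/-- Pairs of tensors that are related by the graded permutation `τ` of the factors. -/
def permRel {N : ℕ} (τ : Equiv.Perm (Fin N)) :
    Submodule ℝ ((⨂[ℝ] _ : Fin N, D.Fun) × (⨂[ℝ] _ : Fin N, D.Fun)) :=
  Submodule.span ℝ {t | ∃ (y : Fin N → ℤ) (f : Fin N → D.Fun),
    (∀ u, f u ∈ D.funGrading (y u)) ∧
      t = (PiTensorProduct.tprod ℝ f, koszul τ y • PiTensorProduct.tprod ℝ (f ∘ τ))}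

/-- The Koszul sign is available only on homogeneous tensors, so a linear relation takes the place
of a graded permutation operator. Its preservation is an inclusion of submodules, checked on
generators, where it is `koszul_update`. -/
theorem slotDeriv_permRel {N : ℕ} (τ : Equiv.Perm (Fin N)) (a : D.Crd) (w : Fin N)
    {t : (⨂[ℝ] _ : Fin N, D.Fun) × (⨂[ℝ] _ : Fin N, D.Fun)} (ht : t ∈ D.permRel τ) :
    (D.slotDeriv a (τ w) t.1, D.slotDeriv a w t.2) ∈ D.permRel τ := by
  revert t
  change D.permRel τ ≤ (D.permRel τ).comap
    (LinearMap.prodMap (D.slotDeriv a (τ w)) (D.slotDeriv a w))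
  refine Submodule.span_le.2 ?_
  rintro _ ⟨y, f, hf, rfl⟩
  change (D.slotDeriv a (τ w) (PiTensorProduct.tprod ℝ f),
    D.slotDeriv a w (koszul τ y • PiTensorProduct.tprod ℝ (f ∘ τ))) ∈ D.permRel τ
  have hgen := Submodule.subset_span (R := ℝ) (s := {t | ∃ (y : Fin N → ℤ) (f : Fin N → D.Fun),
    (∀ u, f u ∈ D.funGrading (y u)) ∧
      t = (PiTensorProduct.tprod ℝ f, koszul τ y • PiTensorProduct.tprod ℝ (f ∘ τ))})
    ⟨_, _, D.update_mem a (τ w) y f hf, rfl⟩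
  rw [map_units_smul, D.slotDeriv_tprod a (τ w) y f hf,
    D.slotDeriv_tprod a w (y ∘ τ) (f ∘ τ) (fun u => hf (τ u)), smul_smul]
  have hk := koszul_update τ y w a.deg
  have hc : Function.update (f ∘ τ) w (D.deriv a ((f ∘ τ) w)) =
      Function.update f (τ w) (D.deriv a (f (τ w))) ∘ τ :=
    (Function.update_comp_eq_of_injective f τ.injective w _).symm
  rw [hc, mul_comm (koszul τ y)]
  simp only [Function.comp_apply]
  rw [← hk, mul_comm (koszul τ _), mul_smul]
  have := zsmul_mem hgen ((∏ u, if u < τ w then (-1 : ℤˣ) ^ (a.deg * y u) else 1 : ℤˣ) : ℤ)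
  rw [← Units.smul_def] at this
  exact this

theorem edgeOp_permRel {N : ℕ} (τ : Equiv.Perm (Fin N)) (v w : Fin N)
    {t : (⨂[ℝ] _ : Fin N, D.Fun) × (⨂[ℝ] _ : Fin N, D.Fun)} (ht : t ∈ D.permRel τ) :
    (D.edgeOp (τ v) (τ w) t.1, D.edgeOp v w t.2) ∈ D.permRel τ := by
  have h : (D.edgeOp (τ v) (τ w) t.1, D.edgeOp v w t.2) = ∑ a : D.Crd, ∑ b : D.Crd,
      D.pairing a b • (D.slotDeriv a (τ v) (D.slotDeriv b (τ w) t.1),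
        D.slotDeriv a v (D.slotDeriv b w t.2)) := by
    ext1 <;> simp [edgeOp, LinearMap.sum_apply, Prod.fst_sum, Prod.snd_sum]
  rw [h]
  exact sum_mem fun a _ => sum_mem fun b _ => Submodule.smul_mem _ _
    (D.slotDeriv_permRel τ a v (D.slotDeriv_permRel τ b w ht))

theorem prod_edgeOp_permRel {N k : ℕ} (τ : Equiv.Perm (Fin N)) (G : Multidigraph N k)
    {t : (⨂[ℝ] _ : Fin N, D.Fun) × (⨂[ℝ] _ : Fin N, D.Fun)} (ht : t ∈ D.permRel τ) :
    ((List.ofFn fun e => D.edgeOp (τ (G e).1) (τ (G e).2)).prod t.1,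
      (List.ofFn fun e => D.edgeOp (G e).1 (G e).2).prod t.2) ∈ D.permRel τ := by
  induction k with
  | zero => simpa using ht
  | succ k ih =>
    rw [List.ofFn_succ, List.prod_cons, List.ofFn_succ, List.prod_cons]
    exact D.edgeOp_permRel τ _ _ (ih fun i => G i.succ)

end NPDomain

/-- Unlike in `prod_ofFn_perm`, only the two exchanged neighbours are assumed to commute up to `ε`.
This is needed since the sign for functions depends on the degrees of the pair. -/
theorem prod_ofFn_swap {A : Type} [Ring A] (ε : ℤˣ) {k : ℕ} (i : Fin k) (g : Fin (k + 1) → A)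
    (hg : g i.succ * g i.castSucc = ε • (g i.castSucc * g i.succ)) :
    (List.ofFn (g ∘ Equiv.swap i.castSucc i.succ)).prod = ε • (List.ofFn g).prod := by
  induction k with
  | zero => exact i.elim0
  | succ k ih =>
    induction i using Fin.cases with
    | zero =>
      have h2 : ∀ x : Fin k, Equiv.swap (0 : Fin (k + 2)) 1 x.succ.succ = x.succ.succ := by
        intro x
        refine Equiv.swap_apply_of_ne_of_ne (Fin.succ_ne_zero _) ?_
        intro h
        exact Fin.succ_ne_zero x (Fin.succ_injective _ (by simpa using h))
      simp only [Fin.castSucc_zero, Fin.succ_zero_eq_one] at hg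
      simp only [List.ofFn_succ, List.prod_cons, Function.comp_apply, Fin.castSucc_zero,
        Fin.succ_zero_eq_one, Equiv.swap_apply_left, Equiv.swap_apply_right, h2]
      rw [← mul_assoc, hg, smul_mul_assoc, mul_assoc]
    | succ i =>
      have h0 : Equiv.swap i.succ.castSucc i.succ.succ (0 : Fin (k + 2)) = 0 := by
        refine Equiv.swap_apply_of_ne_of_ne ?_ (Fin.succ_ne_zero _).symm
        rw [Fin.castSucc_succ]
        exact (Fin.succ_ne_zero _).symm
      have h1 : ∀ x : Fin (k + 1), Equiv.swap i.succ.castSucc i.succ.succ x.succ =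
          (Equiv.swap i.castSucc i.succ x).succ := by
        intro x
        rw [Fin.castSucc_succ]
        exact (Fin.succ_injective _).swap_apply _ _ _
      have := ih i (fun x => g x.succ) hg
      rw [List.ofFn_succ, List.prod_cons, List.ofFn_succ (f := g), List.prod_cons]
      simp only [Function.comp_apply, h0, h1]
      simp only [Function.comp_def] at this
      rw [this, mul_smul_comm]

namespace NPDomain
variable {n : ℕ} (D : NPDomain n)

/-- Adjacent transpositions generate the symmetric group. Each costs the sign of graded
commutativity, and `koszul_mul` shows that these signs accumulate to the Koszul sign. -/
theorem prod_ofFn_comp_perm {N : ℕ} (τ : Equiv.Perm (Fin N)) (y : Fin N → ℤ) (f : Fin N → D.Fun)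
    (hf : ∀ u, f u ∈ D.funGrading (y u)) :
    (List.ofFn (f ∘ τ)).prod = koszul τ y • (List.ofFn f).prod := by
  rcases N with _ | N
  · have : τ = 1 := Subsingleton.elim _ _
    subst this
    simp [koszul_one]
  · have hτ : τ ∈ Submonoid.closure
        (Set.range fun i : Fin N => Equiv.swap i.castSucc i.succ) := by
      rw [Equiv.Perm.mclosure_swap_castSucc_succ]; trivial
    induction hτ using Submonoid.closure_induction_right with
    | one => simp [koszul_one]
    | mul_right τ _ s hs ih =>
      obtain ⟨i, rfl⟩ := hs
      rw [Equiv.Perm.coe_mul, ← Function.comp_assoc,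
        prod_ofFn_swap ((-1) ^ (y (τ i.castSucc) * y (τ i.succ))), ih, koszul_mul, koszul_swap,
        smul_smul]
      · rfl
      · rw [mul_comm (y _)]
        exact D.mul_comm_of_mem (hf _) (hf _)

theorem mulMap_permRel {N : ℕ} (τ : Equiv.Perm (Fin N))
    {t : (⨂[ℝ] _ : Fin N, D.Fun) × (⨂[ℝ] _ : Fin N, D.Fun)} (ht : t ∈ D.permRel τ) :
    D.mulMap N t.1 = D.mulMap N t.2 := by
  revert t
  change D.permRel τ ≤ LinearMap.eqLocus (D.mulMap N ∘ₗ LinearMap.fst ℝ _ _)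
    (D.mulMap N ∘ₗ LinearMap.snd ℝ _ _)
  refine Submodule.span_le.2 ?_
  rintro _ ⟨y, f, hf, rfl⟩
  change D.mulMap N (PiTensorProduct.tprod ℝ f) =
    D.mulMap N (koszul τ y • PiTensorProduct.tprod ℝ (f ∘ τ))
  rw [map_units_smul, mulMap_tprod, mulMap_tprod, D.prod_ofFn_comp_perm τ y f hf, smul_smul,
    Int.units_mul_self, one_smul]

/-- The relation `permRel σ⁻¹` is transported through the edge operators of the relabelled and of
the original graph, and multiplication takes equal values on related tensors. -/
theorem rep_act {N k : ℕ} (σ : Equiv.Perm (Fin N)) (γ : Gra ((n : ℤ) + 1) N k) (y : Fin N → ℤ)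
    (f : Fin N → D.Fun) (hf : ∀ u, f u ∈ D.funGrading (y u)) :
    D.rep (Gra.act _ σ γ) f = koszul σ⁻¹ y • D.rep γ (f ∘ ⇑σ⁻¹) := by
  induction γ using Gra.induction with
  | zero => simp
  | add a b ha hb => simp only [map_add, add_apply, ha, hb, smul_add]
  | smul c a ha => simp only [map_smul, smul_apply, ha, smul_comm c]
  | mk G =>
    rw [Gra.act_mk, rep_mk, rep_mk, repGraph_apply, repGraph_apply, ← map_units_smul,
      ← map_units_smul]
    exact D.mulMap_permRel σ⁻¹
      (D.prod_edgeOp_permRel σ⁻¹ G (Submodule.subset_span ⟨y, f, hf, rfl⟩))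

end NPDomain
-- `Rep` respects partial composition
theorem map_prod_ofFn_of_leibniz {A : Type*} [Ring A] (D P Q : A →+ A)
    (hD : ∀ x y, D (x * y) = D x * Q y + P x * D y) (hQ : ∀ x y, Q (x * y) = Q x * Q y)
    (hD1 : D 1 = 0) (hQ1 : Q 1 = 1) {N : ℕ} (t : Fin N → A) :
    D (List.ofFn t).prod =
      ∑ v, (List.ofFn fun w => if w < v then P (t w) else if w = v then D (t w) else Q (t w)).prod := by
  have hQp : ∀ {N : ℕ} (t : Fin N → A), Q (List.ofFn t).prod = (List.ofFn fun w => Q (t w)).prod := by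
    intro N t
    induction N with
    | zero => simpa using hQ1
    | succ N ih => rw [List.ofFn_succ, List.prod_cons, hQ, ih, List.ofFn_succ, List.prod_cons]
  induction N with
  | zero => simpa using hD1
  | succ N ih =>
    rw [List.ofFn_succ, List.prod_cons, hD, ih, hQp, Fin.sum_univ_succ, Finset.mul_sum]
    congr 1
    · simp [List.ofFn_succ, Fin.succ_ne_zero]
    · refine Finset.sum_congr rfl fun v _ => ?_
      rw [List.ofFn_succ, List.prod_cons]
      simp [Fin.succ_pos]

theorem prod_ofFn_eq_single {A : Type*} [Monoid A] {N : ℕ} (x : Fin N → A) (t : Fin N)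
    (h : ∀ v, v ≠ t → x v = 1) : (List.ofFn x).prod = x t := by
  induction N with
  | zero => exact t.elim0
  | succ N ih =>
    rw [List.ofFn_succ, List.prod_cons]
    induction t using Fin.cases with
    | zero =>
      have : (fun i : Fin N => x i.succ) = fun _ => 1 := funext fun i => h _ (Fin.succ_ne_zero i)
      simp [this]
    | succ t =>
      rw [h 0 (Fin.succ_ne_zero t).symm, one_mul]
      exact ih (fun i => x i.succ) t fun v hv => h _ fun hh => hv (Fin.succ_injective _ hh)

theorem prod_ofFn_eq_one {A : Type*} [Monoid A] {N : ℕ} (x : Fin N → A) (h : ∀ v, x v = 1) :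
    (List.ofFn x).prod = 1 := by
  rw [funext h]; simp

theorem prod_ofFn_split {A : Type*} [Monoid A] {a b c : ℕ} (h : a + b = c) (x : Fin c → A) :
    (List.ofFn x).prod = (List.ofFn fun i : Fin a => x ⟨i.1, by omega⟩).prod *
      (List.ofFn fun i : Fin b => x ⟨a + i.1, by omega⟩).prod := by
  subst h
  rw [List.ofFn_add, List.prod_append]
  rfl

namespace NPDomain
variable {n : ℕ} (D : NPDomain n)

/-- The linear map `f_1 ⊗ ⋯ ⊗ f_N ↦ g_1 ⊗ ⋯ ⊗ g_M`, where `g_i` is the product of the `f_v` with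
`c v = i`. -/
def spread {N M : ℕ} (c : Fin N → Fin M) : (⨂[ℝ] _ : Fin N, D.Fun) →ₗ[ℝ] ⨂[ℝ] _ : Fin M, D.Fun :=
  PiTensorProduct.lift ((MultilinearMap.mkPiAlgebraFin ℝ N (⨂[ℝ] _ : Fin M, D.Fun)).compLinearMap
    fun v => (PiTensorProduct.singleAlgHom (A := fun _ : Fin M => D.Fun) (c v)).toLinearMap)

/-- The tensor with `x` in the slot `i` and `1` in the other slots. -/
abbrev single {M : ℕ} (i : Fin M) (x : D.Fun) : ⨂[ℝ] _ : Fin M, D.Fun :=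
  PiTensorProduct.tprod ℝ (Pi.mulSingle i x)

theorem spread_tprod {N M : ℕ} (c : Fin N → Fin M) (f : Fin N → D.Fun) :
    D.spread c (PiTensorProduct.tprod ℝ f) = (List.ofFn fun v => D.single (c v) (f v)).prod := by
  rw [spread, PiTensorProduct.lift.tprod, MultilinearMap.compLinearMap_apply,
    MultilinearMap.mkPiAlgebraFin_apply]
  rfl

/-- Products in the tensor power are taken slot by slot, without Koszul signs; the signs of
derivatives are carried by `slotDeriv` instead. -/
theorem spread_tprod_eq_tprod {N M : ℕ} (c : Fin N → Fin M) (f : Fin N → D.Fun) :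
    D.spread c (PiTensorProduct.tprod ℝ f) = PiTensorProduct.tprod ℝ fun i =>
      (List.ofFn fun v => (Pi.mulSingle (c v) (f v) : Fin M → D.Fun) i).prod := by
  rw [spread_tprod]
  have h := map_list_prod (PiTensorProduct.tprodMonoidHom ℝ (A := fun _ : Fin M => D.Fun))
    (List.ofFn fun v => (Pi.mulSingle (c v) (f v) : Fin M → D.Fun))
  rw [List.map_ofFn] at h
  refine h.symm.trans ?_
  change PiTensorProduct.tprod ℝ _ = _
  congr 1
  funext i
  have h' := map_list_prod (Pi.evalMonoidHom (fun _ : Fin M => D.Fun) i)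
    (List.ofFn fun v => (Pi.mulSingle (c v) (f v) : Fin M → D.Fun))
  rw [List.map_ofFn] at h'
  exact h'

theorem map_single {M : ℕ} (φ : Fin M → Module.End ℝ D.Fun) (i : Fin M) (x : D.Fun)
    (h : ∀ j, j ≠ i → φ j 1 = 1) : PiTensorProduct.map φ (D.single i x) = D.single i (φ i x) := by
  rw [single, PiTensorProduct.map_tprod]
  congr 1
  funext j
  by_cases hj : j = i
  · subst hj; simp
  · simp [hj, h j hj]

/-- The operators by which `slotDeriv a i` is a twisted derivation. -/
def slotParity {M : ℕ} (a : ℕ) (s : Fin M → Prop) [DecidablePred s] :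
    Module.End ℝ (⨂[ℝ] _ : Fin M, D.Fun) :=
  PiTensorProduct.map fun j => if s j then D.parity ^ a else 1

theorem slotParity_mul {M : ℕ} (a : ℕ) (s : Fin M → Prop) [DecidablePred s]
    (t u : ⨂[ℝ] _ : Fin M, D.Fun) :
    D.slotParity a s (t * u) = D.slotParity a s t * D.slotParity a s u := by
  induction t using PiTensorProduct.induction_on with
  | add t t' h h' => simp only [add_mul, map_add, h, h']
  | smul_tprod r f =>
    induction u using PiTensorProduct.induction_on with
    | add t t' h h' => simp only [mul_add, map_add, h, h']
    | smul_tprod r' f' =>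
      simp only [smul_mul_assoc, mul_smul_comm, map_smul, PiTensorProduct.tprod_mul_tprod,
        slotParity, PiTensorProduct.map_tprod]
      congr 3
      funext j
      by_cases h : s j <;> simp [h, parity_pow_mul]

theorem slotParity_one {M : ℕ} (a : ℕ) (s : Fin M → Prop) [DecidablePred s] :
    D.slotParity a s 1 = 1 := by
  rw [PiTensorProduct.one_def, slotParity, PiTensorProduct.map_tprod]
  congr 1
  funext j
  by_cases h : s j <;> simp [h, parity_pow_one]

/-- A slot derivative is a derivation twisted on both sides. The parity of the slots before `i` acts
on both factors, and the Leibniz rule in the slot `i` itself adds the parity of that slot on the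
left factor only. -/
theorem slotDeriv_mul {M : ℕ} (a : D.Crd) (i : Fin M) (t u : ⨂[ℝ] _ : Fin M, D.Fun) :
    D.slotDeriv a i (t * u) = D.slotDeriv a i t * D.slotParity a.deg (· < i) u +
      D.slotParity a.deg (· ≤ i) t * D.slotDeriv a i u := by
  induction t using PiTensorProduct.induction_on with
  | add t t' h h' => simp only [add_mul, map_add, h, h']; abel
  | smul_tprod r f =>
    induction u using PiTensorProduct.induction_on with
    | add t t' h h' => simp only [mul_add, map_add, h, h']; abel
    | smul_tprod r' f' =>
      simp only [smul_mul_assoc, mul_smul_comm, map_smul, ← smul_add]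
      congr 2
      simp only [slotDeriv, slotParity, PiTensorProduct.map_tprod, PiTensorProduct.tprod_mul_tprod]
      set g : Fin M → D.Fun := fun j =>
        (if j < i then D.parity ^ a.deg else if j = i then D.deriv a else 1) ((f * f') j) with hg
      -- The slot `i` is exposed as an explicit sum so that multilinearity splits the tensor into
      -- the two terms of the Leibniz rule.
      have e1 : g = Function.update g i (D.deriv a (f i) * f' i +
          (D.parity ^ a.deg) (f i) * D.deriv a (f' i)) := by
        rw [← deriv_mul, eq_comm, Function.update_eq_self_iff]
        simp [hg]
      rw [e1, MultilinearMap.map_update_add]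
      congr 2
      · funext j
        rcases lt_trichotomy j i with h | rfl | h
        · simp [hg, h, h.ne, parity_pow_mul]
        · simp
        · simp [hg, h.not_gt, h.ne']
      · funext j
        rcases lt_trichotomy j i with h | rfl | h
        · simp [hg, h, h.ne, h.le, parity_pow_mul]
        · simp
        · simp [hg, h.not_gt, h.ne', h.not_ge]

theorem slotDeriv_one {M : ℕ} (a : D.Crd) (i : Fin M) :
    D.slotDeriv a i (1 : ⨂[ℝ] _ : Fin M, D.Fun) = 0 := by
  have h := D.slotDeriv_mul a i 1 1
  rw [slotParity_one, slotParity_one, mul_one, mul_one, one_mul] at h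
  simpa using h

theorem slotDeriv_single_of_ne {M : ℕ} (a : D.Crd) {i j : Fin M} (h : i ≠ j) (x : D.Fun) :
    D.slotDeriv a i (D.single j x) = 0 := by
  rw [slotDeriv, single, PiTensorProduct.map_tprod]
  exact (PiTensorProduct.tprod ℝ).map_coord_zero i (by simp [h, deriv_one])

/-- A derivative of a slot holding a product is the sum of the derivatives of its factors.
Monotonicity of `c` makes the signs agree: factors before `v` land in slots up to `i` and receive a
parity, while factors after `v` land in slots from `i` on and receive none. -/
theorem slotDeriv_spread {N M : ℕ} (c : Fin N → Fin M) (hc : Monotone c) (a : D.Crd) (i : Fin M)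
    (t : ⨂[ℝ] _ : Fin N, D.Fun) :
    D.slotDeriv a i (D.spread c t) =
      ∑ v, if c v = i then D.spread c (D.slotDeriv a v t) else 0 := by
  induction t using PiTensorProduct.induction_on with
  | add t t' h h' =>
    simp only [map_add, h, h', ← Finset.sum_add_distrib]
    refine Finset.sum_congr rfl fun v _ => ?_
    split_ifs <;> simp
  | smul_tprod r f =>
    simp only [map_smul]
    have key : D.slotDeriv a i (D.spread c (PiTensorProduct.tprod ℝ f)) =
        ∑ v, if c v = i then D.spread c (D.slotDeriv a v (PiTensorProduct.tprod ℝ f)) else 0 := by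
      rw [spread_tprod]
      refine (map_prod_ofFn_of_leibniz (D.slotDeriv a i).toAddMonoidHom
        (D.slotParity a.deg (· ≤ i)).toAddMonoidHom (D.slotParity a.deg (· < i)).toAddMonoidHom
        (D.slotDeriv_mul a i) (D.slotParity_mul _ _) (D.slotDeriv_one a i)
        (D.slotParity_one _ _) _).trans ?_
      refine Finset.sum_congr rfl fun v _ => ?_
      by_cases hv : c v = i
      · have e : D.slotDeriv a v (PiTensorProduct.tprod ℝ f) = PiTensorProduct.tprod ℝ fun j =>
            (if j < v then D.parity ^ a.deg else if j = v then D.deriv a else 1) (f j) := by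
          rw [slotDeriv, PiTensorProduct.map_tprod]
        rw [if_pos hv, e, spread_tprod]
        congr 2
        funext w
        have h1 : ∀ (s : Prop) [Decidable s], (if s then D.parity ^ a.deg else 1) (1 : D.Fun) = 1 := by
          intro s _; split_ifs <;> simp [parity_pow_one]
        rcases lt_trichotomy w v with h | rfl | h
        · simp only [h, if_true]
          have := hc h.le
          refine (D.map_single _ _ _ fun j _ => h1 _).trans ?_
          rw [if_pos (hv ▸ this)]
        · simp only [lt_irrefl, if_false, if_true]
          refine (D.map_single _ _ _ fun j hj => ?_).trans ?_
          · rw [hv] at hj; simp only [hj, if_false]; exact h1 _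
          · simp [hv]
        · simp only [h.not_gt, h.ne', if_false]
          refine (D.map_single _ _ _ fun j _ => h1 _).trans ?_
          rw [if_neg (not_lt.2 (hv ▸ hc h.le))]
      · rw [if_neg hv]
        -- If `v` does not land in the slot `i`, the derivative hits the unit in that slot, and one
        -- factor of the product is zero.
        refine List.prod_eq_zero (List.mem_ofFn.2 ⟨v, ?_⟩)
        simp only [lt_irrefl, if_false, if_true]
        exact D.slotDeriv_single_of_ne a (Ne.symm hv) _
    rw [key, Finset.smul_sum]
    refine Finset.sum_congr rfl fun v _ => ?_
    split_ifs <;> simp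

theorem edgeOp_spread {N M : ℕ} (c : Fin N → Fin M) (hc : Monotone c) (i j : Fin M)
    (t : ⨂[ℝ] _ : Fin N, D.Fun) :
    D.edgeOp i j (D.spread c t) =
      ∑ v : Fin N × Fin N, if (c v.1, c v.2) = (i, j) then D.spread c (D.edgeOp v.1 v.2 t) else 0 := by
  rw [Fintype.sum_prod_type]
  simp only [edgeOp, LinearMap.sum_apply, LinearMap.smul_apply, Module.End.mul_apply]
  have h : ∀ a b, D.slotDeriv a i (D.slotDeriv b j (D.spread c t)) = ∑ v, ∑ w,
      if (c v, c w) = (i, j) then D.spread c (D.slotDeriv a v (D.slotDeriv b w t)) else 0 := by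
    intro a b
    rw [D.slotDeriv_spread c hc, map_sum, Finset.sum_comm]
    refine Finset.sum_congr rfl fun w _ => ?_
    by_cases hw : c w = j
    · rw [if_pos hw, D.slotDeriv_spread c hc]
      simp [hw]
    · simp [hw]
  simp only [h, map_sum, map_smul, Finset.smul_sum, Prod.mk.injEq]
  rw [Finset.sum_congr rfl fun a _ => Finset.sum_comm, Finset.sum_comm]
  refine Finset.sum_congr rfl fun v _ => ?_
  rw [Finset.sum_congr rfl fun a _ => Finset.sum_comm, Finset.sum_comm]
  refine Finset.sum_congr rfl fun w _ => ?_
  split_ifs <;> simp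

-- Iterating the Leibniz rule over the edges distributes each edge end over the fibre of `c`. For `c
-- = collapse h` the condition on `E` is `IsReconnection`.
open Classical in
theorem prod_edgeOp_spread {N M k : ℕ} (c : Fin N → Fin M) (hc : Monotone c)
    (G : Multidigraph M k) (t : ⨂[ℝ] _ : Fin N, D.Fun) :
    (List.ofFn fun e => D.edgeOp (G e).1 (G e).2).prod (D.spread c t) =
      ∑ E : Multidigraph N k, if ∀ e, (c (E e).1, c (E e).2) = G e then
        D.spread c ((List.ofFn fun e => D.edgeOp (E e).1 (E e).2).prod t) else 0 := by
  induction k with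
  | zero => simp
  | succ k ih =>
    rw [List.ofFn_succ, List.prod_cons, Module.End.mul_apply, ih fun i => G i.succ, map_sum]
    rw [← (Fin.consEquiv fun _ => Fin N × Fin N).sum_comp, Fintype.sum_prod_type, Finset.sum_comm]
    refine Finset.sum_congr rfl fun E _ => ?_
    by_cases hE : ∀ e, (c (E e).1, c (E e).2) = G e.succ
    · rw [if_pos hE, D.edgeOp_spread c hc]
      refine Finset.sum_congr rfl fun v _ => ?_
      simp [Fin.consEquiv, Fin.forall_fin_succ, hE, List.ofFn_succ]
    · rw [if_neg hE, map_zero]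
      symm
      refine Finset.sum_eq_zero fun v _ => if_neg fun h => hE fun e => ?_
      simpa [Fin.consEquiv] using h e.succ

end NPDomain
theorem monotone_collapse {p q P : ℕ} (h : p + q = P) : Monotone (collapse h) := by
  intro v w hvw
  simp only [collapse, Fin.le_def] at hvw ⊢
  omega

theorem monotone_embed {p q P : ℕ} (h : p + q = P) : Monotone (embed h) := fun _ _ hvw => hvw

theorem embed_injective {p q P : ℕ} (h : p + q = P) : Function.Injective (embed h) := by
  intro v w hvw
  simpa [embed, Fin.ext_iff] using hvw

/-- The last `p` entries of a tuple. -/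
def tailArgs {p q P : ℕ} (h : p + q = P) {A : Type*} (f : Fin (P + 1) → A) : Fin p → A :=
  fun i => f ⟨q + 1 + i.1, by omega⟩

namespace NPDomain
variable {n : ℕ} (D : NPDomain n)

/-- The tensor `1 ⊗ ⋯ ⊗ 1 ⊗ f_{q + 1} ⊗ ⋯ ⊗ f_P`. -/
def tailTensor {P : ℕ} (q : ℕ) (f : Fin (P + 1) → D.Fun) : ⨂[ℝ] _ : Fin (P + 1), D.Fun :=
  PiTensorProduct.tprod ℝ fun j => if j.1 < q + 1 then 1 else f j

/-- Applied to the initial entries of `f`, this factors a tensor into the part in the first `q + 1`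
slots, on which the inserted graph acts, and a tail with units in those slots. -/
theorem spread_embed_mul {p q P : ℕ} (h : p + q = P) (g : Fin (q + 1) → D.Fun)
    (f : Fin (P + 1) → D.Fun) :
    D.spread (embed h) (PiTensorProduct.tprod ℝ g) * D.tailTensor q f =
      PiTensorProduct.tprod ℝ fun j => if hj : j.1 < q + 1 then g ⟨j.1, hj⟩ else f j := by
  rw [spread_tprod_eq_tprod, tailTensor, PiTensorProduct.tprod_mul_tprod]
  congr 1
  funext j
  by_cases hj : j.1 < q + 1
  · simp only [Pi.mul_apply, hj, if_true, dif_pos, mul_one]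
    have e : j = embed h ⟨j.1, hj⟩ := rfl
    rw [prod_ofFn_eq_single _ ⟨j.1, hj⟩]
    · rw [← e, Pi.mulSingle_eq_same]
    · intro v hv
      rw [e]
      exact Pi.mulSingle_eq_of_ne (fun hh => hv (embed_injective h hh).symm) _
  · simp only [Pi.mul_apply, hj, if_false, dif_neg, not_false_eq_true]
    rw [prod_ofFn_eq_one, one_mul]
    intro v
    refine Pi.mulSingle_eq_of_ne (fun hh => hj ?_) _
    rw [hh]
    exact v.2

theorem spread_collapse_tprod {p q P : ℕ} (h : p + q = P) (f : Fin (P + 1) → D.Fun) :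
    D.spread (collapse h) (PiTensorProduct.tprod ℝ f) =
      PiTensorProduct.tprod ℝ (Fin.cons (List.ofFn fun v => f (embed h v)).prod (tailArgs h f) :
        Fin (p + 1) → D.Fun) := by
  rw [spread_tprod_eq_tprod]
  congr 1
  funext i
  have hP : (q + 1) + p = P + 1 := by omega
  rw [prod_ofFn_split hP]
  induction i using Fin.cases with
  | zero =>
    rw [Fin.cons_zero, prod_ofFn_eq_one (fun i : Fin p => _), mul_one]
    · congr 2
      funext v
      have e : (collapse h ⟨v.1, by omega⟩ : Fin (p + 1)) = 0 := by
        simp only [collapse, Fin.ext_iff, Fin.val_zero]; omega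
      rw [e, Pi.mulSingle_eq_same]
      rfl
    · intro v
      refine Pi.mulSingle_eq_of_ne (fun hh => ?_) _
      simp only [collapse, Fin.ext_iff, Fin.val_zero] at hh
      omega
  | succ s =>
    rw [Fin.cons_succ, prod_ofFn_eq_one (fun i : Fin (q + 1) => _), one_mul, prod_ofFn_eq_single _ s]
    · have e : (collapse h ⟨q + 1 + s.1, by omega⟩ : Fin (p + 1)) = s.succ := by
        simp only [collapse, Fin.ext_iff, Fin.val_succ]; omega
      rw [e, Pi.mulSingle_eq_same]
      rfl
    · intro v hv
      refine Pi.mulSingle_eq_of_ne (fun hh => hv ?_) _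
      simp only [collapse, Fin.ext_iff, Fin.val_succ] at hh ⊢
      omega
    · intro v
      refine Pi.mulSingle_eq_of_ne (fun hh => ?_) _
      simp only [collapse, Fin.ext_iff, Fin.val_succ] at hh
      omega

theorem mulMap_spread_collapse {p q P : ℕ} (h : p + q = P) (t : ⨂[ℝ] _ : Fin (P + 1), D.Fun) :
    D.mulMap (p + 1) (D.spread (collapse h) t) = D.mulMap (P + 1) t := by
  induction t using PiTensorProduct.induction_on with
  | add t t' h h' => simp only [map_add, h, h']
  | smul_tprod r f =>
    have hP : (q + 1) + p = P + 1 := by omega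
    rw [map_smul, map_smul, map_smul, spread_collapse_tprod, mulMap_tprod, mulMap_tprod,
      prod_ofFn_split hP, List.ofFn_succ, List.prod_cons]
    rfl

theorem slotDeriv_tailTensor {P q : ℕ} (a : D.Crd) (i : Fin (P + 1)) (hi : i.1 < q + 1)
    (f : Fin (P + 1) → D.Fun) : D.slotDeriv a i (D.tailTensor q f) = 0 := by
  rw [slotDeriv, tailTensor, PiTensorProduct.map_tprod]
  exact (PiTensorProduct.tprod ℝ).map_coord_zero i (by simp [hi, deriv_one])

theorem slotParity_tailTensor {P q : ℕ} (a : ℕ) (i : Fin (P + 1)) (hi : i.1 < q + 1)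
    (f : Fin (P + 1) → D.Fun) : D.slotParity a (· < i) (D.tailTensor q f) = D.tailTensor q f := by
  rw [slotParity, tailTensor, PiTensorProduct.map_tprod]
  congr 1
  funext j
  by_cases hj : j < i
  · have : j.1 < q + 1 := lt_trans hj hi
    simp [hj, this, parity_pow_one]
  · simp [hj]

/-- The tail consists of units in the first `q + 1` slots, so it is killed by a derivative there and
fixed by the parities of the preceding slots. The operator therefore acts on the first factor alone.
-/
theorem slotDeriv_embed {p q P : ℕ} (h : p + q = P) (a : D.Crd) (v : Fin (q + 1))
    (t : ⨂[ℝ] _ : Fin (q + 1), D.Fun) (f : Fin (P + 1) → D.Fun) :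
    D.slotDeriv a (embed h v) (D.spread (embed h) t * D.tailTensor q f) =
      D.spread (embed h) (D.slotDeriv a v t) * D.tailTensor q f := by
  have hv : (embed h v).1 < q + 1 := v.2
  rw [slotDeriv_mul, D.slotDeriv_tailTensor _ _ hv, D.slotParity_tailTensor _ _ hv, mul_zero,
    add_zero, D.slotDeriv_spread _ (monotone_embed h)]
  simp [(embed_injective h).eq_iff]

theorem edgeOp_embed {p q P : ℕ} (h : p + q = P) (v w : Fin (q + 1))
    (t : ⨂[ℝ] _ : Fin (q + 1), D.Fun) (f : Fin (P + 1) → D.Fun) :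
    D.edgeOp (embed h v) (embed h w) (D.spread (embed h) t * D.tailTensor q f) =
      D.spread (embed h) (D.edgeOp v w t) * D.tailTensor q f := by
  simp [edgeOp, LinearMap.sum_apply, slotDeriv_embed, Finset.sum_mul]

theorem prod_edgeOp_embed {p q P k : ℕ} (h : p + q = P) (H : Multidigraph (q + 1) k)
    (t : ⨂[ℝ] _ : Fin (q + 1), D.Fun) (f : Fin (P + 1) → D.Fun) :
    (List.ofFn fun e => D.edgeOp (embed h (H e).1) (embed h (H e).2)).prod
        (D.spread (embed h) t * D.tailTensor q f) =
      D.spread (embed h) ((List.ofFn fun e => D.edgeOp (H e).1 (H e).2).prod t) *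
        D.tailTensor q f := by
  induction k with
  | zero => simp
  | succ k ih =>
    rw [List.ofFn_succ, List.prod_cons, Module.End.mul_apply, ih fun i => H i.succ, edgeOp_embed,
      List.ofFn_succ, List.prod_cons, Module.End.mul_apply]

theorem spread_collapse_embed {p q P : ℕ} (h : p + q = P) (t : ⨂[ℝ] _ : Fin (q + 1), D.Fun)
    (f : Fin (P + 1) → D.Fun) :
    D.spread (collapse h) (D.spread (embed h) t * D.tailTensor q f) =
      PiTensorProduct.tprod ℝ (Fin.cons (D.mulMap (q + 1) t) (tailArgs h f) :
        Fin (p + 1) → D.Fun) := by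
  induction t using PiTensorProduct.induction_on with
  | add t t' h h' =>
    rw [map_add, add_mul, map_add, h, h', map_add, MultilinearMap.cons_add]
  | smul_tprod r g =>
    rw [map_smul, smul_mul_assoc, map_smul, spread_embed_mul, spread_collapse_tprod, map_smul,
      MultilinearMap.cons_smul, mulMap_tprod]
    congr 3
    · congr 2
      funext v
      exact dif_pos v.2
    · funext i
      exact dif_neg (show ¬ q + 1 + i.1 < q + 1 by omega)

theorem prod_edgeOp_glue {p q P j k K : ℕ} (h : p + q = P) (hK : j + k = K)
    (E : Multidigraph (P + 1) j) (H : Multidigraph (q + 1) k) :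
    (List.ofFn fun e => D.edgeOp (glue h hK E H e).1 (glue h hK E H e).2).prod =
      (List.ofFn fun e => D.edgeOp (E e).1 (E e).2).prod *
        (List.ofFn fun e => D.edgeOp (embed h (H e).1) (embed h (H e).2)).prod := by
  subst hK
  rw [List.ofFn_add, List.prod_append]
  simp [glue]

/-- The product that the inserted graph feeds into the first slot is realised by `spread (collapse
h)`. Pulling the edge operators of `G` back through this map gives the sum over reconnections; the
edges of `H` have already acted on the initial slots, and since `glue` lists them last, their
operators are indeed applied first. -/
theorem rep_compGraph {p q P j k K : ℕ} (h : p + q = P) (hK : j + k = K)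
    (G : Multidigraph (p + 1) j) (H : Multidigraph (q + 1) k) (f : Fin (P + 1) → D.Fun) :
    D.rep (compGraph _ h hK G H) f =
      D.repGraph G (Fin.cons (D.repGraph H fun v => f (embed h v)) (tailArgs h f)) := by
  classical
  have hf : PiTensorProduct.tprod ℝ f =
      D.spread (embed h) (PiTensorProduct.tprod ℝ fun v => f (embed h v)) * D.tailTensor q f := by
    rw [spread_embed_mul]
    congr 1
    funext j
    split_ifs <;> rfl
  rw [repGraph_apply, repGraph_apply, ← D.spread_collapse_embed h _ f,
    D.prod_edgeOp_spread _ (monotone_collapse h), compGraph, map_sum, map_sum,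
    sum_apply]
  refine Finset.sum_congr rfl fun E _ => ?_
  by_cases hE : IsReconnection h G E
  · rw [if_pos hE, if_pos (show ∀ e, (collapse h (E e).1, collapse h (E e).2) = G e from hE), rep_mk, repGraph_apply, prod_edgeOp_glue, mulMap_spread_collapse,
      Module.End.mul_apply, hf, prod_edgeOp_embed]
  · rw [if_neg hE, if_neg (show ¬ ∀ e, (collapse h (E e).1, collapse h (E e).2) = G e from hE)]
    simp

end NPDomain

theorem Gra.comp_mk (d : ℤ) {p q P j k K : ℕ} (h : p + q = P) (hK : j + k = K)
    (G : Multidigraph (p + 1) j) (H : Multidigraph (q + 1) k) :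
    Gra.comp d h hK (Gra.mk d G) (Gra.mk d H) = compGraph d h hK G H := by
  simp [comp, Gra.lift, Gra.mk]

namespace NPDomain
variable {n : ℕ} (D : NPDomain n)

theorem rep_comp {p q P j k K : ℕ} (h : p + q = P) (hK : j + k = K)
    (γ : Gra ((n : ℤ) + 1) (p + 1) j) (γ' : Gra ((n : ℤ) + 1) (q + 1) k) (f : Fin (P + 1) → D.Fun) :
    D.rep (Gra.comp _ h hK γ γ') f =
      D.rep γ (Fin.cons (D.rep γ' fun v => f (embed h v)) (tailArgs h f)) := by
  induction γ using Gra.induction with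
  | zero => simp
  | add a b ha hb => simp only [map_add, LinearMap.add_apply, add_apply, ha, hb]
  | smul c a ha => simp only [map_smul, LinearMap.smul_apply, smul_apply, ha]
  | mk G =>
    induction γ' using Gra.induction with
    | zero =>
      simp only [map_zero, zero_apply]
      exact ((D.rep (Gra.mk _ G)).map_coord_zero 0 rfl).symm
    | add a b ha hb => simp only [map_add, add_apply, ha, hb, MultilinearMap.cons_add]
    | smul c a ha => simp only [map_smul, smul_apply, ha, MultilinearMap.cons_smul]
    | mk H => rw [Gra.comp_mk, rep_mk, rep_mk, rep_compGraph]

end NPDomain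
-- Suspension signs
/-- The sign of `s ⊗ ⋯ ⊗ s` on arguments of degrees `x i`. -/
def suspSign (n : ℕ) {N : ℕ} (x : Fin N → ℤ) : ℤˣ :=
  ∏ i, ((-1 : ℤˣ) ^ x i) ^ (n * (N - 1 - i.1))

theorem units_smul_multilinear {N : ℕ} {V : Type*} [AddCommGroup V] [Module ℝ V] (u : ℤˣ)
    (θ : MultilinearMap ℝ (fun _ : Fin N => V) V) (X : Fin N → V) : (u • θ) X = u • θ X := by
  rcases Int.units_eq_one_or u with rfl | rfl <;> simp [Units.smul_def]

namespace NPDomain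
variable {n : ℕ} (D : NPDomain n)

theorem tParity_of_mem {k : ℤ} {X : D.Fun} (hX : X ∈ D.tGrading k) :
    D.tParity X = ((-1 : ℤˣ) ^ k) • X := by
  rw [tParity, LinearMap.smul_apply, D.parity_of_mem hX, ← neg_one_zpow_smul, smul_smul, zpow_add,
    mul_comm, mul_assoc, units_zpow_mul_self, mul_one]

theorem tParity_pow_of_mem {k : ℤ} {X : D.Fun} (hX : X ∈ D.tGrading k) (a : ℕ) :
    (D.tParity ^ a) X = (((-1 : ℤˣ) ^ k) ^ a) • X := by
  induction a with
  | zero => simp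
  | succ a ih =>
    rw [pow_succ', Module.End.mul_apply, ih, map_units_smul, D.tParity_of_mem hX, smul_smul,
      ← pow_succ]

theorem pullback_apply_of_mem {N : ℕ} (θ : MultilinearMap ℝ (fun _ : Fin N => D.Fun) D.Fun)
    (x : Fin N → ℤ) (X : Fin N → D.Fun) (hX : ∀ i, X i ∈ D.tGrading (x i)) :
    D.pullback θ X = suspSign n x • θ X := by
  rw [suspSign, ← multilinear_units_smul]
  change θ (fun i => (D.tParity ^ (n * (N - 1 - i.1))) (X i)) = _
  congr 1
  funext i
  exact D.tParity_pow_of_mem (hX i) _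

end NPDomain

theorem map_cons_sum {N : ℕ} {V : Type*} [AddCommGroup V] [Module ℝ V]
    (θ : MultilinearMap ℝ (fun _ : Fin (N + 1) => V) V) (S : Finset ℕ) (v : ℕ → V) (W : Fin N → V) :
    θ (Fin.cons (∑ k ∈ S, v k) W) = ∑ k ∈ S, θ (Fin.cons (v k) W) := by
  induction S using Finset.induction_on with
  | empty => exact θ.map_coord_zero 0 rfl
  | insert a S ha ih => rw [Finset.sum_insert ha, Finset.sum_insert ha, θ.cons_add, ih]

theorem units_pow_even {m : ℕ} (h : Even m) (u : ℤˣ) : u ^ m = 1 := by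
  obtain ⟨t, rfl⟩ := h
  rw [pow_add, Int.units_mul_self]

theorem units_pow_odd {m : ℕ} (h : Odd m) (u : ℤˣ) : u ^ m = u := by
  obtain ⟨t, rfl⟩ := h
  rw [pow_succ, units_pow_even (even_two_mul t), one_mul]

/-- Only the parity of `n` matters. For even `n` the suspension signs are trivial and the shift does
not affect Koszul signs; for odd `n` this is `koszul_add_one`. -/
theorem koszul_add_mul_suspSign (n : ℕ) {N : ℕ} (τ : Equiv.Perm (Fin N)) (x : Fin N → ℤ) :
    suspSign n x * koszul τ (fun i => x i + n) =
      Equiv.Perm.sign τ ^ n * koszul τ x * suspSign n (x ∘ τ) := by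
  rcases Nat.even_or_odd n with h | h
  · have h1 : ∀ y : Fin N → ℤ, suspSign n y = 1 := fun y =>
      Finset.prod_eq_one fun i _ => units_pow_even (h.mul_right _) _
    rw [h1, h1, units_pow_even h, one_mul, mul_one, one_mul]
    refine koszul_congr _ _ _ fun i => ?_
    rw [add_sub_cancel_left]
    exact_mod_cast h
  · have h1 : ∀ y : Fin N → ℤ, suspSign n y = ∏ i, ((-1 : ℤˣ) ^ y i) ^ (N - 1 - i.1) := fun y =>
      Finset.prod_congr rfl fun i _ => by rw [pow_mul, units_pow_odd h]
    have h2 : koszul τ (fun i => x i + n) = koszul τ (fun i => x i + 1) := by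
      refine koszul_congr _ _ _ fun i => ?_
      obtain ⟨t, rfl⟩ := h
      exact ⟨t, by push_cast; ring⟩
    rw [h2, koszul_add_one, h1, h1, units_pow_odd h]
    simp only [Function.comp_apply]
    rw [mul_left_comm, ← mul_assoc (∏ i, _), Int.units_mul_self, one_mul]

namespace NPDomain
variable {n : ℕ} (D : NPDomain n)

/-- The suspension contributes the signature to the power `n`. With the twist `n + 1` of the graph
complex the total exponent is odd, so invariance of graphs becomes graded antisymmetry of brackets
for every `n`. -/
theorem pullback_rep_act {N k : ℕ} (σ : Equiv.Perm (Fin N)) (γ : Gra ((n : ℤ) + 1) N k)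
    (x : Fin N → ℤ) (X : Fin N → D.Fun) (hX : ∀ i, X i ∈ D.tGrading (x i)) :
    D.pullback (D.rep (Equiv.Perm.sign σ ^ ((n : ℤ) + 1) • Gra.act _ σ γ)) X =
      (Equiv.Perm.sign σ * koszul σ⁻¹ x) • D.pullback (D.rep γ) (X ∘ ⇑σ⁻¹) := by
  rw [D.pullback_apply_of_mem _ x X hX,
    D.pullback_apply_of_mem _ (x ∘ ⇑σ⁻¹) (X ∘ ⇑σ⁻¹) fun i => hX _, map_units_smul]
  rw [units_smul_multilinear, D.rep_act σ γ _ X hX, smul_smul, smul_smul, smul_smul]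
  congr 1
  have h := koszul_add_mul_suspSign n σ⁻¹ x
  rw [Equiv.Perm.sign_inv] at h
  rw [mul_assoc (suspSign n x), mul_left_comm, h, zpow_add, zpow_natCast, zpow_one]
  rcases Int.units_eq_one_or (Equiv.Perm.sign σ) with e | e
  · simp [e]
  · rw [e]
    rcases Nat.even_or_odd n with h | h <;> simp [h.neg_one_pow]

end NPDomain

/-- The inserted argument is followed by `p` others, so its degree counts `n * p` times. The inputs
of the inner operation account for the splitting of the suspension sign, and its own degree `e` is
left over. -/
theorem suspSign_cons (n : ℕ) {p q P : ℕ} (h : p + q = P) (x : Fin (P + 1) → ℤ) (e : ℤ) :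
    suspSign n (Fin.cons ((∑ v, x (embed h v)) + e) (tailArgs h x) : Fin (p + 1) → ℤ) *
        suspSign n (fun v => x (embed h v)) =
      ((-1 : ℤˣ) ^ e) ^ (n * p) * suspSign n x := by
  have hP : (q + 1) + p = P + 1 := by omega
  have hsplit : suspSign n x =
      (∏ v : Fin (q + 1), ((-1 : ℤˣ) ^ x (embed h v)) ^ (n * (P - v.1))) *
        ∏ t : Fin p, ((-1 : ℤˣ) ^ tailArgs h x t) ^ (n * (p - (t.1 + 1))) := by
    have := prod_ofFn_split hP fun i => ((-1 : ℤˣ) ^ x i) ^ (n * (P + 1 - 1 - i.1))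
    rw [List.prod_ofFn, List.prod_ofFn, List.prod_ofFn] at this
    refine this.trans ?_
    congr 1
    refine Finset.prod_congr rfl fun t _ => ?_
    have : P + 1 - 1 - (q + 1 + t.1) = p - (t.1 + 1) := by omega
    simp only [this]
    rfl
  have hzsum : ∀ {N : ℕ} (y : Fin N → ℤ), (-1 : ℤˣ) ^ (∑ v, y v) = ∏ v, (-1 : ℤˣ) ^ y v := by
    intro N y
    induction N with
    | zero => simp
    | succ N ih => rw [Fin.sum_univ_succ, Fin.prod_univ_succ, zpow_add, ih]
  rw [hsplit, suspSign, Fin.prod_univ_succ, suspSign, Fin.cons_zero, zpow_add, hzsum, mul_pow]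
  simp only [Fin.cons_succ, Fin.val_succ, Fin.val_zero, Nat.add_sub_cancel, Nat.sub_zero]
  have : (∏ v : Fin (q + 1), ((-1 : ℤˣ) ^ x (embed h v)) ^ (n * (P - v.1))) =
      (∏ v, (-1 : ℤˣ) ^ x (embed h v)) ^ (n * p) *
        ∏ v : Fin (q + 1), ((-1 : ℤˣ) ^ x (embed h v)) ^ (n * (q - v.1)) := by
    rw [← Finset.prod_pow, ← Finset.prod_mul_distrib]
    refine Finset.prod_congr rfl fun v _ => ?_
    have : P - v.1 = p + (q - v.1) := by omega
    rw [← pow_add, this, mul_add]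
  rw [this]
  ac_rfl

theorem graphDegree_eq_one_iff (n p k : ℕ) :
    graphDegree ((n : ℤ) + 1) p k = 1 ↔ (n : ℤ) * p - n * k = 1 - p := by
  rw [graphDegree]
  constructor <;> intro h <;> linear_combination h

namespace NPDomain
variable {n : ℕ} (D : NPDomain n)

theorem pullback_rep_mem {p k : ℕ} (hk : graphDegree ((n : ℤ) + 1) p k = 1)
    (γ : Gra ((n : ℤ) + 1) (p + 1) k) (x : Fin (p + 1) → ℤ) (X : Fin (p + 1) → D.Fun)
    (hX : ∀ i, X i ∈ D.tGrading (x i)) :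
    D.pullback (D.rep γ) X ∈ D.tGrading (∑ i, x i + (1 - p)) := by
  rw [D.pullback_apply_of_mem _ x X hX]
  have h := D.rep_mem γ _ X hX
  -- The `p + 1` suspensions raise the degree and the `k` edges lower it; total graph degree `1`
  -- leaves exactly the degree `1 - p` of the bracket after one desuspension.
  have e : ∑ u, (x u + (n : ℤ)) - n * k = ∑ i, x i + (1 - p) + n := by
    rw [Finset.sum_add_distrib, Finset.sum_const, Finset.card_univ, Fintype.card_fin, nsmul_eq_mul]
    push_cast
    linear_combination (graphDegree_eq_one_iff n p k).1 hk
  rw [e] at h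
  exact (D.tGrading (∑ i, x i + (1 - p))).smul_of_tower_mem (suspSign n x) h

theorem mem_tailArgs {p q P : ℕ} (h : p + q = P) (x : Fin (P + 1) → ℤ) (X : Fin (P + 1) → D.Fun)
    (hX : ∀ i, X i ∈ D.tGrading (x i)) {Y : D.Fun} {e : ℤ} (hY : Y ∈ D.tGrading e)
    (i : Fin (p + 1)) : (Fin.cons Y (tailArgs h X) : Fin (p + 1) → D.Fun) i ∈
      D.tGrading ((Fin.cons e (tailArgs h x) : Fin (p + 1) → ℤ) i) := by
  induction i using Fin.cases with
  | zero => exact hY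
  | succ i => exact hX _

/-- The sign `(-1)^(p (1 - q))` is the one in `nrProd` for a cochain of total degree `1`. It cancels
the sign left over by the suspension in `suspSign_cons`. -/
theorem pullback_rep_comp {p q P j k K : ℕ} (h : p + q = P) (hK : j + k = K)
    (γ : Gra ((n : ℤ) + 1) (p + 1) j)
    (γ' : Gra ((n : ℤ) + 1) (q + 1) k) (hk : γ' ≠ 0 → graphDegree ((n : ℤ) + 1) q k = 1)
    (x : Fin (P + 1) → ℤ) (X : Fin (P + 1) → D.Fun) (hX : ∀ i, X i ∈ D.tGrading (x i)) :
    (-1 : ℤˣ) ^ ((p : ℤ) * (1 - q)) • D.pullback (D.rep γ)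
        (Fin.cons (D.pullback (D.rep γ') fun v => X (embed h v)) (tailArgs h X)) =
      D.pullback (D.rep (Gra.comp _ h hK γ γ')) X := by
  -- Components of a degree `1` series outside degree `1` vanish and satisfy the identity trivially,
  -- so the degree condition is only available for nonzero `γ'`.
  by_cases h0 : γ' = 0
  · subst h0
    simp only [map_zero, zero_apply]
    rw [(D.pullback (D.rep γ)).map_coord_zero 0 rfl, smul_zero]
  replace hk := hk h0
  have hY := D.pullback_rep_mem hk γ' (fun v => x (embed h v)) (fun v => X (embed h v))
    fun v => hX _
  rw [D.pullback_apply_of_mem _ _ _ (D.mem_tailArgs h x X hX hY), D.pullback_apply_of_mem _ x X hX,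
    D.pullback_apply_of_mem _ (fun v => x (embed h v)) (fun v => X (embed h v)) fun v => hX _,
    rep_comp]
  have hcons : ∀ (u : ℤˣ) (Y : D.Fun), D.rep γ (Fin.cons (u • Y) (tailArgs h X)) =
      u • D.rep γ (Fin.cons Y (tailArgs h X)) := fun u Y => by
    rw [Units.smul_def, Units.smul_def, ← Int.cast_smul_eq_zsmul ℝ, MultilinearMap.cons_smul,
      Int.cast_smul_eq_zsmul]
  rw [hcons, smul_smul, smul_smul, mul_assoc, suspSign_cons]
  congr 1
  -- The total exponent is `(1 - q) (n + 1) p`. For odd `n` it is even because of `n + 1`; for even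
  -- `n`, degree `1` gives `1 - q = n q - n k`, which is even.
  have hsign : (-1 : ℤˣ) ^ ((p : ℤ) * (1 - q)) * ((-1 : ℤˣ) ^ (1 - (q : ℤ))) ^ (n * p) = 1 := by
    rw [mul_comm (p : ℤ), zpow_mul, zpow_natCast, ← pow_add]
    rcases Nat.even_or_odd n with hn | hn
    · have hq : Even (1 - (q : ℤ)) := by
        have h1 := (graphDegree_eq_one_iff n q k).1 hk
        rw [← h1, ← mul_sub]
        exact Even.mul_right (by exact_mod_cast hn) _
      rw [hq.neg_one_zpow, one_pow]
    · refine units_pow_even ?_ _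
      rw [← one_add_mul]
      exact Even.mul_right (by rw [add_comm]; exact hn.add_one) _
  rw [← mul_assoc, hsign, one_mul]

end NPDomain

/-! ### From the pre-Lie product of graphs to the Nijenhuis–Richardson product -/

namespace NPDomain
variable {n : ℕ} (D : NPDomain n)

open Classical in
theorem pullback_rep_preLie {p q P j k K : ℕ} (h : p + q = P) (hK : j + k = K)
    (γ : Gra ((n : ℤ) + 1) (p + 1) j)
    (γ' : Gra ((n : ℤ) + 1) (q + 1) k) (hk : γ' ≠ 0 → graphDegree ((n : ℤ) + 1) q k = 1)
    (x : Fin (P + 1) → ℤ) (X : Fin (P + 1) → D.Fun) (hX : ∀ i, X i ∈ D.tGrading (x i)) :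
    D.pullback (D.rep (preLie _ h hK γ γ')) X = ∑ σ : Equiv.Perm (Fin (P + 1)),
      if IsUnshuffle (q + 1) σ then
        (Equiv.Perm.sign σ * koszul σ⁻¹ x * (-1) ^ ((p : ℤ) * (1 - q))) • D.pullback (D.rep γ)
          (Fin.cons (D.pullback (D.rep γ') fun v => X (σ⁻¹ (embed h v)))
            (tailArgs h (X ∘ ⇑σ⁻¹)))
      else 0 := by
  rw [preLie, map_sum, map_sum, sum_apply]
  refine Finset.sum_congr rfl fun σ _ => ?_
  by_cases hσ : IsUnshuffle (q + 1) σ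
  · rw [if_pos hσ, if_pos hσ, D.pullback_rep_act σ _ x X hX, mul_smul _ ((-1 : ℤˣ) ^ _),
      ← D.pullback_rep_comp h hK γ γ' hk (x ∘ ⇑σ⁻¹) (X ∘ ⇑σ⁻¹) fun i => hX _]
    rfl
  · rw [if_neg hσ, if_neg hσ]
    simp

theorem sRep_eq_sum (m : GraphSeries ((n : ℤ) + 1)) (p : ℕ) (S : Finset ℕ)
    (hS : ∀ k, k ∉ S → m p k = 0) : D.sRep m p = ∑ k ∈ S, D.pullback (D.rep (m p k)) := by
  refine finsum_eq_sum_of_support_subset _ fun k hk => ?_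
  by_contra hkS
  exact hk (by simp only [hS k hkS, map_zero])

theorem isCE_sRep {m : GraphSeries ((n : ℤ) + 1)} (hm : m ∈ fGC ((n : ℤ) + 1))
    (hd : HasDegree 1 m) (hf : HasFiniteEdges m) : IsCE D.tGrading 1 (D.sRep m) := by
  have hsum : ∀ p, D.sRep m p = ∑ k ∈ (hf p).toFinset, D.pullback (D.rep (m p k)) := fun p =>
    D.sRep_eq_sum m p _ fun k hk => by simpa using hk
  refine ⟨fun p x X hX => ?_, fun p x X hX τ => ?_⟩
  · rw [hsum, sum_apply]
    refine sum_mem fun k hk => ?_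
    refine D.pullback_rep_mem ?_ _ x X hX
    by_contra h
    exact (hf p).mem_toFinset.1 hk (hd p k h)
  · rw [hsum, sum_apply, sum_apply, Finset.smul_sum]
    refine Finset.sum_congr rfl fun k _ => ?_
    -- The inverse is taken because the graph action precomposes the arguments with the inverse
    -- permutation.
    have h := D.pullback_rep_act τ⁻¹ (m p k) x X hX
    rw [hm p k τ⁻¹, inv_inv, Equiv.Perm.sign_inv] at h
    rw [h, smul_smul, Int.units_mul_self, one_smul]

end NPDomain

/-- The pre-Lie product of `fGC_d`. -/
def preLieSeries {d : ℤ} (m m' : GraphSeries d) : GraphSeries d := fun P K =>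
  ∑ x : Finset.HasAntidiagonal.antidiagonal P, ∑ y : Finset.HasAntidiagonal.antidiagonal K,
    preLie d (Finset.HasAntidiagonal.mem_antidiagonal.1 x.2)
      (Finset.HasAntidiagonal.mem_antidiagonal.1 y.2) (m x.1.1 y.1.1) (m' x.1.2 y.1.2)

theorem preLie_zero_left (d : ℤ) {p q P j k K : ℕ} (h : p + q = P) (hK : j + k = K)
    (γ' : Gra d (q + 1) k) : preLie d h hK (0 : Gra d (p + 1) j) γ' = 0 := by
  simp [preLie]

theorem preLie_zero_right (d : ℤ) {p q P j k K : ℕ} (h : p + q = P) (hK : j + k = K)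
    (γ : Gra d (p + 1) j) : preLie d h hK γ (0 : Gra d (q + 1) k) = 0 := by
  simp [preLie]

theorem HasFiniteEdges.exists_bound {d : ℤ} {m : GraphSeries d} (hm : HasFiniteEdges m) (P : ℕ) :
    ∃ M, ∀ p ≤ P, ∀ k, M ≤ k → m p k = 0 := by
  have h : (⋃ p ∈ Finset.range (P + 1), {k | m p k ≠ 0}).Finite :=
    Set.Finite.biUnion (Finset.finite_toSet _) fun p _ => hm p
  obtain ⟨M, hM⟩ := h.bddAbove
  refine ⟨M + 1, fun p hp k hk => ?_⟩
  by_contra hne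
  have : k ≤ M := hM (by
    simp only [Set.mem_iUnion]
    exact ⟨p, Finset.mem_range.2 (by omega), hne⟩)
  omega

theorem preLieSeries_apply_eq_zero {d : ℤ} {m m' : GraphSeries d} {P M : ℕ}
    (hl : ∀ p ≤ P, ∀ k, M ≤ k → m p k = 0) (hr : ∀ p ≤ P, ∀ k, M ≤ k → m' p k = 0) (K : ℕ)
    (hK : 2 * M ≤ K) : preLieSeries m m' P K = 0 := by
  refine Finset.sum_eq_zero fun y _ => Finset.sum_eq_zero fun z _ => ?_
  have hz := Finset.HasAntidiagonal.mem_antidiagonal.1 z.2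
  have hy := Finset.HasAntidiagonal.mem_antidiagonal.1 y.2
  by_cases h : M ≤ z.1.1
  · rw [hl _ (by omega) _ h, preLie_zero_left]
  · rw [hr _ (by omega) _ (by omega), preLie_zero_right]

/-- Two series with fewer than `M` edges have a product with fewer than `2 * M`. The sum over total
numbers of edges thus becomes a sum over a square, which factors into the two separate sums defining
`sRep`. -/
theorem sum_antidiagonal_range {A : Type*} [AddCommMonoid A] (M : ℕ) (g : ℕ → ℕ → A)
    (h1 : ∀ j k, M ≤ j → g j k = 0) (h2 : ∀ j k, M ≤ k → g j k = 0) :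
    ∑ K ∈ Finset.range (2 * M), ∑ z ∈ Finset.HasAntidiagonal.antidiagonal K, g z.1 z.2 =
      ∑ j ∈ Finset.range M, ∑ k ∈ Finset.range M, g j k := by
  rw [← Finset.sum_product', ← Finset.sum_fiberwise_of_maps_to (g := fun z : ℕ × ℕ => z.1 + z.2)
    (t := Finset.range (2 * M))]
  · refine Finset.sum_congr rfl fun K _ => ?_
    symm
    refine Finset.sum_subset (fun z hz => ?_) fun z hz hz' => ?_
    · simpa using (Finset.mem_filter.1 hz).2
    · have hz1 : z.1 + z.2 = K := by simpa using hz
      simp only [Finset.mem_filter, Finset.mem_product, Finset.mem_range, not_and, hz1] at hz'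
      by_cases h : z.1 < M
      · by_cases hh : z.2 < M
        · exact absurd trivial (hz' ⟨h, hh⟩)
        · exact h2 _ _ (not_lt.1 hh)
      · exact h1 _ _ (not_lt.1 h)
  · intro z hz
    simp only [Finset.mem_product, Finset.mem_range] at hz ⊢
    omega

namespace NPDomain
variable {n : ℕ} (D : NPDomain n)

/-- Here the compatibilities are assembled. Finiteness of the numbers of edges up to arity `P + 1`
turns both sides into finite sums, which are then compared one pair of homogeneous components at a
time by `pullback_rep_preLie`. -/
theorem nrProd_sRep {m m' : GraphSeries ((n : ℤ) + 1)} (hd' : HasDegree 1 m')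
    (hf : HasFiniteEdges m) (hf' : HasFiniteEdges m') (P : ℕ) (x : Fin (P + 1) → ℤ)
    (X : Fin (P + 1) → D.Fun) (hX : ∀ i, X i ∈ D.tGrading (x i)) :
    nrProd 1 (D.sRep m) (D.sRep m') P x X = D.sRep (preLieSeries m m') P X := by
  obtain ⟨M₁, hM₁⟩ := hf.exists_bound P
  obtain ⟨M₂, hM₂⟩ := hf'.exists_bound P
  set M := max M₁ M₂ with hM
  have hl : ∀ p ≤ P, ∀ k, M ≤ k → m p k = 0 := fun p hp k hk =>
    hM₁ p hp k (le_trans (le_max_left _ _) hk)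
  have hr : ∀ p ≤ P, ∀ k, M ≤ k → m' p k = 0 := fun p hp k hk =>
    hM₂ p hp k (le_trans (le_max_right _ _) hk)
  have hle : ∀ y : Finset.HasAntidiagonal.antidiagonal P, y.1.1 ≤ P ∧ y.1.2 ≤ P := fun y => by
    have := Finset.HasAntidiagonal.mem_antidiagonal.1 y.2
    omega
  have hzero : ∀ K, K ∉ Finset.range (2 * M) → preLieSeries m m' P K = 0 := fun K hK =>
    preLieSeries_apply_eq_zero hl hr K (not_lt.1 fun h => hK (Finset.mem_range.2 h))
  rw [D.sRep_eq_sum _ P (Finset.range (2 * M)) hzero]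
  simp only [preLieSeries, map_sum, sum_apply]
  rw [Finset.sum_comm, nrProd]
  refine Finset.sum_congr rfl fun y _ => ?_
  have hy := Finset.HasAntidiagonal.mem_antidiagonal.1 y.2
  -- The total number of edges occurs in the type of the composite graph but not in the type of its
  -- action, so terms with different totals become comparable after applying `rep`.
  have hcast : ∀ (j k K : ℕ) (hK : j + k = K),
      D.pullback (D.rep (preLie _ hy hK (m y.1.1 j) (m' y.1.2 k))) X =
        D.pullback (D.rep (preLie _ hy rfl (m y.1.1 j) (m' y.1.2 k))) X := by
    rintro j k K rfl; rfl
  have hinner : ∀ K, (∑ z : Finset.HasAntidiagonal.antidiagonal K,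
      D.pullback (D.rep (preLie _ hy (Finset.HasAntidiagonal.mem_antidiagonal.1 z.2)
        (m y.1.1 z.1.1) (m' y.1.2 z.1.2))) X) =
      ∑ z ∈ Finset.HasAntidiagonal.antidiagonal K,
        D.pullback (D.rep (preLie _ hy rfl (m y.1.1 z.1) (m' y.1.2 z.2))) X := by
    intro K
    rw [← Finset.sum_coe_sort (Finset.HasAntidiagonal.antidiagonal K) fun z : ℕ × ℕ =>
      D.pullback (D.rep (preLie _ hy rfl (m y.1.1 z.1) (m' y.1.2 z.2))) X]
    exact Finset.sum_congr rfl fun z _ => hcast _ _ _ _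
  simp only [hinner]
  rw [sum_antidiagonal_range M (fun j k =>
    D.pullback (D.rep (preLie _ hy rfl (m y.1.1 j) (m' y.1.2 k))) X)]
  · have hterm := fun j k => D.pullback_rep_preLie hy rfl (m y.1.1 j) (m' y.1.2 k)
      (fun hne => by_contra fun h => hne (hd' _ _ h)) x X hX
    rw [Finset.sum_congr rfl fun j _ =>
      (Finset.sum_congr rfl fun k _ => hterm j k).trans Finset.sum_comm, Finset.sum_comm]
    refine Finset.sum_congr rfl fun σ _ => ?_
    by_cases hσ : IsUnshuffle (y.1.2 + 1) σ
    · simp only [if_pos hσ]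
      rw [D.sRep_eq_sum m y.1.1 (Finset.range M) fun k hk =>
          hl _ (hle y).1 _ (not_lt.1 fun h => hk (Finset.mem_range.2 h)),
        D.sRep_eq_sum m' y.1.2 (Finset.range M) fun k hk =>
          hr _ (hle y).2 _ (not_lt.1 fun h => hk (Finset.mem_range.2 h)), sum_apply,
        Finset.smul_sum]
      refine Finset.sum_congr rfl fun j _ => ?_
      rw [sum_apply, map_cons_sum, Finset.smul_sum]
      rfl
    · simp [if_neg hσ]
  · intro j k hj
    rw [hl _ (hle y).1 _ hj, preLie_zero_left]
    simp
  · intro j k hk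
    rw [hr _ (hle y).2 _ hk, preLie_zero_right]
    simp

end NPDomain
-- Additivity, the bracket in degree one, and finiteness
theorem preLie_add_left (d : ℤ) {p q P j k K : ℕ} (h : p + q = P) (hK : j + k = K)
    (a b : Gra d (p + 1) j) (γ' : Gra d (q + 1) k) :
    preLie d h hK (a + b) γ' = preLie d h hK a γ' + preLie d h hK b γ' := by
  simp only [preLie, map_add, LinearMap.add_apply, smul_add, ← Finset.sum_add_distrib]
  exact Finset.sum_congr rfl fun σ _ => by split_ifs <;> simp

theorem preLie_add_right (d : ℤ) {p q P j k K : ℕ} (h : p + q = P) (hK : j + k = K)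
    (γ : Gra d (p + 1) j) (a b : Gra d (q + 1) k) :
    preLie d h hK γ (a + b) = preLie d h hK γ a + preLie d h hK γ b := by
  simp only [preLie, map_add, smul_add, ← Finset.sum_add_distrib]
  exact Finset.sum_congr rfl fun σ _ => by split_ifs <;> simp

theorem preLieSeries_add_left {d : ℤ} (a b m : GraphSeries d) :
    preLieSeries (a + b) m = preLieSeries a m + preLieSeries b m := by
  funext P K
  simp only [preLieSeries, Pi.add_apply, preLie_add_left, Finset.sum_add_distrib]

theorem preLieSeries_add_right {d : ℤ} (m a b : GraphSeries d) :
    preLieSeries m (a + b) = preLieSeries m a + preLieSeries m b := by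
  funext P K
  simp only [preLieSeries, Pi.add_apply, preLie_add_right, Finset.sum_add_distrib]

theorem preLieSeries_zero_left {d : ℤ} (m : GraphSeries d) : preLieSeries 0 m = 0 := by
  funext P K
  simp only [preLieSeries, Pi.zero_apply, preLie_zero_left, Finset.sum_const_zero]

theorem preLieSeries_zero_right {d : ℤ} (m : GraphSeries d) : preLieSeries m 0 = 0 := by
  funext P K
  simp only [preLieSeries, Pi.zero_apply, preLie_zero_right, Finset.sum_const_zero]

/-- Exchange the two entries of an antidiagonal. -/
def antidiagonalSwap (P : ℕ) :
    Finset.HasAntidiagonal.antidiagonal P ≃ Finset.HasAntidiagonal.antidiagonal P :=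
  (Equiv.prodComm ℕ ℕ).subtypeEquiv fun x => by
    simp only [Finset.HasAntidiagonal.mem_antidiagonal, Equiv.prodComm_apply, Prod.fst_swap,
      Prod.snd_swap, add_comm]

/-- Between elements of odd degree the graded commutator is an anticommutator; components of any
other degree vanish, so the sign is the same in every nonzero term. -/
theorem bracket_eq {d : ℤ} {m m' : GraphSeries d} (hm : HasDegree 1 m) (hm' : HasDegree 1 m') :
    bracket m m' = preLieSeries m m' + preLieSeries m' m := by
  funext P K
  have hterm : ∀ (x : Finset.HasAntidiagonal.antidiagonal P)
      (y : Finset.HasAntidiagonal.antidiagonal K),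
      -((-1 : ℤˣ) ^ (graphDegree d x.1.1 y.1.1 * graphDegree d x.1.2 y.1.2) •
        preLie d ((add_comm _ _).trans (Finset.HasAntidiagonal.mem_antidiagonal.1 x.2))
          ((add_comm _ _).trans (Finset.HasAntidiagonal.mem_antidiagonal.1 y.2))
          (m' x.1.2 y.1.2) (m x.1.1 y.1.1)) =
        preLie d ((add_comm _ _).trans (Finset.HasAntidiagonal.mem_antidiagonal.1 x.2))
          ((add_comm _ _).trans (Finset.HasAntidiagonal.mem_antidiagonal.1 y.2))
          (m' x.1.2 y.1.2) (m x.1.1 y.1.1) := by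
    intro x y
    by_cases h1 : graphDegree d x.1.1 y.1.1 = 1
    · by_cases h2 : graphDegree d x.1.2 y.1.2 = 1
      · rw [h1, h2, mul_one, zpow_one, Units.neg_smul, one_smul, neg_neg]
      · rw [hm' _ _ h2, preLie_zero_left, smul_zero, neg_zero]
    · rw [hm _ _ h1, preLie_zero_right, smul_zero, neg_zero]
  simp only [bracket, sub_eq_add_neg, hterm, Finset.sum_add_distrib, Pi.add_apply]
  congr 1
  refine Fintype.sum_equiv (antidiagonalSwap P) _ _ fun x => ?_
  exact Fintype.sum_equiv (antidiagonalSwap K) _ _ fun y => rfl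

theorem hasDegree_add {d i : ℤ} {a b : GraphSeries d} (ha : HasDegree i a) (hb : HasDegree i b) :
    HasDegree i (a + b) := fun p k h => by
  rw [Pi.add_apply, Pi.add_apply, ha p k h, hb p k h, add_zero]

theorem hasDegree_zero {d i : ℤ} : HasDegree i (0 : GraphSeries d) := fun _ _ _ => rfl

theorem hasFiniteEdges_add {d : ℤ} {a b : GraphSeries d} (ha : HasFiniteEdges a)
    (hb : HasFiniteEdges b) : HasFiniteEdges (a + b) := fun p => by
  refine ((ha p).union (hb p)).subset fun k hk => ?_
  by_contra h
  simp only [Set.mem_union, Set.mem_ofPred_eq, not_or, not_not] at h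
  exact hk (by rw [Pi.add_apply, Pi.add_apply, h.1, h.2, add_zero])

theorem hasFiniteEdges_zero {d : ℤ} : HasFiniteEdges (0 : GraphSeries d) := fun p => by simp

theorem HasFiniteEdges.preLieSeries {d : ℤ} {m m' : GraphSeries d} (hf : HasFiniteEdges m)
    (hf' : HasFiniteEdges m') : HasFiniteEdges (preLieSeries m m') := by
  intro P
  obtain ⟨M₁, hM₁⟩ := hf.exists_bound P
  obtain ⟨M₂, hM₂⟩ := hf'.exists_bound P
  refine (Set.finite_Iio (2 * max M₁ M₂)).subset fun K hK => ?_
  by_contra h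
  exact hK (preLieSeries_apply_eq_zero (M := max M₁ M₂)
    (fun p hp k hk => hM₁ p hp k (le_trans (le_max_left _ _) hk))
    (fun p hp k hk => hM₂ p hp k (le_trans (le_max_right _ _) hk)) K (not_lt.1 h))

theorem hasFiniteEdges_sum {d : ℤ} {ι : Type*} (S : Finset ι) (m : ι → GraphSeries d)
    (h : ∀ i ∈ S, HasFiniteEdges (m i)) : HasFiniteEdges (∑ i ∈ S, m i) :=
  Finset.sum_induction m HasFiniteEdges (fun _ _ => hasFiniteEdges_add) hasFiniteEdges_zero h

/-! ### The edge graph -/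

theorem mk_swap_edges (d : ℤ) {N : ℕ} (a b : Fin N × Fin N) :
    Gra.mk d ![b, a] = -((-1 : ℤˣ) ^ d • Gra.mk d ![a, b]) := by
  have h := Gra.mk_perm d ![a, b] (Equiv.swap 0 1)
  have e : ![a, b] ∘ Equiv.swap (0 : Fin 2) 1 = ![b, a] := by
    funext i; fin_cases i <;> simp
  rw [e, Equiv.Perm.sign_swap (by decide), zpow_add_one, mul_neg_one, Units.neg_smul] at h
  exact h

theorem mk_flip_fst (d : ℤ) {N : ℕ} (u v : Fin N) (b : Fin N × Fin N) :
    Gra.mk d ![(v, u), b] = (-1 : ℤˣ) ^ d • Gra.mk d ![(u, v), b] := by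
  have h := Gra.mk_flip d ![(u, v), b] 0
  have e : flipEdge 0 ![(u, v), b] = ![(v, u), b] := by
    funext i; fin_cases i <;> simp [flipEdge]
  rwa [e] at h

theorem mk_flip_snd (d : ℤ) {N : ℕ} (u v : Fin N) (a : Fin N × Fin N) :
    Gra.mk d ![a, (v, u)] = (-1 : ℤˣ) ^ d • Gra.mk d ![a, (u, v)] := by
  have h := Gra.mk_flip d ![a, (u, v)] 1
  have e : flipEdge 1 ![a, (u, v)] = ![a, (v, u)] := by
    funext i; fin_cases i <;> simp [flipEdge]
  rwa [e] at h

/-- The definitions of the products use classical decidability. This instance and the next one allow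
the small cases with two edges to be settled by `decide`. -/
instance decidablePred_isUnshuffle {N a : ℕ} : DecidablePred fun σ : Equiv.Perm (Fin N) => IsUnshuffle a σ := fun σ => by
  unfold IsUnshuffle; infer_instance

instance decidablePred_isReconnection {p q P j : ℕ} (h : p + q = P) (G : Multidigraph (p + 1) j) :
    DecidablePred fun E : Multidigraph (P + 1) j => IsReconnection h G E := fun E => by
  unfold IsReconnection; infer_instance

/-- The decidability instance is an arbitrary argument, so that the lemma applies to the classical
one and the index set can still be listed explicitly. -/
theorem sum_ite_eq_sum {ι A : Type*} [Fintype ι] [AddCommMonoid A] (p : ι → Prop)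
    {inst : ∀ i, Decidable (p i)} (S : Finset ι) (hS : ∀ i, i ∈ S ↔ p i) (f : ι → A) :
    (∑ i, if p i then f i else 0) = ∑ i ∈ S, f i := by
  rw [← Finset.sum_filter]
  congr 1
  ext i
  simp [hS]

theorem compGraph_edge_edge (d : ℤ) :
    compGraph d (show 1 + 1 = 2 from rfl) (show 1 + 1 = 2 from rfl)
      (fun _ => (0, 1)) (fun _ => (0, 1)) =
      Gra.mk d ![((0 : Fin 3), (2 : Fin 3)), (0, 1)] + Gra.mk d ![(1, 2), (0, 1)] := by
  have hS : ∀ E : Multidigraph 3 1, E ∈ ({fun _ => (0, 2), fun _ => (1, 2)} :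
      Finset (Multidigraph 3 1)) ↔ IsReconnection (show 1 + 1 = 2 from rfl) (fun _ => (0, 1)) E := by
    decide
  refine (sum_ite_eq_sum _ _ hS _).trans ?_
  rw [Finset.sum_pair (by decide)]
  · congr 2
    · decide
    · decide

/-- Each of the three paths on three vertices, classified by its middle vertex, arises twice.
Reordering its two edges, and reversing edges where necessary, shows that the two copies have
opposite signs for either parity of `d`. -/
theorem preLie_edge_edge (d : ℤ) :
    preLie d (show 1 + 1 = 2 from rfl) (show 1 + 1 = 2 from rfl)
      (Gra.mk d fun _ => (0, 1)) (Gra.mk d fun _ => (0, 1)) = 0 := by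
  have hS : ∀ σ : Equiv.Perm (Fin 3), σ ∈ ({1, Equiv.swap 1 2, (finRotate 3)⁻¹} :
      Finset (Equiv.Perm (Fin 3))) ↔ IsUnshuffle (1 + 1) σ := by
    decide
  rw [preLie, Gra.comp_mk, compGraph_edge_edge]
  refine (sum_ite_eq_sum _ _ hS _).trans ?_
  · have e1 : relabel (Equiv.swap 1 2) ![((0 : Fin 3), (2 : Fin 3)), (0, 1)] =
        ![(0, 1), (0, 2)] := by decide
    have e2 : relabel (Equiv.swap 1 2) ![((1 : Fin 3), (2 : Fin 3)), (0, 1)] =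
        ![(2, 1), (0, 2)] := by decide
    have e3 : relabel (finRotate 3)⁻¹ ![((0 : Fin 3), (2 : Fin 3)), (0, 1)] =
        ![(1, 0), (1, 2)] := by decide
    have e4 : relabel (finRotate 3)⁻¹ ![((1 : Fin 3), (2 : Fin 3)), (0, 1)] =
        ![(2, 0), (1, 2)] := by decide
    have e5 : ∀ G : Multidigraph 3 2, relabel 1 G = G := fun G => rfl
    rw [Finset.sum_insert (by decide), Finset.sum_pair (by decide)]
    simp only [map_add, Gra.act_mk, e1, e2, e3, e4, e5, Equiv.Perm.sign_one, Equiv.Perm.sign_inv,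
      sign_finRotate, Equiv.Perm.sign_swap (show (1 : Fin 3) ≠ 2 by decide), one_zpow, one_smul]
    rw [mk_swap_edges d (0, 2) (0, 1), mk_swap_edges d (0, 2) (2, 1), mk_flip_fst d 0 1 (1, 2),
      mk_swap_edges d (1, 2) (0, 1), mk_flip_fst d 0 2 (1, 2), mk_flip_snd d 2 1 (0, 2)]
    rcases Int.units_eq_one_or ((-1 : ℤˣ) ^ d) with h | h <;> rw [h] <;> simp <;> abel

theorem edgeGraph_one_one (d : ℤ) : edgeGraph d 1 1 = Gra.mk d fun _ => (0, 1) := by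
  simp [edgeGraph]

theorem edgeGraph_eq_zero (d : ℤ) {p k : ℕ} (h : ¬ (p = 1 ∧ k = 1)) : edgeGraph d p k = 0 :=
  if_neg h

theorem preLieSeries_edgeGraph (d : ℤ) : preLieSeries (edgeGraph d) (edgeGraph d) = 0 := by
  funext P K
  refine Finset.sum_eq_zero fun x _ => Finset.sum_eq_zero fun y _ => ?_
  obtain ⟨⟨p, q⟩, hx⟩ := x
  obtain ⟨⟨j, k⟩, hy⟩ := y
  have hx' := Finset.HasAntidiagonal.mem_antidiagonal.1 hx
  have hy' := Finset.HasAntidiagonal.mem_antidiagonal.1 hy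
  simp only at hx' hy' ⊢
  by_cases h1 : p = 1 ∧ j = 1
  · by_cases h2 : q = 1 ∧ k = 1
    · obtain ⟨rfl, rfl⟩ := h1
      obtain ⟨rfl, rfl⟩ := h2
      subst hx' hy'
      rw [edgeGraph_one_one]
      exact preLie_edge_edge d
    · rw [edgeGraph_eq_zero d h2, preLie_zero_right]
  · rw [edgeGraph_eq_zero d h1, preLie_zero_left]

theorem hasDegree_edgeGraph (d : ℤ) : HasDegree 1 (edgeGraph d) := by
  intro p k h
  refine edgeGraph_eq_zero d ?_
  rintro ⟨rfl, rfl⟩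
  exact h (by simp [graphDegree])

theorem hasFiniteEdges_edgeGraph (d : ℤ) : HasFiniteEdges (edgeGraph d) := by
  intro p
  refine (Set.finite_singleton 1).subset fun k hk => ?_
  by_contra h
  exact hk (edgeGraph_eq_zero d fun hh => h hh.2)

/-- Exchanging the vertices reverses the edge, which costs `(-1)^d`, and this cancels the twist by
the signature. -/
theorem edgeGraph_mem (d : ℤ) : edgeGraph d ∈ fGC d := by
  intro p k σ
  by_cases h : p = 1 ∧ k = 1
  · obtain ⟨rfl, rfl⟩ := h
    rw [edgeGraph_one_one, Gra.act_mk]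
    have hσ : ∀ σ : Equiv.Perm (Fin 2), σ = 1 ∨ σ = Equiv.swap 0 1 := by decide
    rcases hσ σ with rfl | rfl
    · have e : relabel 1 (fun _ : Fin 1 => ((0 : Fin 2), (1 : Fin 2))) = fun _ => (0, 1) := rfl
      rw [e, Equiv.Perm.sign_one, one_zpow, one_smul]
    · have e : relabel (Equiv.swap 0 1) (fun _ : Fin 1 => ((0 : Fin 2), (1 : Fin 2))) =
          flipEdge 0 fun _ => (0, 1) := by decide
      rw [e, Gra.mk_flip, Equiv.Perm.sign_swap (by decide), smul_smul, units_zpow_mul_self,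
        one_smul]
  · rw [edgeGraph_eq_zero d h, map_zero, smul_zero]

/-! ### The image of the edge graph, and linearity of `sRep` -/

namespace NPDomain
variable {n : ℕ} (D : NPDomain n)

/-- The Koszul sign of the derivative in the second slot is a parity on the first argument, which is
the sign in the Poisson bracket. -/
theorem rep_edge : D.rep (Gra.mk _ fun _ : Fin 1 => ((0 : Fin 2), (1 : Fin 2))) = D.poisson := by
  ext f
  rw [rep_mk, repGraph_apply, poisson, sum_apply]
  have hab : ∀ a b, D.mulMap 2 (D.slotDeriv a (0 : Fin 2) (D.slotDeriv b (1 : Fin 2)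
      (PiTensorProduct.tprod ℝ f))) =
      D.deriv a ((D.parity ^ b.deg) (f 0)) * D.deriv b (f 1) := by
    intro a b
    rw [slotDeriv, slotDeriv, PiTensorProduct.map_tprod, PiTensorProduct.map_tprod, mulMap_tprod]
    simp [List.ofFn_succ]
  simp [edgeOp, LinearMap.sum_apply, hab, List.ofFn_succ]

theorem sRep_edgeGraph : D.sRep (edgeGraph ((n : ℤ) + 1)) = D.schouten := by
  funext p
  by_cases hp : p = 1
  · subst hp
    rw [D.sRep_eq_sum _ 1 {1} fun k hk => edgeGraph_eq_zero _ fun h => hk (by simpa using h.2),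
      Finset.sum_singleton, edgeGraph_one_one, rep_edge]
    rfl
  · rw [D.sRep_eq_sum _ p ∅ fun k _ => edgeGraph_eq_zero _ fun h => hp h.1, Finset.sum_empty]
    match p, hp with
    | 0, _ => rfl
    | p + 2, _ => rfl

theorem sRep_zero : D.sRep 0 = 0 := by
  funext p
  rw [D.sRep_eq_sum 0 p ∅ fun _ _ => rfl]
  rfl

theorem sRep_add {a b : GraphSeries ((n : ℤ) + 1)} (ha : HasFiniteEdges a)
    (hb : HasFiniteEdges b) : D.sRep (a + b) = D.sRep a + D.sRep b := by
  funext p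
  have h := fun {m : GraphSeries ((n : ℤ) + 1)} (S : Finset ℕ) (hS : ∀ k, k ∉ S → m p k = 0) =>
    D.sRep_eq_sum m p S hS
  have ha' : ∀ k, k ∉ (ha p).toFinset ∪ (hb p).toFinset → a p k = 0 := fun k hk => by
    by_contra hne
    exact hk (Finset.mem_union_left _ ((ha p).mem_toFinset.2 hne))
  have hb' : ∀ k, k ∉ (ha p).toFinset ∪ (hb p).toFinset → b p k = 0 := fun k hk => by
    by_contra hne
    exact hk (Finset.mem_union_right _ ((hb p).mem_toFinset.2 hne))
  rw [Pi.add_apply, h _ ha', h _ hb', h _ fun k hk => by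
    rw [Pi.add_apply, Pi.add_apply, ha' k hk, hb' k hk, add_zero], ← Finset.sum_add_distrib]
  exact Finset.sum_congr rfl fun k _ => by simp only [Pi.add_apply, map_add]

theorem sRep_smul (c : ℝ) (a : GraphSeries ((n : ℤ) + 1)) (ha : HasFiniteEdges a) :
    D.sRep (c • a) = c • D.sRep a := by
  funext p
  have ha' : ∀ k, k ∉ (ha p).toFinset → a p k = 0 := fun k hk => by
    by_contra hne
    exact hk ((ha p).mem_toFinset.2 hne)
  rw [Pi.smul_apply, D.sRep_eq_sum a p _ ha', D.sRep_eq_sum _ p _ fun k hk => by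
    rw [Pi.smul_apply, Pi.smul_apply, ha' k hk, smul_zero], Finset.smul_sum]
  exact Finset.sum_congr rfl fun k _ => by simp only [Pi.smul_apply, map_smul]

theorem sRep_sum {ι : Type*} (S : Finset ι) (m : ι → GraphSeries ((n : ℤ) + 1))
    (h : ∀ i ∈ S, HasFiniteEdges (m i)) : D.sRep (∑ i ∈ S, m i) = ∑ i ∈ S, D.sRep (m i) := by
  classical
  induction S using Finset.induction_on with
  | empty => exact D.sRep_zero
  | insert a S ha ih =>
    have hS : ∀ i ∈ S, HasFiniteEdges (m i) := fun i hi => h i (Finset.mem_insert_of_mem hi)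
    rw [Finset.sum_insert ha, Finset.sum_insert ha, D.sRep_add (h a (Finset.mem_insert_self _ _))
      (hasFiniteEdges_sum S m hS), ih hS]

theorem nrBracket_sRep {m m' : GraphSeries ((n : ℤ) + 1)} (hd : HasDegree 1 m)
    (hd' : HasDegree 1 m') (hf : HasFiniteEdges m) (hf' : HasFiniteEdges m') (P : ℕ)
    (x : Fin (P + 1) → ℤ) (X : Fin (P + 1) → D.Fun) (hX : ∀ i, X i ∈ D.tGrading (x i)) :
    nrBracket 1 1 (D.sRep m) (D.sRep m') P x X = D.sRep (bracket m m') P X := by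
  rw [nrBracket, D.nrProd_sRep hd' hf hf' P x X hX, D.nrProd_sRep hd hf' hf P x X hX,
    bracket_eq hd hd', D.sRep_add (hf.preLieSeries hf') (hf'.preLieSeries hf), mul_one, zpow_one,
    Units.neg_smul, one_smul, sub_neg_eq_add]
  rfl

end NPDomain
-- Formal Maurer–Cartan elements and twisting by the edge graph
theorem sum_antidiagonal_fst_zero {A : Type*} [AddCommMonoid A] (r : ℕ) (g : ℕ → A) :
    (∑ ij ∈ Finset.HasAntidiagonal.antidiagonal r, if ij.1 = 0 then g ij.2 else 0) = g r := by
  rw [Finset.sum_eq_single (0, r)]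
  · simp
  · rintro ⟨i, j⟩ hij hne
    rw [Finset.HasAntidiagonal.mem_antidiagonal] at hij
    refine if_neg fun h => hne ?_
    simp only at h hij
    subst h
    simpa using hij
  · intro h
    exact absurd (Finset.HasAntidiagonal.mem_antidiagonal.2 (zero_add r)) h

theorem sum_antidiagonal_swap_eq {A : Type*} [AddCommMonoid A] (r : ℕ) (g : ℕ → ℕ → A) :
    ∑ ij ∈ Finset.HasAntidiagonal.antidiagonal r, g ij.2 ij.1 =
      ∑ ij ∈ Finset.HasAntidiagonal.antidiagonal r, g ij.1 ij.2 := by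
  refine Finset.sum_nbij' Prod.swap Prod.swap ?_ ?_ ?_ ?_ ?_ <;> intro x hx
  · simpa [Finset.HasAntidiagonal.mem_antidiagonal, add_comm] using hx
  · simpa [Finset.HasAntidiagonal.mem_antidiagonal, add_comm] using hx
  all_goals simp

theorem GraphSeries.zero_add {d : ℤ} (a : GraphSeries d) : 0 + a = a :=
  _root_.zero_add a

theorem GraphSeries.add_zero {d : ℤ} (a : GraphSeries d) : a + 0 = a :=
  _root_.add_zero a

theorem GraphSeries.smul_zero {d : ℤ} (c : ℝ) : c • (0 : GraphSeries d) = 0 :=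
  funext fun p => funext fun k => _root_.smul_zero (A := Gra d (p + 1) k) c

theorem GraphSeries.two_smul {d : ℤ} (a : GraphSeries d) : (2 : ℝ) • a = a + a :=
  _root_.two_smul ℝ a

theorem GraphSeries.half_smul_two_smul {d : ℤ} (a : GraphSeries d) :
    (1 / 2 : ℝ) • (2 : ℝ) • a = a := by
  funext p k
  change (1 / 2 : ℝ) • (2 : ℝ) • a p k = a p k
  rw [smul_smul]
  norm_num

theorem GraphSeries.add_left_comm_assoc {d : ℤ} (a b c : GraphSeries d) :
    a + (b + c) = b + a + c := by
  funext p k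
  change a p k + (b p k + c p k) = b p k + a p k + c p k
  rw [add_left_comm, add_assoc]

/-- The coefficients of `Γ + ∑ r, ε ^ r m_r`, where `Γ` is the edge graph. -/
def twisted {d : ℤ} (m : ℕ → GraphSeries d) (r : ℕ) : GraphSeries d :=
  (if r = 0 then edgeGraph d else 0) + m r

section

variable {d : ℤ} {m : ℕ → GraphSeries d}

theorem twisted_mem (hm : ∀ r, m r ∈ fGC d) (r : ℕ) : twisted m r ∈ fGC d := by
  refine add_mem ?_ (hm r)
  split_ifs
  · exact edgeGraph_mem d
  · exact zero_mem _

theorem hasDegree_twisted (hm : ∀ r, HasDegree 1 (m r)) (r : ℕ) : HasDegree 1 (twisted m r) := by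
  refine hasDegree_add ?_ (hm r)
  split_ifs
  · exact hasDegree_edgeGraph d
  · exact hasDegree_zero

theorem hasFiniteEdges_twisted (hm : ∀ r, HasFiniteEdges (m r)) (r : ℕ) :
    HasFiniteEdges (twisted m r) := by
  refine hasFiniteEdges_add ?_ (hm r)
  split_ifs
  · exact hasFiniteEdges_edgeGraph d
  · exact hasFiniteEdges_zero

/-- In degree `1` the bracket is the symmetrised pre-Lie product, and the antidiagonal is symmetric.
-/
theorem sum_bracket_eq (hd : ∀ r, HasDegree 1 (m r)) (r : ℕ) :
    ∑ ij ∈ Finset.HasAntidiagonal.antidiagonal r, bracket (m ij.1) (m ij.2) =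
      (2 : ℝ) • ∑ ij ∈ Finset.HasAntidiagonal.antidiagonal r, preLieSeries (m ij.1) (m ij.2) := by
  rw [Finset.sum_congr rfl fun ij _ => bracket_eq (hd ij.1) (hd ij.2), Finset.sum_add_distrib,
    sum_antidiagonal_swap_eq r fun i j => preLieSeries (m i) (m j), GraphSeries.two_smul]

/-- Expanding the square of `Γ + m`, the square of `Γ` vanishes, the mixed terms give the
differential, and the square of `m` is half its bracket: what remains is the Maurer–Cartan equation.
-/
theorem sum_preLieSeries_twisted (hm : IsFormalMaurerCartan m) (r : ℕ) :
    ∑ ij ∈ Finset.HasAntidiagonal.antidiagonal r,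
      preLieSeries (twisted m ij.1) (twisted m ij.2) = 0 := by
  have h := hm.eqn r
  rw [sum_bracket_eq hm.degree, GraphSeries.half_smul_two_smul,
    differential, bracket_eq (hasDegree_edgeGraph d) (hm.degree r)] at h
  have hl : ∀ (i : ℕ) (b : GraphSeries d), preLieSeries (if i = 0 then edgeGraph d else 0) b =
      if i = 0 then preLieSeries (edgeGraph d) b else 0 := fun i b => by
    split_ifs
    · rfl
    · exact preLieSeries_zero_left b
  have hr : ∀ (i : ℕ) (b : GraphSeries d), preLieSeries b (if i = 0 then edgeGraph d else 0) =
      if i = 0 then preLieSeries b (edgeGraph d) else 0 := fun i b => by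
    split_ifs
    · rfl
    · exact preLieSeries_zero_right b
  simp only [twisted, preLieSeries_add_left, preLieSeries_add_right, hl, hr,
    preLieSeries_edgeGraph, ite_self, GraphSeries.zero_add, Finset.sum_add_distrib]
  rw [sum_antidiagonal_fst_zero r fun j => preLieSeries (edgeGraph d) (m j),
    sum_antidiagonal_swap_eq r fun j i => if j = 0 then preLieSeries (m i) (edgeGraph d) else 0,
    sum_antidiagonal_fst_zero r fun j => preLieSeries (m j) (edgeGraph d)]
  exact (GraphSeries.add_left_comm_assoc _ _ _).trans h

end

namespace NPDomain
variable {n : ℕ} (D : NPDomain n)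

theorem deformed_sRep {m : ℕ → GraphSeries ((n : ℤ) + 1)} (hf : ∀ r, HasFiniteEdges (m r))
    (r : ℕ) : D.deformed (fun r => D.sRep (m r)) r = D.sRep (twisted m r) := by
  rw [deformed, twisted]
  split_ifs with h
  · rw [D.sRep_add (hasFiniteEdges_edgeGraph _) (hf r), sRep_edgeGraph, h]
  · rw [GraphSeries.zero_add]

/-- Every condition on cochains is the image under `sRep` of an identity between graphs. Finiteness
of edges is what makes `sRep` additive, so that it can be applied termwise. -/
theorem isFormalUniversalDeformation_sRep {m : ℕ → GraphSeries ((n : ℤ) + 1)}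
    (hm : IsFormalMaurerCartan m) (hf : ∀ r, HasFiniteEdges (m r)) :
    D.IsFormalUniversalDeformation fun r => D.sRep (m r) := by
  have hfb : ∀ a b : GraphSeries ((n : ℤ) + 1), HasDegree 1 a → HasDegree 1 b → HasFiniteEdges a →
      HasFiniteEdges b → HasFiniteEdges (bracket a b) := fun a b ha hb hfa hfb' => by
    rw [bracket_eq ha hb]
    exact hasFiniteEdges_add (hfa.preLieSeries hfb') (hfb'.preLieSeries hfa)
  refine ⟨fun r => D.isCE_sRep (hm.mem r) (hm.degree r) (hf r), fun r P x X hX => ?_, ⟨fun r => ?_,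
    fun r P x X hX => ?_⟩, twisted m, fun r => ⟨twisted_mem hm.mem r, hasDegree_twisted hm.degree r,
    hasFiniteEdges_twisted hf r⟩, fun r => ?_, D.deformed_sRep hf⟩
  · have h : D.sRep (bracket (edgeGraph _) (m r) + (1 / 2 : ℝ) •
        ∑ ij ∈ Finset.HasAntidiagonal.antidiagonal r, bracket (m ij.1) (m ij.2)) P X =
        D.sRep 0 P X := congrArg (fun g => D.sRep g P X) (hm.eqn r)
    have hs : HasFiniteEdges (∑ ij ∈ Finset.HasAntidiagonal.antidiagonal r,
        bracket (m ij.1) (m ij.2)) := hasFiniteEdges_sum _ _ fun ij _ =>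
      hfb _ _ (hm.degree _) (hm.degree _) (hf _) (hf _)
    have hs' : HasFiniteEdges ((1 / 2 : ℝ) • ∑ ij ∈ Finset.HasAntidiagonal.antidiagonal r,
        bracket (m ij.1) (m ij.2)) := fun p => (hs p).subset fun k hk h0 => hk (by
      rw [Pi.smul_apply, Pi.smul_apply, h0, smul_zero])
    rw [D.sRep_zero, D.sRep_add (hfb _ _ (hasDegree_edgeGraph _) (hm.degree r)
      (hasFiniteEdges_edgeGraph _) (hf r)) hs', D.sRep_smul _ _ hs, D.sRep_sum _ _ fun ij _ =>
      hfb _ _ (hm.degree _) (hm.degree _) (hf _) (hf _)] at h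
    rw [← sRep_edgeGraph, D.nrBracket_sRep (hasDegree_edgeGraph _) (hm.degree r)
      (hasFiniteEdges_edgeGraph _) (hf r) P x X hX, Finset.sum_congr rfl fun ij _ =>
      D.nrBracket_sRep (hm.degree ij.1) (hm.degree ij.2) (hf ij.1) (hf ij.2) P x X hX]
    simpa [sum_apply, Finset.sum_apply] using h
  · rw [D.deformed_sRep hf]
    exact D.isCE_sRep (twisted_mem hm.mem r) (hasDegree_twisted hm.degree r)
      (hasFiniteEdges_twisted hf r)
  · simp only [D.deformed_sRep hf]
    rw [Finset.sum_congr rfl fun ij _ => D.nrProd_sRep (hasDegree_twisted hm.degree ij.2)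
      (hasFiniteEdges_twisted hf ij.1) (hasFiniteEdges_twisted hf ij.2) P x X hX]
    have h := congrArg (fun g => D.sRep g P X) (sum_preLieSeries_twisted hm r)
    rw [D.sRep_zero, D.sRep_sum _ _ fun ij _ => (hasFiniteEdges_twisted hf ij.1).preLieSeries
      (hasFiniteEdges_twisted hf ij.2)] at h
    simpa [sum_apply, Finset.sum_apply] using h
  · rw [sum_bracket_eq (hasDegree_twisted hm.degree), sum_preLieSeries_twisted hm,
      GraphSeries.smul_zero]

/-- An edge has degree `-n ≠ 0`, so for fixed arity and degree at most one number of edges can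
occur. -/
theorem hasFiniteEdges_of_hasDegree (hn : 1 ≤ n) {i : ℤ} {m : GraphSeries ((n : ℤ) + 1)}
    (hm : HasDegree i m) : HasFiniteEdges m := by
  intro p
  refine Set.Subsingleton.finite fun k hk l hl => ?_
  have h : ∀ k, m p k ≠ 0 → graphDegree ((n : ℤ) + 1) p k = i := fun k hk => by_contra fun h =>
    hk (hm p k h)
  have h2 := (h k hk).trans (h l hl).symm
  have hn0 : (n : ℤ) ≠ 0 := by exact_mod_cast (by omega : n ≠ 0)
  have h3 : (n : ℤ) * k = n * l := by
    simp only [graphDegree] at h2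
    linear_combination -h2
  exact_mod_cast mul_left_cancel₀ hn0 h3

theorem isUniversalDeformation_of_formal {c : ℕ → Cochains D.Fun}
    (h : D.IsFormalUniversalDeformation c) : D.IsUniversalDeformation (c 0) := by
  obtain ⟨γ, h1, h2, h3⟩ := h.universal
  refine ⟨h.cochain 0, fun P x X hX => ?_, ⟨?_, fun P x X hX => ?_⟩, γ 0, (h1 0).1, (h1 0).2.1,
    (h1 0).2.2, ?_, h3 0⟩
  · simpa using h.maurerCartan 0 P x X hX
  · exact h.lieInfty.cochain 0
  · have h' := h.lieInfty.jacobi 0 P x X hX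
    rw [Finset.Nat.antidiagonal_zero, Finset.sum_singleton] at h'
    exact h'
  · simpa using h2 0

end NPDomain

/-! ### Ordinary Maurer–Cartan elements as formal ones -/

theorem bracket_zero_left {d : ℤ} (m : GraphSeries d) : bracket 0 m = 0 := by
  funext P K
  simp [bracket, preLie_zero_left, preLie_zero_right]

theorem bracket_zero_right {d : ℤ} (m : GraphSeries d) : bracket m 0 = 0 := by
  funext P K
  simp [bracket, preLie_zero_left, preLie_zero_right]

theorem IsMaurerCartan.formal {d : ℤ} {m : GraphSeries d} (hm : IsMaurerCartan m) :
    IsFormalMaurerCartan fun r => if r = 0 then m else 0 := by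
  refine ⟨fun r => ?_, fun r => ?_, fun r => ?_⟩
  · split_ifs
    · exact hm.mem
    · exact zero_mem _
  · split_ifs
    · exact hm.degree
    · exact hasDegree_zero
  · have hl : ∀ (i : ℕ) (b : GraphSeries d), bracket (if i = 0 then m else 0) b =
        if i = 0 then bracket m b else 0 := fun i b => by
      split_ifs
      · rfl
      · exact bracket_zero_left b
    simp only [hl]
    rw [sum_antidiagonal_fst_zero r fun j => bracket m (if j = 0 then m else 0), differential]
    split_ifs
    · exact hm.eqn
    · rw [bracket_zero_right, bracket_zero_right, GraphSeries.smul_zero, GraphSeries.add_zero]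

theorem bracket_edgePart {d : ℤ} (a b : ℕ) (m m' : GraphSeries d) (P K : ℕ) (hK : a + b ≠ K) :
    bracket (edgePart a m) (edgePart b m') P K = 0 := by
  refine Finset.sum_eq_zero fun x _ => Finset.sum_eq_zero fun y _ => ?_
  have hy := Finset.HasAntidiagonal.mem_antidiagonal.1 y.2
  have h : edgePart a m x.1.1 y.1.1 = 0 ∨ edgePart b m' x.1.2 y.1.2 = 0 := by
    by_cases h1 : y.1.1 = a
    · exact Or.inr (if_neg fun h2 => hK (by omega))
    · exact Or.inl (if_neg h1)
  rcases h with h | h <;> rw [h] <;> simp [preLie_zero_left, preLie_zero_right]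

/-- The bracket is homogeneous for the number of edges, so a component with `K` edges only involves
parts whose numbers of edges add up to `K`. -/
theorem bracket_apply_eq_sum {d : ℤ} (m m' : GraphSeries d) (P K : ℕ) :
    bracket m m' P K = ∑ ab ∈ Finset.HasAntidiagonal.antidiagonal K,
      bracket (edgePart ab.1 m) (edgePart ab.2 m') P K := by
  unfold bracket
  refine Eq.trans ?_ Finset.sum_comm
  refine Finset.sum_congr rfl fun x _ => ?_
  refine Eq.trans ?_ Finset.sum_comm
  refine Finset.sum_congr rfl fun y _ => ?_
  symm
  refine (Finset.sum_eq_single y.1 (fun ab hab hne => ?_) fun h => absurd y.2 h).trans ?_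
  · have hy := Finset.HasAntidiagonal.mem_antidiagonal.1 y.2
    have hab' := Finset.HasAntidiagonal.mem_antidiagonal.1 hab
    have h1 : y.1.1 ≠ ab.1 := fun h => hne (Prod.ext h.symm (by omega))
    have h : edgePart ab.1 m x.1.1 y.1.1 = 0 := if_neg h1
    rw [h]
    simp [preLie_zero_left, preLie_zero_right]
  · simp [edgePart]

theorem edgePart_mem {d : ℤ} {m : GraphSeries d} (hm : m ∈ fGC d) (a : ℕ) : edgePart a m ∈ fGC d := by
  intro p k σ
  by_cases h : k = a
  · subst h
    simpa [edgePart] using hm p k σ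
  · simp [edgePart, h]

theorem hasDegree_edgePart {d i : ℤ} {m : GraphSeries d} (hm : HasDegree i m) (a : ℕ) :
    HasDegree i (edgePart a m) := fun p k h => by
  simp only [edgePart, hm p k h, ite_self]

theorem hasFiniteEdges_edgePart {d : ℤ} (m : GraphSeries d) (a : ℕ) :
    HasFiniteEdges (edgePart a m) := fun p =>
  (Set.finite_singleton a).subset fun k hk => by
    by_contra h
    exact hk (if_neg h)

theorem edgePart_edgeGraph (d : ℤ) (a : ℕ) :
    edgePart a (edgeGraph d) = if a = 1 then edgeGraph d else 0 := by
  funext p k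
  by_cases ha : a = 1
  · subst ha
    by_cases hk : k = 1
    · simp [edgePart, hk]
    · simp only [edgePart, if_neg hk, if_true]
      exact (edgeGraph_eq_zero d fun h => hk h.2).symm
  · simp only [edgePart, if_neg ha]
    split_ifs with h
    · exact edgeGraph_eq_zero d fun hh => ha (h ▸ hh.2)
    · rfl

/-- For `d = 1`, an element of degree `1` has no part without edges. -/
theorem edgePart_zero_eq_zero {m : GraphSeries 1} (hm : m ∈ fGC 1) (hd : HasDegree 1 m) :
    edgePart 0 m = 0 := by
  funext p k
  by_cases hk : k = 0
  · subst hk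
    by_cases hp : p = 1
    · subst hp
      -- For `d = 1` the degree of a graph is its number of vertices minus one, so two vertices
      -- remain. Exchanging them fixes the edgeless graph, while invariance with the sign twist
      -- requires it to change sign.
      have h := hm 1 0 (Equiv.swap 0 1)
      have hact : Gra.act 1 (Equiv.swap (0 : Fin 2) 1) (m 1 0) = m 1 0 := by
        induction m 1 0 using Gra.induction with
        | zero => simp
        | add a b ha hb => rw [map_add, ha, hb]
        | smul c a ha => rw [map_smul, ha]
        | mk G =>
          rw [Gra.act_mk]
          congr 1
          exact Subsingleton.elim _ _
      rw [hact, Equiv.Perm.sign_swap (by decide), zpow_one, Units.neg_smul, one_smul] at h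
      have h2 : (2 : ℝ) • m 1 0 = 0 := by
        rw [two_smul]; nth_rewrite 1 [← h]; exact neg_add_cancel _
      simpa [edgePart] using h2
    · have : m p 0 = 0 := hd p 0 fun h => hp (by simpa [graphDegree] using h)
      simpa [edgePart] using this
  · simp [edgePart, hk]

/-- The coefficient of `ε ^ r` is the component with `r + 2` edges of the Maurer–Cartan equation:
`Γ` adds one edge to the part with `r + 1`, and the parts with `i + 1` and `j + 1` edges pair to `r
+ 2` when `i + j = r`. -/
theorem IsMaurerCartan.formal_edgePart {m : GraphSeries 1} (hm : IsMaurerCartan m) :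
    IsFormalMaurerCartan fun r => edgePart (r + 1) m := by
  refine ⟨fun r => edgePart_mem hm.mem _, fun r => hasDegree_edgePart hm.degree _, fun r => ?_⟩
  have h1 : edgeGraph 1 = edgePart 1 (edgeGraph 1) := by rw [edgePart_edgeGraph, if_pos rfl]
  have hsum : ∀ P K, (∑ ij ∈ Finset.HasAntidiagonal.antidiagonal r,
      bracket (edgePart (ij.1 + 1) m) (edgePart (ij.2 + 1) m)) P K =
      ∑ ij ∈ Finset.HasAntidiagonal.antidiagonal r,
        bracket (edgePart (ij.1 + 1) m) (edgePart (ij.2 + 1) m) P K := fun P K => by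
    simp only [Finset.sum_apply]
  funext P K
  simp only [differential, Pi.add_apply, Pi.smul_apply, hsum, Pi.zero_apply]
  by_cases hK : K = r + 2
  · subst hK
    have h := congrFun (congrFun hm.eqn P) (r + 2)
    simp only [differential, Pi.add_apply, Pi.smul_apply, Pi.zero_apply] at h
    have hsingle : ∑ ab ∈ Finset.HasAntidiagonal.antidiagonal (r + 2),
        bracket (edgePart ab.1 (edgeGraph 1)) (edgePart ab.2 m) P (r + 2) =
        bracket (edgeGraph 1) (edgePart (r + 1) m) P (r + 2) := by
      rw [Finset.sum_eq_single (1, r + 1)]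
      · rw [← h1]
      · rintro ⟨a, b⟩ hab hne
        have hab' := Finset.HasAntidiagonal.mem_antidiagonal.1 hab
        simp only at hab' ⊢
        rw [edgePart_edgeGraph, if_neg fun ha => hne (Prod.ext ha (by simp only; omega)),
          bracket_zero_left]
        rfl
      · intro hn
        exact absurd (Finset.HasAntidiagonal.mem_antidiagonal.2 (by omega)) hn
    -- The two ends of the antidiagonal of `r + 2` contain the edgeless part and vanish; the
    -- remaining pairs are those of the antidiagonal of `r`, with both entries raised by one.
    rw [bracket_apply_eq_sum, bracket_apply_eq_sum m m, hsingle,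
      Finset.Nat.antidiagonal_succ_succ', Finset.sum_cons, Finset.sum_cons, Finset.sum_map] at h
    simpa [edgePart_zero_eq_zero hm.mem hm.degree, bracket_zero_left, bracket_zero_right] using h
  · rw [h1, bracket_edgePart _ _ _ _ _ _ (by omega), Finset.sum_eq_zero, smul_zero, add_zero]
    intro ij hij
    have := Finset.HasAntidiagonal.mem_antidiagonal.1 hij
    exact bracket_edgePart _ _ _ _ _ _ (by omega)

end NPGraph

end

theorem mainTheorem4 (n : ℕ) (D : NPGraph.NPDomain n) :
    (1 ≤ n → ∀ m : NPGraph.GraphSeries ((n : ℤ) + 1), NPGraph.IsMaurerCartan m →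
      D.IsUniversalDeformation (D.sRep m)) ∧
    (n = 0 → ∀ m : NPGraph.GraphSeries ((n : ℤ) + 1), NPGraph.IsMaurerCartan m →
      D.IsFormalUniversalDeformation fun r => D.sRep (NPGraph.edgePart (r + 1) m)) ∧
    (∀ m : ℕ → NPGraph.GraphSeries ((n : ℤ) + 1), NPGraph.IsFormalMaurerCartan m →
      (∀ r, NPGraph.HasFiniteEdges (m r)) →
      D.IsFormalUniversalDeformation fun r => D.sRep (m r)) := by
  refine ⟨fun hn m hm => ?_, fun hn m hm => ?_, fun m hm hf =>
    D.isFormalUniversalDeformation_sRep hm hf⟩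
  · refine D.isUniversalDeformation_of_formal (D.isFormalUniversalDeformation_sRep hm.formal
      fun r => NPGraph.NPDomain.hasFiniteEdges_of_hasDegree hn (hm.formal.degree r))
  · subst hn
    exact D.isFormalUniversalDeformation_sRep hm.formal_edgePart fun r =>
      NPGraph.hasFiniteEdges_edgePart m (r + 1)
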